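/- Setting. Let $F\subseteq\mathbb R$ be a subfield, let $\Phi$ be a finite (not necessarily crystallographic or reduced) root system with basis $B$ in the $F$-vector space $V=\mathrm{span}_F(\Phi)$, all evaluations $\langle\beta,\alpha^\vee\rangle$ of co-roots on roots lying in $F$, and let $\Lambda\neq 0$ be a totally ordered abelian group that is an ordered $F$-module. Let $\mathbb A=V\otimes_F\Lambda$, let $\overline W$ be the spherical Weyl group acting on $\mathbb A$, let $T\le\mathbb A$ be a $\overline W$-invariant group of translations, $W_T=\overline W\ltimes T$ and $W=\overline W\ltimes\mathbb A$. Half-apartments of $\mathbb A$ are the sets $\{x:\langle x,\alpha^\vee\rangle\ge k\}$ and walls the sets $\{x:\langle x,\alpha^\vee\rangle=k\}$ ($\alpha\in\Phi$, $k\in\Lambda$); closed convex sets are finite intersections of half-apartments; Weyl chambers are the $W$-images of $C_f=\{x:\langle x,\alpha^\vee\rangle\ge 0\ \forall \alpha\in B\}$ (the image of $0$ is the base point), and panels are the $W$-images of the codimension-one faces of $C_f$. Let $d$ be a $W$-invariant $\Lambda$-metric on $\mathbb A$ which is topologically equivalent to the modified Minkowski metric $\sum_{\alpha\in\Phi}|\langle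 x-y,\alpha^\vee\rangle|$ and geodesic in the following sense: $d(0,v\otimes(a+b))=d(0,v\otimes a)+d(0,v\otimes b)$ for $v\in V$ and $a,b\ge 0$ in $\Lambda$; and for all $x,y\in\mathbb A$ one can write $y-x=\sum_{i=1}^m v_i\otimes a_i$ with $v_i\in V$, $a_i\ge 0$ in $\Lambda$ and $d(x,y)=\sum_i d(0,v_i\otimes a_i)$. (The modified Minkowski metric itself has these properties, and so has the Euclidean metric for $F=\Lambda=\mathbb R$.) Let $X$ be a set and $\mathcal A$ a set of injective maps (charts) $\mathbb A\to X$; apartments are the images of charts, and Weyl chambers, panels, half-apartments and walls of $X$ are the images of those of $\mathbb A$ under charts. The distance $d(x,y)$ of two points of $X$ is the distance of their preimages under a chart whose image contains both. The germ at $x$ of an $x$-based Weyl chamber $S$ is the class of all $x$-based Weyl chambers $S'$ such that $S\cap S'$ is a neighbourhood of $x$ in $S$ and in $S'$; it is contained in $Y\subseteq X$ if $S\cap B_\varepsilon(x)\subseteq Y$ for some $\varepsilon>0$ in $\Lambda$. Consider the conditions: * (A1) $f\circ w\in\mathcal A$ for $f\in\mathcal A$, $w\in W_T$. * (A2) If $f,g\in\mathcal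 A$ and $f(\mathbb A)\cap g(\mathbb A)\ne\emptyset$, then $f^{-1}(g(\mathbb A))$ is closed convex and some $w\in W_T$ satisfies $f=g\circ w$ on $f^{-1}(g(\mathbb A))$. * (A3) Any two points of $X$ lie in a common apartment. * (A4) Any two Weyl chambers contain sub-Weyl chambers lying in a common apartment. * (A5) For every apartment $A$ and $x\in A$ there is a retraction $r:X\to A$ that does not increase distances and satisfies $r^{-1}(x)=\{x\}$. * (TI) The distance on $X$ satisfies the triangle inequality. * (SC) If a Weyl chamber $S$ meets an apartment $A_1$ exactly in a panel $P$ of $S$ and $M$ is the wall of $A_1$ containing $P$, then there are apartments $A_2\ne A_3$ with $M\cup S\subseteq A_j$ and $A_1\cap A_j$ a half-apartment $(j=2,3)$. * (ALA) For every point $x$ and every germ $\mu$ of a Weyl chamber some apartment contains $x$ and $\mu$. * (FC) For all $x,y,z\in X$ and all apartments $A$ containing $x,y$ the segment $\{p\in A: d(x,y)=d(x,p)+d(p,y)\}$ is contained in a finite union of $z$-based Weyl chambers. Proposition. Suppose that $(X,\mathcal A)$ satisfies either (A1), (A2), (A3), (A4), (TI) and (SC), or (A1), (A2), (ALA) and (FC).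 Let $A$ be an apartment and $\mu$ a germ of a Weyl chamber that is contained in $A$. Then the retraction $r_{A,\mu}$ onto $A$ centered at $\mu$ is well defined and distance non-increasing: every point of $X$ lies in $g(\mathbb A)$ for some $g\in\mathcal A$ with $\mu$ contained in $g(\mathbb A)$; there is exactly one map $r=r_{A,\mu}:X\to X$ such that $r(g(a))=f(w(a))$ for all $a\in\mathbb A$, all such $g$, all $f\in\mathcal A$ with $f(\mathbb A)=A$ and all $w\in W_T$ with $g=f\circ w$ on $g^{-1}(A)$; and $d(r(y),r(z))\le d(y,z)$ for all $y,z\in X$. Moreover (A5) holds. -/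

import Mathlib

open scoped TensorProduct

noncomputable section

namespace GenBuilding

/-! ### The model space

`P` is a finite root system over a subfield `F` of the reals (so that `F` contains all evaluations
of co-roots on roots), in the `F`-vector space `V` spanned by the roots, and `Λ` is a totally
ordered abelian group that is an ordered `F`-module. -/

variable {F : Subfield ℝ} {ι V N Λ X : Type*} [Fintype ι]
  [AddCommGroup V] [Module F V] [AddCommGroup N] [Module F N]
  [AddCommGroup Λ] [LinearOrder Λ] [IsOrderedAddMonoid Λ] [Module F Λ]

/-- The set `B` of (indices of) roots is a basis of the root system: it is linearly independent and
every root is a linear combination of `B` with coefficients that are all `≥ 0` or all `≤ 0`. -/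
def IsRootBasis (P : RootPairing ι F V N) (B : Set ι) : Prop :=
  LinearIndepOn F P.root B ∧
    ∀ i, ∃ c : ι → F, (∀ j, j ∉ B → c j = 0) ∧ P.root i = ∑ j, c j • P.root j ∧
      ((∀ j, 0 ≤ c j) ∨ (∀ j, c j ≤ 0))

/-- The evaluation `x ↦ ⟨x, αᵢ^∨⟩ ∈ Λ` of the `i`-th co-root on the model space `V ⊗ Λ`. -/
def ev (P : RootPairing ι F V N) (i : ι) : V ⊗[F] Λ →ₗ[F] Λ :=
  (TensorProduct.lid F Λ).toLinearMap ∘ₗ (P.coroot' i).rTensor Λ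

/-- The spherical Weyl group, generated by the reflections in the roots. -/
def weyl (P : RootPairing ι F V N) : Subgroup (V ≃ₗ[F] V) :=
  Subgroup.closure (Set.range P.reflection)

/-- The action of a linear automorphism of `V` on the model space `V ⊗ Λ`. -/
def act (Λ : Type*) [AddCommGroup Λ] [Module F Λ] (w : V ≃ₗ[F] V) : V ⊗[F] Λ →ₗ[F] V ⊗[F] Λ :=
  w.toLinearMap.rTensor Λ

/-- `T` is a translation group that is invariant under the spherical Weyl group. -/
def WeylInvariant (P : RootPairing ι F V N) (T : AddSubgroup (V ⊗[F] Λ)) : Prop :=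
  ∀ w ∈ weyl P, ∀ t ∈ T, act Λ w t ∈ T

/-- The elements of the affine Weyl group with translation part `T`, as maps of the model space. For
`T = ⊤` this is the full affine Weyl group. -/
def affineWeyl (P : RootPairing ι F V N) (T : AddSubgroup (V ⊗[F] Λ)) :
    Set (V ⊗[F] Λ → V ⊗[F] Λ) :=
  {φ | ∃ w ∈ weyl P, ∃ t ∈ T, φ = fun x => act Λ w x + t}

/-- The fundamental Weyl chamber of the basis `B`. -/
def fundChamber (P : RootPairing ι F V N) (B : Set ι) : Set (V ⊗[F] Λ) :=
  {x | ∀ i ∈ B, 0 ≤ ev P i x}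

/-- The panel (face of codimension one) of the fundamental chamber that belongs to `i ∈ B`. -/
def fundPanel (P : RootPairing ι F V N) (B : Set ι) (i : ι) : Set (V ⊗[F] Λ) :=
  {x ∈ fundChamber P B | ev P i x = 0}

/-- Hyperplanes (walls) of the model space. -/
def hyperplane (P : RootPairing ι F V N) (i : ι) (k : Λ) : Set (V ⊗[F] Λ) :=
  {x | ev P i x = k}

/-- Half-apartments of the model space. (The other side of the wall is obtained from the root
`-αᵢ`.) -/
def halfSpace (P : RootPairing ι F V N) (i : ι) (k : Λ) : Set (V ⊗[F] Λ) :=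
  {x | k ≤ ev P i x}

/-- Closed convex subsets of the model space: intersections of finitely many half-apartments. -/
def IsClosedConvex (P : RootPairing ι F V N) (Y : Set (V ⊗[F] Λ)) : Prop :=
  ∃ s : Finset (ι × Λ), Y = ⋂ p ∈ s, halfSpace P p.1 p.2

/-- The modified Minkowski metric `d(x, y) = ∑_α |⟨x - y, α^∨⟩|`. -/
def minkowski (P : RootPairing ι F V N) (x y : V ⊗[F] Λ) : Λ :=
  ∑ i, |ev P i (x - y)|

/-- The metrics that the model space may carry: `Λ`-metrics that are invariant under the full affine
Weyl group, topologically equivalent to the modified Minkowski metric, additive along the rays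
`{v ⊗ a | 0 ≤ a}`, and such that any two points are joined by a geodesic that is composed of
finitely many segments of such rays (and their translates). -/
structure IsModelMetric (P : RootPairing ι F V N) (d : V ⊗[F] Λ → V ⊗[F] Λ → Λ) : Prop where
  eq_zero_iff : ∀ x y, d x y = 0 ↔ x = y
  symm : ∀ x y, d x y = d y x
  triangle : ∀ x y z, d x y ≤ d x z + d z y
  invariant : ∀ φ ∈ affineWeyl P (⊤ : AddSubgroup (V ⊗[F] Λ)), ∀ x y, d (φ x) (φ y) = d x y
  finer : ∀ ε : Λ, 0 < ε → ∃ δ : Λ, 0 < δ ∧ ∀ x y, d x y < δ → minkowski P x y < ε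
  coarser : ∀ ε : Λ, 0 < ε → ∃ δ : Λ, 0 < δ ∧ ∀ x y, minkowski P x y < δ → d x y < ε
  ray : ∀ (v : V) (a b : Λ), 0 ≤ a → 0 ≤ b →
    d 0 (v ⊗ₜ[F] (a + b)) = d 0 (v ⊗ₜ[F] a) + d 0 (v ⊗ₜ[F] b)
  geodesic : ∀ x y, ∃ l : List (V × Λ), (∀ p ∈ l, 0 ≤ p.2) ∧
    y - x = (l.map fun p => p.1 ⊗ₜ[F] p.2).sum ∧
    d x y = (l.map fun p => d 0 (p.1 ⊗ₜ[F] p.2)).sum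

/-! ### Spaces modelled on the model space

An atlas is a set `𝒜` of charts `V ⊗ Λ → X` (their injectivity is a hypothesis of the theorem). -/

/-- Apartments are the images of the charts. -/
def IsApartment (𝒜 : Set (V ⊗[F] Λ → X)) (A : Set X) : Prop :=
  ∃ f ∈ 𝒜, A = Set.range f

/-- `S` is a Weyl chamber of `X` with base point `x`. -/
def IsChamberAt (P : RootPairing ι F V N) (B : Set ι) (𝒜 : Set (V ⊗[F] Λ → X))
    (S : Set X) (x : X) : Prop :=
  ∃ f ∈ 𝒜, ∃ w ∈ weyl P, ∃ a : V ⊗[F] Λ,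
    S = (fun c => f (act Λ w c + a)) '' fundChamber P B ∧ x = f a

/-- `S` is a Weyl chamber of `X`, and `Q` is one of its panels. -/
def IsPanelOf (P : RootPairing ι F V N) (B : Set ι) (𝒜 : Set (V ⊗[F] Λ → X))
    (Q S : Set X) : Prop :=
  ∃ f ∈ 𝒜, ∃ w ∈ weyl P, ∃ a : V ⊗[F] Λ, ∃ i ∈ B,
    S = (fun c => f (act Λ w c + a)) '' fundChamber P B ∧
    Q = (fun c => f (act Λ w c + a)) '' fundPanel P B i

/-- `H` is a half-apartment of `X`. -/
def IsHalfApartment (P : RootPairing ι F V N) (𝒜 : Set (V ⊗[F] Λ → X)) (H : Set X) : Prop :=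
  ∃ f ∈ 𝒜, ∃ (i : ι) (k : Λ), H = f '' halfSpace P i k

open Classical in
/-- The distance function on `X` induced by the metric `d` of the model space: the distance of the
preimages under a chart whose apartment contains both points. -/
def idist (d : V ⊗[F] Λ → V ⊗[F] Λ → Λ) (𝒜 : Set (V ⊗[F] Λ → X)) (x y : X) : Λ :=
  if h : ∃ r : Λ, ∃ f ∈ 𝒜, ∃ a b, f a = x ∧ f b = y ∧ d a b = r then h.choose else 0

/-- The map `r` does not increase distances. -/
def NonIncreasing (d : V ⊗[F] Λ → V ⊗[F] Λ → Λ) (𝒜 : Set (V ⊗[F] Λ → X)) (r : X → X) : Prop :=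
  ∀ y z, idist d 𝒜 (r y) (r z) ≤ idist d 𝒜 y z

/-- The `ε`-ball around `x`. -/
def ball (d : V ⊗[F] Λ → V ⊗[F] Λ → Λ) (𝒜 : Set (V ⊗[F] Λ → X)) (x : X) (ε : Λ) : Set X :=
  {y | idist d 𝒜 x y < ε}

/-- The germ at `x` of the `x`-based Weyl chamber `S`: the class of all `x`-based Weyl chambers `S'`
such that `S ∩ S'` is a neighbourhood of `x` in `S` and in `S'`. -/
def germ (P : RootPairing ι F V N) (B : Set ι) (d : V ⊗[F] Λ → V ⊗[F] Λ → Λ)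
    (𝒜 : Set (V ⊗[F] Λ → X)) (S : Set X) (x : X) : Set (Set X) :=
  {S' | IsChamberAt P B 𝒜 S' x ∧
    ∃ ε : Λ, 0 < ε ∧ S ∩ ball d 𝒜 x ε ⊆ S ∩ S' ∧ S' ∩ ball d 𝒜 x ε ⊆ S ∩ S'}

/-- `μ` is a germ at `x` of a Weyl chamber. -/
def IsChamberGerm (P : RootPairing ι F V N) (B : Set ι) (d : V ⊗[F] Λ → V ⊗[F] Λ → Λ)
    (𝒜 : Set (V ⊗[F] Λ → X)) (μ : Set (Set X)) (x : X) : Prop :=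
  ∃ S, IsChamberAt P B 𝒜 S x ∧ μ = germ P B d 𝒜 S x

/-- The germ `μ` at `x` is contained in the set `Y`. -/
def GermIn (d : V ⊗[F] Λ → V ⊗[F] Λ → Λ) (𝒜 : Set (V ⊗[F] Λ → X))
    (μ : Set (Set X)) (x : X) (Y : Set X) : Prop :=
  ∃ S ∈ μ, ∃ ε : Λ, 0 < ε ∧ S ∩ ball d 𝒜 x ε ⊆ Y

/-! ### The axioms -/

/-- (A1): the atlas is invariant under precomposition with the affine Weyl group. -/
def A1 (P : RootPairing ι F V N) (T : AddSubgroup (V ⊗[F] Λ)) (𝒜 : Set (V ⊗[F] Λ → X)) : Prop :=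
  ∀ f ∈ 𝒜, ∀ w ∈ affineWeyl P T, f ∘ w ∈ 𝒜

/-- (A2): compatibility of charts. -/
def A2 (P : RootPairing ι F V N) (T : AddSubgroup (V ⊗[F] Λ)) (𝒜 : Set (V ⊗[F] Λ → X)) : Prop :=
  ∀ f ∈ 𝒜, ∀ g ∈ 𝒜, (Set.range f ∩ Set.range g).Nonempty →
    IsClosedConvex P (f ⁻¹' Set.range g) ∧
    ∃ w ∈ affineWeyl P T, ∀ a ∈ f ⁻¹' Set.range g, f a = g (w a)

/-- (A3): any two points lie in a common apartment. -/
def A3 (𝒜 : Set (V ⊗[F] Λ → X)) : Prop :=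
  ∀ x y : X, ∃ f ∈ 𝒜, x ∈ Set.range f ∧ y ∈ Set.range f

/-- (A4): any two Weyl chambers have sub-Weyl chambers in a common apartment. -/
def A4 (P : RootPairing ι F V N) (B : Set ι) (𝒜 : Set (V ⊗[F] Λ → X)) : Prop :=
  ∀ S x S' x', IsChamberAt P B 𝒜 S x → IsChamberAt P B 𝒜 S' x' →
    ∃ C y C' y', IsChamberAt P B 𝒜 C y ∧ IsChamberAt P B 𝒜 C' y' ∧ C ⊆ S ∧ C' ⊆ S' ∧
      ∃ f ∈ 𝒜, C ⊆ Set.range f ∧ C' ⊆ Set.range f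

/-- (A5): retractions onto apartments, centered at points. -/
def A5 (d : V ⊗[F] Λ → V ⊗[F] Λ → Λ) (𝒜 : Set (V ⊗[F] Λ → X)) : Prop :=
  ∀ A, IsApartment 𝒜 A → ∀ x ∈ A, ∃ r : X → X,
    (∀ y, r y ∈ A) ∧ (∀ y ∈ A, r y = y) ∧ NonIncreasing d 𝒜 r ∧ r ⁻¹' {x} = {x}

/-- (TI): the triangle inequality for the induced distance function. -/
def TI (d : V ⊗[F] Λ → V ⊗[F] Λ → Λ) (𝒜 : Set (V ⊗[F] Λ → X)) : Prop :=
  ∀ x y z, idist d 𝒜 x y ≤ idist d 𝒜 x z + idist d 𝒜 z y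

/-- (SC): the sundial configuration. If a Weyl chamber `S` meets the apartment of `f₁` exactly in a
panel `Q` of `S`, and `M` is the wall of that apartment containing `Q`, then there are two different
apartments that contain `M ∪ S` and meet the apartment of `f₁` in half-apartments. -/
def SC (P : RootPairing ι F V N) (B : Set ι) (𝒜 : Set (V ⊗[F] Λ → X)) : Prop :=
  ∀ f₁ ∈ 𝒜, ∀ S, IsPanelOf P B 𝒜 (S ∩ Set.range f₁) S →
    ∀ (i : ι) (k : Λ), S ∩ Set.range f₁ ⊆ f₁ '' hyperplane P i k →
      ∃ f₂ ∈ 𝒜, ∃ f₃ ∈ 𝒜, Set.range f₂ ≠ Set.range f₃ ∧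
        IsHalfApartment P 𝒜 (Set.range f₁ ∩ Set.range f₂) ∧
        IsHalfApartment P 𝒜 (Set.range f₁ ∩ Set.range f₃) ∧
        f₁ '' hyperplane P i k ∪ S ⊆ Set.range f₂ ∧
        f₁ '' hyperplane P i k ∪ S ⊆ Set.range f₃

/-- (ALA): almost a large atlas. -/
def ALA (P : RootPairing ι F V N) (B : Set ι) (d : V ⊗[F] Λ → V ⊗[F] Λ → Λ)
    (𝒜 : Set (V ⊗[F] Λ → X)) : Prop :=
  ∀ (x y : X) (μ : Set (Set X)), IsChamberGerm P B d 𝒜 μ y →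
    ∃ f ∈ 𝒜, x ∈ Set.range f ∧ GermIn d 𝒜 μ y (Set.range f)

/-- (FC): the finite cover condition for segments of apartments. -/
def FC (P : RootPairing ι F V N) (B : Set ι) (d : V ⊗[F] Λ → V ⊗[F] Λ → Λ)
    (𝒜 : Set (V ⊗[F] Λ → X)) : Prop :=
  ∀ x y z : X, ∀ A, IsApartment 𝒜 A → x ∈ A → y ∈ A →
    ∃ 𝒞 : Set (Set X), 𝒞.Finite ∧ (∀ S ∈ 𝒞, IsChamberAt P B 𝒜 S z) ∧
      {p ∈ A | idist d 𝒜 x y = idist d 𝒜 x p + idist d 𝒜 p y} ⊆ ⋃₀ 𝒞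

/-! ### Retractions centered at germs -/

/-- `r` is the retraction onto the apartment `A` centered at the germ `μ` at `x`: every point lies
in the apartment of a chart `g` that contains `μ`, and for every such `g`, every chart `f` with
image `A` and every `w` in the affine Weyl group with `g = f ∘ w` on `g⁻¹(A)`, one has
`r = f ∘ w ∘ g⁻¹` on the apartment of `g`. -/
def IsGermRetraction (P : RootPairing ι F V N) (T : AddSubgroup (V ⊗[F] Λ))
    (d : V ⊗[F] Λ → V ⊗[F] Λ → Λ) (𝒜 : Set (V ⊗[F] Λ → X))
    (A : Set X) (μ : Set (Set X)) (x : X) (r : X → X) : Prop :=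
  (∀ y, ∃ g ∈ 𝒜, y ∈ Set.range g ∧ GermIn d 𝒜 μ x (Set.range g)) ∧
  ∀ f ∈ 𝒜, Set.range f = A → ∀ g ∈ 𝒜, GermIn d 𝒜 μ x (Set.range g) →
    ∀ w ∈ affineWeyl P T, (∀ a ∈ g ⁻¹' Set.range f, g a = f (w a)) → ∀ a, r (g a) = f (w a)

/-! ### Two checks of the definitions

The induced distance does not depend on the chart, and the modified Minkowski metric satisfies the
conditions imposed on the metric of the model space. -/

set_option linter.unusedSectionVars false

/-- The induced distance is well defined. -/
theorem idist_apply (P : RootPairing ι F V N) (T : AddSubgroup (V ⊗[F] Λ))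
    (d : V ⊗[F] Λ → V ⊗[F] Λ → Λ) (hd : IsModelMetric P d)
    (𝒜 : Set (V ⊗[F] Λ → X)) (hinj : ∀ f ∈ 𝒜, Function.Injective f) (h2 : A2 P T 𝒜)
    (f : V ⊗[F] Λ → X) (hf : f ∈ 𝒜) (a b : V ⊗[F] Λ) : idist d 𝒜 (f a) (f b) = d a b := by
  have h : ∃ r : Λ, ∃ g ∈ 𝒜, ∃ a' b', g a' = f a ∧ g b' = f b ∧ d a' b' = r :=
    ⟨_, f, hf, a, b, rfl, rfl, rfl⟩
  rw [idist, dif_pos h]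
  obtain ⟨g, hg, a', b', ha, hb, hr⟩ := h.choose_spec
  rw [← hr]
  obtain ⟨-, φ, ⟨w, hw, t, -, rfl⟩, hφ⟩ := h2 f hf g hg ⟨f a, ⟨a, rfl⟩, ⟨a', ha⟩⟩
  have e1 := hinj g hg (ha.trans (hφ a ⟨a', ha⟩))
  have e2 := hinj g hg (hb.trans (hφ b ⟨b', hb⟩))
  rw [e1, e2]
  exact hd.invariant _ ⟨w, hw, t, trivial, rfl⟩ a b

theorem ev_tmul (P : RootPairing ι F V N) (i : ι) (v : V) (a : Λ) :
    ev P i (v ⊗ₜ[F] a) = P.coroot' i v • a := by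
  simp [ev]

theorem exists_perm (P : RootPairing ι F V N) (w : V ≃ₗ[F] V) (hw : w ∈ weyl P) :
    ∃ σ : Equiv.Perm ι, ∀ (i : ι) (x : V), P.coroot' i (w x) = P.coroot' (σ i) x := by
  induction hw using Subgroup.closure_induction with
  | mem w h =>
    obtain ⟨j, rfl⟩ := h
    refine ⟨P.reflectionPerm j, fun i x => ?_⟩
    rw [P.coroot'_reflectionPerm]; rfl
  | one => exact ⟨1, fun i x => rfl⟩
  | mul a b _ _ ha hb =>
    obtain ⟨σ, hσ⟩ := ha
    obtain ⟨τ, hτ⟩ := hb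
    refine ⟨σ.trans τ, fun i x => ?_⟩
    rw [LinearEquiv.mul_apply, hσ, hτ]; rfl
  | inv a _ ha =>
    obtain ⟨σ, hσ⟩ := ha
    refine ⟨σ.symm, fun i x => ?_⟩
    have := hσ (σ.symm i) (a⁻¹ x)
    rw [Equiv.apply_symm_apply] at this
    rw [← this]
    congr 1
    exact LinearEquiv.apply_symm_apply a x

theorem ev_act_perm (P : RootPairing ι F V N) (w : V ≃ₗ[F] V) (σ : Equiv.Perm ι)
    (hσ : ∀ (i : ι) (x : V), P.coroot' i (w x) = P.coroot' (σ i) x) (i : ι) (x : V ⊗[F] Λ) :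
    ev P i (act Λ w x) = ev P (σ i) x := by
  induction x with
  | zero => simp
  | add a b ha hb => simp [ha, hb]
  | tmul v a => rw [act, LinearMap.rTensor_tmul, ev_tmul, ev_tmul, ← hσ]; rfl

theorem minkowski_act (P : RootPairing ι F V N) (w : V ≃ₗ[F] V) (hw : w ∈ weyl P)
    (x : V ⊗[F] Λ) : minkowski P (act Λ w x) 0 = minkowski P x 0 := by
  obtain ⟨σ, hσ⟩ := exists_perm P w hw
  simp only [minkowski, sub_zero, ev_act_perm P w σ hσ]
  exact Equiv.sum_comp σ (fun i => |ev P i x|)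

theorem minkowski_sub (P : RootPairing ι F V N) (x y : V ⊗[F] Λ) :
    minkowski P x y = minkowski P (x - y) 0 := by simp [minkowski]


open Classical in
theorem exists_dual (P : RootPairing ι F V N) [P.IsRootSystem] (B : Set ι)
    (hB : IsRootBasis P B) :
    ∃ ω : Module.Basis B F V, ∀ i j : B, P.coroot' i (ω j) = if i = j then 1 else 0 := by
  have hli : LinearIndepOn F P.coroot B := P.linearIndepOn_coroot_iff.2 hB.1
  have hspan : ⊤ ≤ Submodule.span F (Set.range fun i : B => P.coroot i) := by
    rw [← RootPairing.IsRootSystem.span_coroot_eq_top (P := P), Submodule.span_le]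
    rintro _ ⟨i, rfl⟩
    obtain ⟨c, hc, hi, -⟩ := hB.2 i
    have hpos : 0 < P.RootForm (P.root i) (P.root i) :=
      P.rootForm_pos_of_ne_zero (Submodule.subset_span ⟨i, rfl⟩) (P.ne_zero i)
    have hco : P.RootForm (P.root i) (P.root i) • P.coroot i =
        ∑ j, (c j * P.RootForm (P.root j) (P.root j)) • P.coroot j := by
      rw [P.rootForm_self_smul_coroot, hi, map_sum, Finset.smul_sum]
      refine Finset.sum_congr rfl fun j _ => ?_
      rw [mul_smul, P.rootForm_self_smul_coroot, map_smul, smul_comm]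
    have : P.coroot i = (P.RootForm (P.root i) (P.root i))⁻¹ •
        ∑ j, (c j * P.RootForm (P.root j) (P.root j)) • P.coroot j := by
      rw [← hco, smul_smul, inv_mul_cancel₀ hpos.ne', one_smul]
    rw [this]
    refine Submodule.smul_mem _ _ (Submodule.sum_mem _ fun j _ => ?_)
    by_cases hj : j ∈ B
    · exact Submodule.smul_mem _ _ (Submodule.subset_span ⟨⟨j, hj⟩, rfl⟩)
    · rw [hc j hj, zero_mul, zero_smul]; exact Submodule.zero_mem _
  let c : Module.Basis B F N := Module.Basis.mk (v := fun i : B => P.coroot i) hli hspan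
  refine ⟨c.dualBasis.map P.toLinearMap.toPerfPair.symm, fun i j => ?_⟩
  have hci : P.coroot i = c i := (Module.Basis.mk_apply hli hspan i).symm
  have : P.coroot' i ((c.dualBasis.map P.toLinearMap.toPerfPair.symm) j) =
      P.toLinearMap (P.toLinearMap.toPerfPair.symm (c.dualBasis j)) (P.coroot i) := rfl
  rw [this, P.toLinearMap.apply_symm_toPerfPair_self, hci, Module.Basis.dualBasis_apply_self]

open Classical in
theorem eq_sum_dual (P : RootPairing ι F V N) (B : Set ι) [Fintype B]
    (ω : Module.Basis B F V)
    (hω : ∀ i j : B, P.coroot' i (ω j) = if i = j then 1 else 0) (x : V ⊗[F] Λ) :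
    x = ∑ j : B, ω j ⊗ₜ[F] ev P j x := by
  induction x with
  | zero => simp
  | add a b ha hb =>
    simp only [map_add, TensorProduct.tmul_add, Finset.sum_add_distrib]
    rw [← ha, ← hb]
  | tmul v a =>
    simp only [ev_tmul, ← TensorProduct.smul_tmul]
    rw [← TensorProduct.sum_tmul]
    congr 1
    conv_lhs => rw [← ω.sum_repr v]
    refine Finset.sum_congr rfl fun j _ => ?_
    congr 1
    conv_rhs => rw [← ω.sum_repr v]
    rw [map_sum]
    simp only [map_smul, hω, smul_eq_mul, mul_ite, mul_one, mul_zero]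
    simp

theorem exists_sign (P : RootPairing ι F V N) [P.IsRootSystem] [IsOrderedModule F Λ] (B : Set ι)
    (hB : IsRootBasis P B) (i : ι) :
    (∀ x ∈ fundChamber (Λ := Λ) P B, 0 ≤ ev P i x) ∨
    (∀ x ∈ fundChamber (Λ := Λ) P B, ev P i x ≤ 0) := by
  obtain ⟨c, hc, hi, hs⟩ := hB.2 i
  have hpos : ∀ j, 0 < P.RootForm (P.root j) (P.root j) := fun j =>
    P.rootForm_pos_of_ne_zero (Submodule.subset_span ⟨j, rfl⟩) (P.ne_zero j)
  have hco : P.RootForm (P.root i) (P.root i) • P.coroot i =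
      ∑ j, (c j * P.RootForm (P.root j) (P.root j)) • P.coroot j := by
    rw [P.rootForm_self_smul_coroot, hi, map_sum, Finset.smul_sum]
    refine Finset.sum_congr rfl fun j _ => ?_
    rw [mul_smul, P.rootForm_self_smul_coroot, map_smul, smul_comm]
  have hev : ∀ x : V ⊗[F] Λ, P.RootForm (P.root i) (P.root i) • ev P i x =
      ∑ j, (c j * P.RootForm (P.root j) (P.root j)) • ev P j x := by
    intro x
    induction x with
    | zero => simp
    | add a b ha hb => simp only [map_add, smul_add, Finset.sum_add_distrib, ha, hb]
    | tmul v a =>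
      simp only [ev_tmul, ← smul_assoc]
      rw [← Finset.sum_smul]
      congr 1
      have := congrArg (P.toLinearMap v) hco
      simpa using this
  rcases hs with hs | hs
  · left
    intro x hx
    have h1 : 0 ≤ P.RootForm (P.root i) (P.root i) • ev P i x := by
      rw [hev]
      refine Finset.sum_nonneg fun j _ => ?_
      by_cases hj : j ∈ B
      · exact smul_nonneg (mul_nonneg (hs j) (hpos j).le) (hx j hj)
      · rw [hc j hj, zero_mul, zero_smul]
    have := smul_nonneg (inv_nonneg.2 (hpos i).le) h1
    rwa [smul_smul, inv_mul_cancel₀ (hpos i).ne', one_smul] at this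
  · right
    intro x hx
    have h1 : 0 ≤ - (P.RootForm (P.root i) (P.root i) • ev P i x) := by
      rw [hev, ← Finset.sum_neg_distrib]
      refine Finset.sum_nonneg fun j _ => ?_
      rw [← neg_smul, ← neg_mul]
      by_cases hj : j ∈ B
      · exact smul_nonneg (mul_nonneg (neg_nonneg.2 (hs j)) (hpos j).le) (hx j hj)
      · rw [hc j hj, neg_zero, zero_mul, zero_smul]
    have := smul_nonneg (inv_nonneg.2 (hpos i).le) h1
    rw [smul_neg, smul_smul, inv_mul_cancel₀ (hpos i).ne', one_smul] at this
    exact neg_nonneg.1 this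

theorem exists_dominant (P : RootPairing ι F V N) [P.IsRootSystem] (B : Set ι)
    (hB : IsRootBasis P B) (x : V ⊗[F] Λ) : ∃ w ∈ weyl P, act Λ w x ∈ fundChamber P B := by
  classical
  obtain ⟨ω, hω⟩ := exists_dual P B hB
  have hspan : ∃ h : V →ₗ[F] F, ∀ j ∈ B, h (P.root j) = 1 := by

    obtain ⟨h, hh⟩ := LinearMap.exists_extend
      ((Module.Basis.span hB.1).constr F (fun _ => (1 : F)) :
        Submodule.span F (Set.range fun i : B => P.root i) →ₗ[F] F)
    refine ⟨h, fun j hj => ?_⟩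
    have h1 := Module.Basis.span_apply hB.1 ⟨j, hj⟩
    have h2 := LinearMap.congr_fun hh (Module.Basis.span hB.1 ⟨j, hj⟩)
    rw [Module.Basis.constr_basis] at h2
    rw [← h2]
    simp [h1]
  obtain ⟨h, hh⟩ := hspan
  let H : V ⊗[F] Λ →ₗ[F] Λ := (TensorProduct.lid F Λ).toLinearMap ∘ₗ h.rTensor Λ
  let O : Set (V ⊗[F] Λ) := {y | ∃ w ∈ weyl P, y = act Λ w x}
  have hfin : O.Finite := by
    have hf : (Set.pi Set.univ fun _ : B => Set.range fun i => ev P i x).Finite :=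
      Set.Finite.pi fun _ => Set.finite_range _
    refine Set.Finite.of_injOn (f := fun y => fun i : B => ev P i y) ?_ ?_ hf
    · rintro y ⟨w, hw, rfl⟩ i -
      obtain ⟨σ, hσ⟩ := exists_perm P w hw
      exact ⟨σ i, (ev_act_perm P w σ hσ i x).symm⟩
    · intro y _ z _ hyz
      rw [eq_sum_dual P B ω hω y, eq_sum_dual P B ω hω z]
      exact Finset.sum_congr rfl fun j _ => by
          have h0 : ev P j y = ev P j z := congrFun hyz j
          rw [h0]
  obtain ⟨y, ⟨w, hw, rfl⟩, hmax⟩ := hfin.exists_maximalFor H O ⟨_, 1, one_mem _, rfl⟩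
  refine ⟨w, hw, fun i hi => ?_⟩
  have hmem : act Λ (P.reflection i * w) x ∈ O :=
    ⟨_, mul_mem (Subgroup.subset_closure ⟨i, rfl⟩) hw, rfl⟩
  have hr : ∀ z : V ⊗[F] Λ, H (act Λ (P.reflection i) z) = H z - ev P i z := by
    intro z
    induction z with
    | zero => simp
    | add a b ha hb => simp only [map_add, ha, hb]; abel
    | tmul v a =>
      simp [H, act, ev_tmul, P.reflection_apply, hh i hi, sub_smul]
  have hcomp : act Λ (P.reflection i * w) x = act Λ (P.reflection i) (act Λ w x) := by
    simp only [act, ← LinearMap.comp_apply, ← LinearMap.rTensor_comp]; rfl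
  by_contra hneg
  have h1 : H (act Λ w x) ≤ H (act Λ (P.reflection i * w) x) := by
    rw [hcomp, hr]
    have := (not_le.1 hneg).le
    simpa using this
  have h2 := hmax hmem h1
  simp only [hcomp, hr] at h2
  apply hneg
  simpa using h2

/-- The modified Minkowski metric is one of the metrics that the model space may carry. -/
theorem isModelMetric_minkowski (P : RootPairing ι F V N) [P.IsRootSystem] [IsOrderedModule F Λ]
    (B : Set ι) (hB : IsRootBasis P B) :
    IsModelMetric P (minkowski P : V ⊗[F] Λ → V ⊗[F] Λ → Λ) := by
  classical
  obtain ⟨ω, hω⟩ := exists_dual P B hB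
  refine ⟨?_, ?_, ?_, ?_, ?_, ?_, ?_, ?_⟩
  · intro x y
    constructor
    · intro h
      have h0 := (Finset.sum_eq_zero_iff_of_nonneg (fun i _ => abs_nonneg _)).1 h
      rw [eq_sum_dual P B ω hω x, eq_sum_dual P B ω hω y]
      refine Finset.sum_congr rfl fun j _ => ?_
      have := abs_eq_zero.1 (h0 j (Finset.mem_univ _))
      rw [map_sub, sub_eq_zero] at this
      rw [this]
    · rintro rfl
      simp [minkowski]
  · intro x y
    refine Finset.sum_congr rfl fun i _ => ?_
    rw [map_sub, map_sub, abs_sub_comm]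
  · intro x y z
    simp only [minkowski]
    rw [← Finset.sum_add_distrib]
    refine Finset.sum_le_sum fun i _ => ?_
    rw [← sub_add_sub_cancel x z y, map_add]
    exact abs_add_le _ _
  · rintro φ ⟨w, hw, t, -, rfl⟩ x y
    rw [minkowski_sub, minkowski_sub P x, add_sub_add_right_eq_sub, ← map_sub, minkowski_act P w hw]
  · exact fun ε hε => ⟨ε, hε, fun x y h => h⟩
  · exact fun ε hε => ⟨ε, hε, fun x y h => h⟩
  · intro v a b ha hb
    simp only [minkowski, zero_sub, map_neg, abs_neg, ev_tmul, smul_add]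
    rw [← Finset.sum_add_distrib]
    refine Finset.sum_congr rfl fun i _ => ?_
    rcases le_total 0 (P.coroot' i v) with h | h
    · rw [abs_of_nonneg (smul_nonneg h ha), abs_of_nonneg (smul_nonneg h hb),
        abs_of_nonneg (add_nonneg (smul_nonneg h ha) (smul_nonneg h hb))]
    · have h1 := smul_nonpos_of_nonpos_of_nonneg h ha
      have h2 := smul_nonpos_of_nonpos_of_nonneg h hb
      rw [abs_of_nonpos h1, abs_of_nonpos h2, abs_of_nonpos (add_nonpos h1 h2), neg_add]
  · intro x y
    obtain ⟨w, hw, hdom⟩ := exists_dominant P B hB (y - x)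
    have hinv : ∀ z : V ⊗[F] Λ, act Λ w⁻¹ (act Λ w z) = z := by
      intro z
      simp only [act, ← LinearMap.comp_apply, ← LinearMap.rTensor_comp]
      have : (w⁻¹.toLinearMap ∘ₗ w.toLinearMap : V →ₗ[F] V) = LinearMap.id := by
        ext v; exact w.symm_apply_apply v
      rw [this]; simp
    set u := act Λ w (y - x) with hu
    have hyx : y - x = act Λ w⁻¹ u := (hinv _).symm
    refine ⟨(Finset.univ : Finset B).toList.map fun j => (w⁻¹ (ω j), ev P j u), ?_, ?_, ?_⟩
    · intro p hp
      obtain ⟨j, -, rfl⟩ := List.mem_map.1 hp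
      exact hdom j j.2
    · rw [List.map_map, Finset.sum_map_toList, hyx]
      conv_lhs => rw [eq_sum_dual P B ω hω u, map_sum]
      rfl
    · rw [List.map_map, Finset.sum_map_toList]
      have hs : ∀ z : V ⊗[F] Λ, minkowski P 0 z = minkowski P z 0 := fun z => by
        simp [minkowski]
      have h1 : minkowski P x y = minkowski P u 0 := by
        rw [hu, minkowski_act P w hw, ← minkowski_sub]
        refine Finset.sum_congr rfl fun i _ => ?_
        rw [map_sub, map_sub, abs_sub_comm]
      have h2 : ∀ j : B, minkowski P 0 ((w⁻¹ (ω j)) ⊗ₜ[F] ev P j u) =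
          minkowski P (ω j ⊗ₜ[F] ev P j u) 0 := by
        intro j
        rw [hs, ← minkowski_act P w⁻¹ (inv_mem hw) (ω j ⊗ₜ[F] ev P j u)]
        rfl
      simp only [Function.comp_def, h2, h1]
      have hmem : ∀ j : B, ω j ⊗ₜ[F] ev P j u ∈ fundChamber P B := by
        intro j i hi
        rw [ev_tmul, hω ⟨i, hi⟩ j]
        split_ifs
        · rw [one_smul]; exact hdom j j.2
        · rw [zero_smul]
      simp only [minkowski, sub_zero]
      rw [Finset.sum_comm]
      refine Finset.sum_congr rfl fun i _ => ?_
      rcases exists_sign (Λ := Λ) P B hB i with h | h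
      · rw [abs_of_nonneg (h u hdom)]
        conv_lhs => rw [eq_sum_dual P B ω hω u, map_sum]
        exact Finset.sum_congr rfl fun j _ => (abs_of_nonneg (h _ (hmem j))).symm
      · rw [abs_of_nonpos (h u hdom)]
        conv_lhs => rw [eq_sum_dual P B ω hω u, map_sum, ← Finset.sum_neg_distrib]
        exact Finset.sum_congr rfl fun j _ => (abs_of_nonpos (h _ (hmem j))).symm

end GenBuilding

end

noncomputable section

namespace GenBuilding

set_option linter.unusedSectionVars false

variable {F : Subfield ℝ} {ι V N Λ X : Type*} [Fintype ι]
  [AddCommGroup V] [Module F V] [AddCommGroup N] [Module F N]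
  [AddCommGroup Λ] [LinearOrder Λ] [IsOrderedAddMonoid Λ] [Nontrivial Λ]
  [Module F Λ] [IsOrderedModule F Λ]

/-! ### Combinatorics of the spherical Weyl group -/

/-! Composing all charts with the full affine Weyl group (`saturate`) changes neither apartments nor
distances, and lets every chamber be written as the image of the fundamental chamber C under a
chart. Both systems of axioms lead to the same two properties: a point and a germ lie in a common
apartment (`GermsJoin`), and a piece of a ray is covered by finitely many chambers with a prescribed
base point (`RaysCovered`).

These two properties suffice. An affine Weyl group element is determined by its values on a small
piece of a chamber (`affW_ext`), so charts that agree on the germ agree wherever their images meet.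
Their inverses glue to a coordinate map ρ on X (`exists_coordinates`), and the retraction is a chart
of the apartment composed with ρ. On a chamber based at the vertex of the germ ρ is an isometry: for
x, y in C some apartment contains the germ and the point with coordinates x + y, and by convexity it
contains the points x and y of that chamber as well. A geodesic breaks into ray pieces and each of
these into finitely many intervals lying in such chambers, so additivity along rays and the triangle
inequality of the model space give `coordinates_le`.

From (ALA) and (FC) both properties are a matter of translation. From (A3), (A4), (SC) they come
from crossing panels at infinity (`exists_attach`). If two apartments share a chamber at infinity,
either the first also contains the j-adjacent chamber at infinity of the second, or it is cut by a
wall into halves, each of which lies in an apartment with that adjacent chamber at infinity. A germ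
lies on one side of the wall, so it survives the crossing. Walking along a gallery at infinity puts
any germ and any chamber at infinity into one apartment (`exists_germEq_subchamber`), whence
`GermsJoin`.

For the cover, take the chambers based at z that are parallel to the finitely many directions of the
apartment. Given a point p of the apartment, let E be a chamber at p containing z. Some chamber G of
the apartment at p has a germ opposite to E (`exists_opposite`). Germs are never further apart than
the chambers at infinity, and equality yields a common apartment (`length_le_of_par`). Opposite
position being the longest, E and G share an apartment, and in it the chamber at z parallel to G
contains p. -/

theorem exists_posElt (Λ : Type*) [AddCommGroup Λ] [LinearOrder Λ] [IsOrderedAddMonoid Λ]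
    [Nontrivial Λ] : ∃ a : Λ, 0 < a := by
  obtain ⟨a, ha⟩ := exists_ne (0 : Λ)
  exact ⟨|a|, abs_pos.2 ha⟩

theorem reflection_mem_weyl (P : RootPairing ι F V N) (i : ι) : P.reflection i ∈ weyl P :=
  Subgroup.subset_closure ⟨i, rfl⟩

/-- The fundamental weights, i.e. the basis dual to the simple co-roots. -/
def fundWeight (P : RootPairing ι F V N) [P.IsRootSystem] {B : Set ι} (hB : IsRootBasis P B) :
    Module.Basis B F V := (exists_dual P B hB).choose

/-- The sum of the fundamental weights: a strictly dominant vector. -/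
def rho (P : RootPairing ι F V N) [P.IsRootSystem] {B : Set ι} (hB : IsRootBasis P B) : V :=
  letI := Fintype.ofFinite B
  ∑ j, fundWeight P hB j

section

variable {P : RootPairing ι F V N} [P.IsRootSystem] {B : Set ι} (hB : IsRootBasis P B)

open Classical in
theorem coroot_fundWeight (i j : B) :
    P.coroot' i (fundWeight P hB j) = if i = j then 1 else 0 :=
  (exists_dual P B hB).choose_spec i j

theorem coroot_fundWeight_self (j : B) : P.coroot' j (fundWeight P hB j) = 1 := by
  rw [coroot_fundWeight, if_pos rfl]

theorem coroot_fundWeight_ne {i j : B} (h : i ≠ j) : P.coroot' i (fundWeight P hB j) = 0 := by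
  rw [coroot_fundWeight, if_neg h]

theorem coroot_root_self (i : ι) : P.coroot' i (P.root i) = 2 := by
  rw [P.root_coroot'_eq_pairing, P.pairing_same]

theorem repr_fundWeight (x : V) (j : B) :
    (fundWeight P hB).repr x j = P.coroot' j x := by
  let _ := Fintype.ofFinite B
  conv_rhs => rw [← (fundWeight P hB).sum_repr x, map_sum]
  rw [Finset.sum_eq_single j]
  · rw [map_smul, coroot_fundWeight_self, smul_eq_mul, mul_one]
  · intro k _ hk; rw [map_smul, coroot_fundWeight_ne hB hk.symm, smul_zero]
  · simp

theorem fundWeight_tmul_mem {a : Λ} (ha : 0 ≤ a) (j : B) :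
    fundWeight P hB j ⊗ₜ[F] a ∈ fundChamber P B := by
  intro i hi
  rw [ev_tmul]
  by_cases h : (⟨i, hi⟩ : B) = j
  · subst h; rw [coroot_fundWeight_self hB ⟨i, hi⟩, one_smul]; exact ha
  · rw [coroot_fundWeight_ne hB (i := ⟨i, hi⟩) h, zero_smul]

theorem coroot_fundWeight_sign (i : ι) :
    (∀ j, 0 ≤ P.coroot' i (fundWeight P hB j)) ∨ (∀ j, P.coroot' i (fundWeight P hB j) ≤ 0) := by
  -- The sign statement on chambers is used with coefficients `F` itself, where a fundamental weight
  -- is the point ω_j ⊗ 1.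
  have h1 : ∀ j, fundWeight P hB j ⊗ₜ[F] (1 : F) ∈ fundChamber P B :=
    fun j => fundWeight_tmul_mem hB zero_le_one j
  refine (exists_sign (Λ := F) P B hB i).imp (fun h j => ?_) (fun h j => ?_)
  · simpa [ev_tmul] using h _ (h1 j)
  · simpa [ev_tmul] using h _ (h1 j)

theorem exists_coroot_fundWeight_ne (i : ι) : ∃ j, P.coroot' i (fundWeight P hB j) ≠ 0 := by
  by_contra! h
  have h0 : P.coroot' i = 0 := (fundWeight P hB).ext fun j => by simpa using h j
  have := coroot_root_self (P := P) i
  rw [h0] at this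
  simp at this

/-- The values of a co-root on the fundamental weights all have the same sign and do not all vanish,
so their sum cannot cancel. Consequently the sign at `rho` serves as the definition of a positive
root. -/
theorem coroot_rho_ne (i : ι) : P.coroot' i (rho P hB) ≠ 0 := by
  let _ := Fintype.ofFinite B
  obtain ⟨j, hj⟩ := exists_coroot_fundWeight_ne hB i
  simp only [rho, map_sum]
  rcases coroot_fundWeight_sign hB i with h | h
  · exact (Finset.sum_pos' (fun k _ => h k) ⟨j, Finset.mem_univ _, lt_of_le_of_ne (h j) hj.symm⟩).ne'
  · exact (Finset.sum_neg' (fun k _ => h k) ⟨j, Finset.mem_univ _, lt_of_le_of_ne (h j) hj⟩).ne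

theorem coroot_rho_simple (j : B) : P.coroot' j (rho P hB) = 1 := by
  let _ := Fintype.ofFinite B
  simp only [rho, map_sum]
  rw [Finset.sum_eq_single j (fun k _ hk => coroot_fundWeight_ne hB hk.symm) (by simp),
    coroot_fundWeight_self]

theorem coroot_fundWeight_nonneg {i : ι} (hi : 0 < P.coroot' i (rho P hB)) (j : B) :
    0 ≤ P.coroot' i (fundWeight P hB j) := by
  let _ := Fintype.ofFinite B
  rcases coroot_fundWeight_sign hB i with h | h
  · exact h j
  · refine absurd hi (not_lt.2 ?_)
    simp only [rho, map_sum]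
    exact Finset.sum_nonpos fun k _ => h k

theorem coroot_fundWeight_nonpos {i : ι} (hi : P.coroot' i (rho P hB) < 0) (j : B) :
    P.coroot' i (fundWeight P hB j) ≤ 0 := by
  let _ := Fintype.ofFinite B
  rcases coroot_fundWeight_sign hB i with h | h
  · refine absurd hi (not_lt.2 ?_)
    simp only [rho, map_sum]
    exact Finset.sum_nonneg fun k _ => h k
  · exact h j

theorem coroot_rho_pos_of_fundWeight {i : ι} {j : B}
    (h : 0 < P.coroot' i (fundWeight P hB j)) : 0 < P.coroot' i (rho P hB) := by
  rcases lt_or_gt_of_ne (coroot_rho_ne hB i) with h1 | h1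
  · exact absurd (coroot_fundWeight_nonpos hB h1 j) (not_le.2 h)
  · exact h1

/-- The sign of a root at a Weyl translate of `rho` is the sign of another root at `rho`. -/
theorem coroot_act_rho_ne {w : V ≃ₗ[F] V} (hw : w ∈ weyl P) (i : ι) :
    P.coroot' i (w (rho P hB)) ≠ 0 := by
  obtain ⟨σ, hσ⟩ := exists_perm P w hw
  rw [hσ]; exact coroot_rho_ne hB _

theorem reflection_fundWeight {i j : B} (h : i ≠ j) :
    P.reflection i (fundWeight P hB j) = fundWeight P hB j := by
  rw [P.reflection_apply, coroot_fundWeight_ne hB h, zero_smul, sub_zero]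

/-- Criterion for a wall to be parallel to the j-th simple wall. A scalar remains because the root
system need not be reduced. -/
theorem coroot_eq_smul {i : ι} {j : B}
    (h : ∀ k, k ≠ j → P.coroot' i (fundWeight P hB k) = 0) :
    P.coroot' i = P.coroot' i (fundWeight P hB j) • P.coroot' j := by
  refine (fundWeight P hB).ext fun k => ?_
  by_cases hk : k = j
  · subst hk
    simp only [LinearMap.smul_apply, coroot_fundWeight_self hB, smul_eq_mul, mul_one]
  · rw [h k hk, LinearMap.smul_apply, coroot_fundWeight_ne hB (Ne.symm hk), smul_zero]

/-- The set of walls separating `rho` from its image under `w`. -/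
def sepWalls (w : V ≃ₗ[F] V) : Set (Submodule F V) :=
  {K | ∃ i, 0 < P.coroot' i (rho P hB) ∧ P.coroot' i (w (rho P hB)) < 0 ∧
    K = LinearMap.ker (P.coroot' i)}

/-- The length of `w`: the number of walls separating `rho` from its image under `w`. -/
def length (w : V ≃ₗ[F] V) : ℕ := (sepWalls hB w).ncard

theorem sepWalls_finite (w : V ≃ₗ[F] V) : (sepWalls hB w).Finite :=
  (Set.finite_range fun i => LinearMap.ker (P.coroot' i)).subset
    fun _ ⟨i, _, _, h⟩ => ⟨i, h.symm⟩

/-- The j-th simple reflection fixes ω_k for k ≠ j, and a co-root that is nonzero at ω_k has the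
same sign there as at `rho`. So only walls parallel to the j-th simple wall can separate `rho` from
its reflection. -/
theorem sign_reflection_of_ne {i : ι} {j k : B} (hk : k ≠ j)
    (h : P.coroot' i (fundWeight P hB k) ≠ 0) :
    P.coroot' i (P.reflection j (rho P hB)) < 0 ↔ P.coroot' i (rho P hB) < 0 := by
  have h1 : P.coroot' (P.reflectionPerm j i) (fundWeight P hB k) =
      P.coroot' i (fundWeight P hB k) := by
    rw [P.coroot'_reflectionPerm, LinearMap.comp_apply]
    exact congrArg _ (reflection_fundWeight hB (Ne.symm hk))
  have key : ∀ i', P.coroot' i' (fundWeight P hB k) ≠ 0 →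
      (P.coroot' i' (rho P hB) < 0 ↔ P.coroot' i' (fundWeight P hB k) < 0) := by
    intro i' h'
    constructor
    · exact fun h2 => lt_of_le_of_ne (coroot_fundWeight_nonpos hB h2 k) h'
    · intro h2
      by_contra h3
      exact absurd (coroot_fundWeight_nonneg hB
        (lt_of_le_of_ne (not_lt.1 h3) (coroot_rho_ne hB i').symm) k) (not_le.2 h2)
  rw [P.coroot'_reflection, key i h, key _ (h1 ▸ h), h1]

/-- The chambers of w and of w s_j have a common panel, so the only wall between them is the image
under w of the j-th simple wall. The hypothesis says that w lies on the side of `rho`, so this wall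
is added to the separating ones and no other wall changes. -/
theorem length_mul_reflection {w : V ≃ₗ[F] V} (hw : w ∈ weyl P) (j : B)
    (hj : 0 < P.coroot' j (w⁻¹ (rho P hB))) :
    length hB (w * P.reflection j) = length hB w + 1 := by
  obtain ⟨σ, hσ⟩ := exists_perm P w hw
  obtain ⟨τ, hτ⟩ := exists_perm P w⁻¹ (inv_mem hw)
  have hwi : ∀ x, w (w⁻¹ x) = x := fun x => w.apply_symm_apply x
  have hiw : ∀ x, w⁻¹ (w x) = x := fun x => w.symm_apply_apply x
  set K0 := LinearMap.ker (P.coroot' (τ j)) with hK0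
  have hrefl : ∀ x, P.coroot' j (P.reflection j x) = - P.coroot' j x := by
    intro x
    rw [P.reflection_apply, map_sub, map_smul, coroot_root_self, smul_eq_mul]; ring
  have hτp : 0 < P.coroot' (τ j) (rho P hB) := by rw [← hτ]; exact hj
  have hnot : K0 ∉ sepWalls hB w := by
    rintro ⟨i, hi, hi', hK⟩
    have hc : P.coroot' (σ i) = P.coroot' (σ i) (fundWeight P hB j) • P.coroot' j := by
      refine coroot_eq_smul hB fun k hk => ?_
      rw [← hσ]
      have : w (fundWeight P hB k) ∈ K0 := by
        rw [hK0, LinearMap.mem_ker, ← hτ, hiw]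
        exact coroot_fundWeight_ne hB (Ne.symm hk)
      rwa [hK] at this
    have h1 : P.coroot' i (rho P hB) =
        P.coroot' (σ i) (fundWeight P hB j) * P.coroot' j (w⁻¹ (rho P hB)) := by
      rw [← smul_eq_mul, ← LinearMap.smul_apply, ← hc, ← hσ, hwi]
    have h2 : P.coroot' i (w (rho P hB)) = P.coroot' (σ i) (fundWeight P hB j) := by
      rw [hσ, hc, LinearMap.smul_apply, coroot_rho_simple, smul_eq_mul, mul_one,
        ← hc]
    rw [h2] at hi'
    rw [h1] at hi
    exact absurd hi (not_lt.2 (mul_nonpos_of_nonpos_of_nonneg hi'.le hj.le))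
  have hins : sepWalls hB (w * P.reflection j) = insert K0 (sepWalls hB w) := by
    have hK0mem : K0 ∈ sepWalls hB (w * P.reflection j) := by
      refine ⟨τ j, hτp, ?_, rfl⟩
      rw [← hτ, LinearEquiv.mul_apply, hiw, hrefl, coroot_rho_simple]
      simp
    have key : ∀ i, LinearMap.ker (P.coroot' i) ≠ K0 →
        (P.coroot' i ((w * P.reflection j) (rho P hB)) < 0 ↔ P.coroot' i (w (rho P hB)) < 0) := by
      intro i hi
      have : ∃ k, k ≠ j ∧ P.coroot' (σ i) (fundWeight P hB k) ≠ 0 := by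
        by_contra! hcon
        apply hi
        have hc := coroot_eq_smul hB hcon
        have hne : P.coroot' (σ i) (fundWeight P hB j) ≠ 0 := by
          obtain ⟨k, hk⟩ := exists_coroot_fundWeight_ne hB (σ i)
          by_cases hkj : k = j
          · rwa [hkj] at hk
          · exact absurd (hcon k hkj) hk
        ext x
        rw [hK0, LinearMap.mem_ker, LinearMap.mem_ker, ← hτ]
        have : P.coroot' i x = P.coroot' (σ i) (fundWeight P hB j) * P.coroot' j (w⁻¹ x) := by
          rw [← smul_eq_mul, ← LinearMap.smul_apply, ← hc, ← hσ, hwi]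
        rw [this, mul_eq_zero, or_iff_right hne]
      obtain ⟨k, hk, hk'⟩ := this
      rw [LinearEquiv.mul_apply, hσ, hσ]
      exact sign_reflection_of_ne hB hk hk'
    ext K
    constructor
    · rintro ⟨i, hi, hi', rfl⟩
      by_cases h : LinearMap.ker (P.coroot' i) = K0
      · exact Or.inl h
      · exact Or.inr ⟨i, hi, (key i h).1 hi', rfl⟩
    · rintro (rfl | ⟨i, hi, hi', rfl⟩)
      · exact hK0mem
      · by_cases h : LinearMap.ker (P.coroot' i) = K0
        · rw [h]; exact hK0mem
        · exact ⟨i, hi, (key i h).2 hi', rfl⟩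
  rw [length, hins, Set.ncard_insert_of_notMem hnot (sepWalls_finite hB w)]; rfl

theorem reflection_mul_self (i : ι) : P.reflection i * P.reflection i = 1 := by
  ext x
  exact P.reflection_same i x

theorem coroot_mul_reflection_inv (w : V ≃ₗ[F] V) (j : ι) (x : V) :
    P.coroot' j ((w * P.reflection j)⁻¹ x) = - P.coroot' j (w⁻¹ x) := by
  have : (w * P.reflection j)⁻¹ = P.reflection j * w⁻¹ := by
    rw [mul_inv_rev, inv_eq_of_mul_eq_one_left (reflection_mul_self j)]
  rw [this, LinearEquiv.mul_apply, P.reflection_apply, map_sub, map_smul, coroot_root_self,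
    smul_eq_mul]
  ring

theorem length_mul_reflection_neg {w : V ≃ₗ[F] V} (hw : w ∈ weyl P) (j : B)
    (hj : P.coroot' j (w⁻¹ (rho P hB)) < 0) :
    length hB (w * P.reflection j) + 1 = length hB w := by
  have h := length_mul_reflection hB (mul_mem hw (reflection_mem_weyl P j)) j
    (by rw [coroot_mul_reflection_inv]; exact neg_pos.2 hj)
  rw [mul_assoc, reflection_mul_self, mul_one] at h
  exact h.symm

theorem length_mul_reflection_le {w : V ≃ₗ[F] V} (hw : w ∈ weyl P) (j : B) :
    length hB (w * P.reflection j) ≤ length hB w + 1 := by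
  rcases lt_or_gt_of_ne (coroot_act_rho_ne hB (inv_mem hw) j) with h | h
  · have := length_mul_reflection_neg hB hw j h
    omega
  · exact (length_mul_reflection hB hw j h).le

/-- Such a w carries `rho` into the opposite chamber: w⁻¹ρ is a combination of fundamental weights
with negative coefficients, so every positive co-root is negative at wρ and every wall separates. -/
theorem length_le_of_forall_neg {w : V ≃ₗ[F] V} (hw : w ∈ weyl P)
    (h : ∀ j : B, P.coroot' j (w⁻¹ (rho P hB)) < 0) (v : V ≃ₗ[F] V) :
    length hB v ≤ length hB w := by
  refine Set.ncard_le_ncard ?_ (sepWalls_finite hB w)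
  rintro K ⟨i, hi, -, rfl⟩
  refine ⟨i, hi, ?_, rfl⟩
  obtain ⟨σ, hσ⟩ := exists_perm P w hw
  rw [hσ]
  by_contra hcon
  have hpos : 0 < P.coroot' (σ i) (rho P hB) :=
    lt_of_le_of_ne (not_lt.1 hcon) (coroot_rho_ne hB _).symm
  have h1 : P.coroot' i (rho P hB) = P.coroot' (σ i) (w⁻¹ (rho P hB)) := by
    rw [← hσ]; exact congrArg _ (w.apply_symm_apply _).symm
  rw [h1] at hi
  refine absurd hi (not_lt.2 ?_)
  let _ := Fintype.ofFinite B
  rw [← (fundWeight P hB).sum_repr (w⁻¹ (rho P hB)), map_sum]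
  refine Finset.sum_nonpos fun j _ => ?_
  rw [map_smul, repr_fundWeight]
  exact smul_nonpos_of_nonpos_of_nonneg (h j).le (coroot_fundWeight_nonneg hB hpos j)

/-- If there were no such j, then w⁻¹ρ would be dominant and no wall could separate ρ from wρ. This
supplies the descents for inductions on the length. -/
theorem exists_neg_of_length_pos {w : V ≃ₗ[F] V} (hw : w ∈ weyl P) (h : length hB w ≠ 0) :
    ∃ j : B, P.coroot' j (w⁻¹ (rho P hB)) < 0 := by
  by_contra! hcon
  apply h
  rw [length, Set.ncard_eq_zero (sepWalls_finite hB w)]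
  refine Set.eq_empty_iff_forall_notMem.2 ?_
  rintro K ⟨i, hi, hi', -⟩
  obtain ⟨σ, hσ⟩ := exists_perm P w hw
  rw [hσ] at hi'
  have h1 : P.coroot' i (rho P hB) = P.coroot' (σ i) (w⁻¹ (rho P hB)) := by
    rw [← hσ]; exact congrArg _ (w.apply_symm_apply _).symm
  rw [h1] at hi
  refine absurd hi (not_lt.2 ?_)
  let _ := Fintype.ofFinite B
  rw [← (fundWeight P hB).sum_repr (w⁻¹ (rho P hB)), map_sum]
  refine Finset.sum_nonpos fun j _ => ?_
  rw [map_smul, repr_fundWeight]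
  exact smul_nonpos_of_nonneg_of_nonpos (hcon j) (coroot_fundWeight_nonpos hB hi' j)

/-! ### The invariant form and the stabilizer of a panel -/

theorem rootForm_invariant {w : V ≃ₗ[F] V} (hw : w ∈ weyl P) (x y : V) :
    P.RootForm (w x) (w y) = P.RootForm x y := by
  induction hw using Subgroup.closure_induction generalizing x y with
  | mem w h =>
    obtain ⟨j, rfl⟩ := h
    exact P.rootForm_reflection_reflection_apply j x y
  | one => rfl
  | mul a b _ _ ha hb => rw [LinearEquiv.mul_apply, LinearEquiv.mul_apply, ha, hb]
  | inv a _ ha =>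
    rw [← ha]
    congr 1
    · exact congrArg _ (a.apply_symm_apply x)
    · exact a.apply_symm_apply y

theorem rootForm_root_pos (i : ι) : 0 < P.RootForm (P.root i) (P.root i) :=
  P.rootForm_pos_of_ne_zero (Submodule.subset_span ⟨i, rfl⟩) (P.ne_zero i)

theorem two_mul_rootForm (i : ι) (x : V) :
    2 * P.RootForm (P.root i) x = P.RootForm (P.root i) (P.root i) * P.coroot' i x := by
  have h := congrArg (P.toLinearMap x) (P.rootForm_self_smul_coroot i)
  rw [map_smul, map_nsmul, P.toLinearMap_apply_apply_Polarization] at h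
  rw [two_mul, ← two_nsmul, ← h]
  rfl

/-- The pointwise stabilizer of a panel. -/
theorem eq_one_or_reflection {w : V ≃ₗ[F] V} (hw : w ∈ weyl P) (j : B)
    (h : ∀ k, k ≠ j → w (fundWeight P hB k) = fundWeight P hB k) :
    w = 1 ∨ w = P.reflection j := by
  set α := P.root (j : ι) with hα
  have hpos := rootForm_root_pos (P := P) j
  have hfix : ∀ x, P.coroot' j x = 0 → w x = x := by
    intro x hx
    let _ := Fintype.ofFinite B
    have hr := (fundWeight P hB).sum_repr x
    have hj : (fundWeight P hB).repr x j = 0 := by rw [repr_fundWeight, hx]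
    conv_lhs => rw [← hr]
    conv_rhs => rw [← hr]
    rw [map_sum]
    refine Finset.sum_congr rfl fun k _ => ?_
    by_cases hk : k = j
    · subst hk; rw [hj]; simp
    · rw [map_smul, h k hk]
  have hdec : ∀ x, x = (x - (P.coroot' j x / 2) • α) + (P.coroot' j x / 2) • α := by
    intro x; abel
  have hker : ∀ x, P.coroot' j (x - (P.coroot' j x / 2) • α) = 0 := by
    intro x
    rw [map_sub, map_smul, hα, coroot_root_self, smul_eq_mul]; ring
  obtain ⟨c, hc⟩ : ∃ c : F, w α = c • α := by
    -- Let u be the component of wα in the fixed hyperplane. It is orthogonal to α, and since wu = u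
    -- it is also orthogonal to wα. Hence it is orthogonal to itself, and positivity of the form
    -- gives u = 0.
    refine ⟨P.coroot' j (w α) / 2, ?_⟩
    set u := w α - (P.coroot' j (w α) / 2) • α with hu
    have hku : P.coroot' j u = 0 := hker _
    have hwu : w u = u := hfix u hku
    have hsymm : P.RootForm u α = P.RootForm α u := P.rootForm_symmetric.eq u α
    have h1 : P.RootForm u (w α) = 0 := by
      rw [← hwu, rootForm_invariant hw, hsymm]
      have := two_mul_rootForm (P := P) j u
      rw [hku, mul_zero] at this
      simpa using this
    have h2 : P.RootForm u α = 0 := by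
      rw [hsymm]
      have := two_mul_rootForm (P := P) j u
      rw [hku, mul_zero] at this
      simpa using this
    have h3 : P.RootForm u u = 0 := by
      conv_lhs => arg 2; rw [hu]
      rw [map_sub, map_smul, h1, h2]; simp
    have h4 : u = 0 := by
      by_contra hne
      have := P.rootForm_pos_of_ne_zero (x := u)
        (by rw [RootPairing.rootSpan, RootPairing.IsRootSystem.span_root_eq_top (P := P)]; trivial) hne
      exact this.ne' h3
    exact sub_eq_zero.1 h4
  have hcc : c * c = 1 := by
    have := rootForm_invariant hw α α
    rw [hc] at this
    simp only [map_smul, LinearMap.smul_apply, smul_eq_mul] at this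
    have h5 : (c * c - 1) * P.RootForm α α = 0 := by linear_combination this
    rcases mul_eq_zero.1 h5 with h6 | h6
    · exact sub_eq_zero.1 h6
    · exact absurd h6 hpos.ne'
  rcases mul_self_eq_one_iff.1 hcc with rfl | rfl
  · left
    ext x
    conv_lhs => rw [hdec x]
    rw [map_add, hfix _ (hker x), map_smul, hc, one_smul]
    simp
  · right
    ext x
    conv_lhs => rw [hdec x]
    rw [map_add, hfix _ (hker x), map_smul, hc, P.reflection_apply, ← hα]
    module

end

/-! ### The model space and its affine Weyl group -/

theorem act_tmul (w : V ≃ₗ[F] V) (v : V) (a : Λ) : act Λ w (v ⊗ₜ[F] a) = w v ⊗ₜ[F] a := rfl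

theorem act_one (x : V ⊗[F] Λ) : act Λ (1 : V ≃ₗ[F] V) x = x := by
  have : ((1 : V ≃ₗ[F] V).toLinearMap) = LinearMap.id := rfl
  rw [act, this, LinearMap.rTensor_id, LinearMap.id_apply]

theorem act_mul (v w : V ≃ₗ[F] V) (x : V ⊗[F] Λ) : act Λ (v * w) x = act Λ v (act Λ w x) := by
  simp only [act, ← LinearMap.comp_apply, ← LinearMap.rTensor_comp]; rfl

theorem act_inv_act (w : V ≃ₗ[F] V) (x : V ⊗[F] Λ) : act Λ w⁻¹ (act Λ w x) = x := by
  rw [← act_mul, inv_mul_cancel, act_one]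

theorem act_act_inv (w : V ≃ₗ[F] V) (x : V ⊗[F] Λ) : act Λ w (act Λ w⁻¹ x) = x := by
  rw [← act_mul, mul_inv_cancel, act_one]

variable (Λ) in
/-- The full affine Weyl group, as a group of permutations of the model space. -/
def affW (P : RootPairing ι F V N) : Subgroup (Equiv.Perm (V ⊗[F] Λ)) where
  carrier := {φ | ∃ w ∈ weyl P, ∃ t, ∀ x, φ x = act Λ w x + t}
  one_mem' := ⟨1, one_mem _, 0, fun x => by rw [act_one, add_zero]; rfl⟩
  mul_mem' := by
    rintro φ ψ ⟨v, hv, s, hφ⟩ ⟨w, hw, t, hψ⟩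
    refine ⟨v * w, mul_mem hv hw, act Λ v t + s, fun x => ?_⟩
    rw [Equiv.Perm.mul_apply, hψ, hφ, map_add, act_mul, add_assoc]
  inv_mem' := by
    rintro φ ⟨v, hv, s, hφ⟩
    refine ⟨v⁻¹, inv_mem hv, - act Λ v⁻¹ s, fun x => ?_⟩
    rw [Equiv.Perm.inv_eq_iff_eq, hφ, map_add, act_act_inv, map_neg, act_act_inv,
      neg_add_cancel_right]

variable (Λ) in
/-- The action of a linear automorphism of `V`, as a permutation of the model space. -/
def lin (w : V ≃ₗ[F] V) : Equiv.Perm (V ⊗[F] Λ) where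
  toFun := act Λ w
  invFun := act Λ w⁻¹
  left_inv := act_inv_act w
  right_inv := act_act_inv w

theorem lin_apply (w : V ≃ₗ[F] V) (x : V ⊗[F] Λ) : lin Λ w x = act Λ w x := rfl

theorem lin_mem (P : RootPairing ι F V N) {w : V ≃ₗ[F] V} (hw : w ∈ weyl P) :
    lin Λ w ∈ affW Λ P := ⟨w, hw, 0, fun x => by rw [add_zero]; rfl⟩

theorem addRight_mem (P : RootPairing ι F V N) (t : V ⊗[F] Λ) : Equiv.addRight t ∈ affW Λ P :=
  ⟨1, one_mem _, t, fun x => by rw [act_one]; rfl⟩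

theorem mem_affineWeyl_top {P : RootPairing ι F V N} {φ : Equiv.Perm (V ⊗[F] Λ)}
    (hφ : φ ∈ affW Λ P) : ⇑φ ∈ affineWeyl P (⊤ : AddSubgroup (V ⊗[F] Λ)) := by
  obtain ⟨w, hw, t, h⟩ := hφ
  exact ⟨w, hw, t, trivial, funext h⟩

theorem exists_affW_of_mem {P : RootPairing ι F V N} {T : AddSubgroup (V ⊗[F] Λ)}
    {φ : V ⊗[F] Λ → V ⊗[F] Λ} (hφ : φ ∈ affineWeyl P T) : ∃ ψ ∈ affW Λ P, φ = ψ := by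
  obtain ⟨w, hw, t, -, rfl⟩ := hφ
  exact ⟨Equiv.addRight t * lin Λ w, mul_mem (addRight_mem P t) (lin_mem P hw), rfl⟩

theorem ev_affW {P : RootPairing ι F V N} {φ : Equiv.Perm (V ⊗[F] Λ)} (hφ : φ ∈ affW Λ P) :
    ∃ σ : Equiv.Perm ι, ∀ i x, ev P i (φ x) = ev P (σ i) x + ev P i (φ 0) := by
  obtain ⟨w, hw, t, h⟩ := hφ
  obtain ⟨σ, hσ⟩ := exists_perm P w hw
  refine ⟨σ, fun i x => ?_⟩
  rw [h, h, map_add, ev_act_perm P w σ hσ, map_zero, zero_add]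

theorem affW_add {P : RootPairing ι F V N} {φ : Equiv.Perm (V ⊗[F] Λ)} (hφ : φ ∈ affW Λ P) :
    ∃ w ∈ weyl P, ∀ x y, φ (x + y) = φ x + act Λ w y := by
  obtain ⟨w, hw, t, h⟩ := hφ
  exact ⟨w, hw, fun x y => by rw [h, h, map_add]; abel⟩

theorem smul_pos_of_pos {c : F} {a : Λ} (hc : 0 < c) (ha : 0 < a) : 0 < c • a :=
  lt_of_le_of_ne (smul_nonneg hc.le ha.le) (smul_ne_zero hc.ne' ha.ne').symm

theorem smul_lt_smul_of_lt {b c : F} {a : Λ} (hbc : b < c) (ha : 0 < a) : b • a < c • a := by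
  rw [← sub_pos, ← sub_smul]
  exact smul_pos_of_pos (sub_pos.2 hbc) ha

/-- The points of the model space at which all co-roots are small. -/
def small (P : RootPairing ι F V N) (ε : Λ) : Set (V ⊗[F] Λ) := {x | ∀ i, |ev P i x| < ε}

theorem zero_mem_small (P : RootPairing ι F V N) {ε : Λ} (h : 0 < ε) : 0 ∈ small P ε := by
  intro i; rw [map_zero, abs_zero]; exact h

theorem exists_tmul_mem_small (P : RootPairing ι F V N) (v : V) {ε : Λ} (hε : 0 < ε) :
    ∃ a : Λ, 0 < a ∧ v ⊗ₜ[F] a ∈ small P ε := by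
  -- M strictly exceeds every |⟨v, α^∨⟩|, so scaling ε by its inverse makes all co-root values
  -- smaller than ε.
  set M : F := 1 + ∑ i, |P.coroot' i v| with hM
  have hM0 : 0 < M := add_pos_of_pos_of_nonneg one_pos (Finset.sum_nonneg fun _ _ => abs_nonneg _)
  refine ⟨M⁻¹ • ε, smul_pos_of_pos (inv_pos.2 hM0) hε, fun i => ?_⟩
  rw [ev_tmul, smul_smul, abs_smul, abs_of_pos hε]
  conv_rhs => rw [← one_smul F ε]
  refine smul_lt_smul_of_lt ?_ hε
  rw [abs_mul, abs_of_pos (inv_pos.2 hM0), ← div_eq_mul_inv, div_lt_one hM0, hM]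
  have := Finset.single_le_sum (f := fun i => |P.coroot' i v|) (fun _ _ => abs_nonneg _)
    (Finset.mem_univ i)
  exact lt_of_le_of_lt this (lt_one_add _)

theorem smul_eq_zero_iff_of_pos {c : F} {a : Λ} (ha : 0 < a) : c • a = 0 ↔ c = 0 := by
  rw [smul_eq_zero, or_iff_left ha.ne']

theorem add_mem_fundChamber {P : RootPairing ι F V N} {B : Set ι} {x y : V ⊗[F] Λ}
    (hx : x ∈ fundChamber P B) (hy : y ∈ fundChamber P B) : x + y ∈ fundChamber P B := by
  intro i hi; rw [map_add]; exact add_nonneg (hx i hi) (hy i hi)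

theorem zero_mem_fundChamber (P : RootPairing ι F V N) (B : Set ι) :
    (0 : V ⊗[F] Λ) ∈ fundChamber P B := by
  intro i _; rw [map_zero]

section

variable {P : RootPairing ι F V N} [P.IsRootSystem] {B : Set ι} (hB : IsRootBasis P B)

theorem eq_sum_fundWeight [Fintype B] (x : V ⊗[F] Λ) :
    x = ∑ j : B, fundWeight P hB j ⊗ₜ[F] ev P j x := by
  classical
  exact eq_sum_dual P B (fundWeight P hB) (fun i j => coroot_fundWeight hB i j) x

theorem ev_eq_sum [Fintype B] (i : ι) (x : V ⊗[F] Λ) :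
    ev P i x = ∑ j : B, P.coroot' i (fundWeight P hB j) • ev P j x := by
  conv_lhs => rw [eq_sum_fundWeight hB x, map_sum]
  simp only [ev_tmul]

theorem ev_nonneg {i : ι} (hi : 0 < P.coroot' i (rho P hB)) {x : V ⊗[F] Λ}
    (hx : x ∈ fundChamber P B) : 0 ≤ ev P i x := by
  let _ := Fintype.ofFinite B
  rw [ev_eq_sum hB]
  exact Finset.sum_nonneg fun j _ => smul_nonneg (coroot_fundWeight_nonneg hB hi j) (hx j j.2)

theorem ev_nonpos {i : ι} (hi : P.coroot' i (rho P hB) < 0) {x : V ⊗[F] Λ}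
    (hx : x ∈ fundChamber P B) : ev P i x ≤ 0 := by
  let _ := Fintype.ofFinite B
  rw [ev_eq_sum hB]
  exact Finset.sum_nonpos fun j _ =>
    smul_nonpos_of_nonpos_of_nonneg (coroot_fundWeight_nonpos hB hi j) (hx j j.2)

theorem rho_tmul_mem {a : Λ} (ha : 0 ≤ a) : rho P hB ⊗ₜ[F] a ∈ fundChamber P B := by
  intro j hj
  rw [ev_tmul, coroot_rho_simple hB ⟨j, hj⟩, one_smul]
  exact ha

/-- A linear form `v ↦ c • a` is unbounded below along the ray when `c < 0`. -/
theorem exists_smul_lt {c : F} (hc : c < 0) (l : Λ) : ∃ a : Λ, 0 < a ∧ c • a < l := by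
  obtain ⟨e, he⟩ := exists_posElt Λ
  refine ⟨(-c)⁻¹ • (|l| + e), smul_pos_of_pos (inv_pos.2 (neg_pos.2 hc))
    (add_pos_of_nonneg_of_pos (abs_nonneg _) he), ?_⟩
  rw [smul_smul, inv_neg, mul_neg, mul_inv_cancel₀ hc.ne, neg_smul, one_smul]
  have := neg_abs_le l
  calc -(|l| + e) < -|l| := neg_lt_neg (lt_add_of_pos_right _ he)
    _ ≤ l := this

/-- A negative co-root is unbounded below along the ray through `rho`. So in a description of a
convex set containing a Weyl chamber only positive roots occur, which drives all the convexity
arguments. -/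
theorem coroot_rho_pos_of_bddBelow {i : ι} {x : V ⊗[F] Λ} {l : Λ}
    (h : ∀ c ∈ fundChamber P B, l ≤ ev P i (x + c)) : 0 < P.coroot' i (rho P hB) := by
  by_contra hcon
  have hneg := lt_of_le_of_ne (not_lt.1 hcon) (coroot_rho_ne hB i)
  obtain ⟨a, ha, hlt⟩ := exists_smul_lt hneg (l - ev P i x)
  have := h _ (rho_tmul_mem hB ha.le)
  rw [map_add, ev_tmul] at this
  rw [lt_sub_iff_add_lt'] at hlt
  exact absurd this (not_le.2 hlt)

include hB in
-- Two parallel chambers always contain a common parallel subchamber; this makes "equal up to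
-- subchambers" a workable relation.
theorem exists_sub_mem_fundChamber (x y : V ⊗[F] Λ) :
    ∃ z, z - x ∈ fundChamber P B ∧ z - y ∈ fundChamber P B := by
  let _ := Fintype.ofFinite B
  obtain ⟨a, ha⟩ : ∃ a : Λ, ∀ j, ev P j (y - x) ≤ a := by
    obtain ⟨a, ha⟩ := (Set.finite_range fun j => ev P j (y - x)).bddAbove
    exact ⟨a, fun j => ha ⟨j, rfl⟩⟩
  refine ⟨x + rho P hB ⊗ₜ[F] max a 0, ?_, ?_⟩
  · rw [add_sub_cancel_left]; exact rho_tmul_mem hB (le_max_right _ _)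
  · intro j hj
    have h1 := ha j
    rw [map_sub] at h1
    rw [map_sub, map_add, ev_tmul, coroot_rho_simple hB ⟨j, hj⟩, one_smul]
    have := h1.trans (le_max_left a 0)
    rw [sub_nonneg]
    exact (sub_le_iff_le_add'.1 this)

include hB in
-- Small multiples of all fundamental weights lie in the given piece. Tensoring with a positive
-- element of `Λ` loses no information on vectors of `V`, so the linear parts agree on a basis, and
-- the values at `a` agree as well.
theorem affW_ext {φ ψ : Equiv.Perm (V ⊗[F] Λ)} (hφ : φ ∈ affW Λ P) (hψ : ψ ∈ affW Λ P)
    {a : V ⊗[F] Λ} {ε : Λ} (hε : 0 < ε)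
    (h : ∀ c ∈ fundChamber P B, c ∈ small P ε → φ (a + c) = ψ (a + c)) : φ = ψ := by
  obtain ⟨v, hv, hφ'⟩ := affW_add hφ
  obtain ⟨w, hw, hψ'⟩ := affW_add hψ
  have h0 : φ a = ψ a := by
    have := h 0 (zero_mem_fundChamber P B) (zero_mem_small P hε)
    rwa [add_zero] at this
  have hvw : v = w := by
    refine LinearEquiv.toLinearMap_injective ((fundWeight P hB).ext fun j => ?_)
    obtain ⟨b, hb, hs⟩ := exists_tmul_mem_small P (fundWeight P hB j) hε
    have := h _ (fundWeight_tmul_mem hB hb.le j) hs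
    rw [hφ', hψ', h0, add_right_inj, act_tmul, act_tmul] at this
    refine (fundWeight P hB).ext_elem fun k => ?_
    have h1 := congrArg (ev P k) this
    rw [ev_tmul, ev_tmul, ← sub_eq_zero, ← sub_smul, smul_eq_zero_iff_of_pos hb, sub_eq_zero] at h1
    rw [repr_fundWeight, repr_fundWeight]
    exact h1
  ext x
  have h1 := hφ' a (x - a)
  have h2 := hψ' a (x - a)
  rw [add_sub_cancel] at h1 h2
  rw [h1, h2, h0, hvw]

/-! ### Closed convex sets -/

theorem IsClosedConvex.exists_finset {Y : Set (V ⊗[F] Λ)} (hY : IsClosedConvex P Y) :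
    ∃ s : Finset (ι × Λ), ∀ x, x ∈ Y ↔ ∀ p ∈ s, p.2 ≤ ev P p.1 x := by
  obtain ⟨s, rfl⟩ := hY
  exact ⟨s, fun x => by simp only [Set.mem_iInter, halfSpace, Set.mem_ofPred_eq]⟩

include hB in
/-- A closed convex set containing a point and a Weyl chamber contains the parallel Weyl chamber
based at the point. -/
theorem IsClosedConvex.add_mem {Y : Set (V ⊗[F] Λ)} (hY : IsClosedConvex P Y)
    {x y : V ⊗[F] Λ} (hx : x ∈ Y) (hy : ∀ c ∈ fundChamber P B, y + c ∈ Y)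
    {c : V ⊗[F] Λ} (hc : c ∈ fundChamber P B) : x + c ∈ Y := by
  obtain ⟨s, hs⟩ := hY.exists_finset
  rw [hs] at hx ⊢
  intro p hp
  have hpos := coroot_rho_pos_of_bddBelow hB fun c hc => (hs _).1 (hy c hc) p hp
  rw [map_add]
  exact (hx p hp).trans (le_add_of_nonneg_right (ev_nonneg hB hpos hc))

include hB in
-- No root changes sign on the chamber, so its value at x lies between its values at 0 and at x + y.
-- Any half-apartment containing these two points therefore contains x.
theorem IsClosedConvex.mem_of_add_mem {Y : Set (V ⊗[F] Λ)} (hY : IsClosedConvex P Y)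
    (h0 : 0 ∈ Y) {x y : V ⊗[F] Λ} (hx : x ∈ fundChamber P B) (hy : y ∈ fundChamber P B)
    (hxy : x + y ∈ Y) : x ∈ Y := by
  obtain ⟨s, hs⟩ := hY.exists_finset
  rw [hs] at h0 hxy ⊢
  intro p hp
  have h1 := h0 p hp
  have h2 := hxy p hp
  rw [map_zero] at h1
  rw [map_add] at h2
  rcases lt_or_gt_of_ne (coroot_rho_ne hB p.1) with h | h
  · exact h2.trans (add_le_of_nonpos_right (ev_nonpos hB h hy))
  · exact h1.trans (ev_nonneg hB h hx)

theorem IsClosedConvex.eq_univ {Y : Set (V ⊗[F] Λ)} (hY : IsClosedConvex P Y)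
    (h : ∀ i l, ∃ y ∈ Y, ev P i y < l) : Y = Set.univ := by
  obtain ⟨s, hs⟩ := hY.exists_finset
  refine Set.eq_univ_of_forall fun x => (hs x).2 fun p hp => ?_
  obtain ⟨y, hy, hlt⟩ := h p.1 p.2
  exact absurd ((hs y).1 hy p hp) (not_le.2 hlt)

end

/-! ### Full atlases -/

/-- An atlas that is invariant under the full affine Weyl group and has compatible charts. -/
structure IsFullAtlas (P : RootPairing ι F V N) (𝒢 : Set (V ⊗[F] Λ → X)) : Prop where
  inj : ∀ f ∈ 𝒢, Function.Injective f
  comp : ∀ f ∈ 𝒢, ∀ φ ∈ affW Λ P, f ∘ φ ∈ 𝒢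
  compat : ∀ f ∈ 𝒢, ∀ g ∈ 𝒢, ∀ x y, f x = g y → IsClosedConvex P (f ⁻¹' Set.range g) ∧
    ∃ φ ∈ affW Λ P, ∀ a, f a ∈ Set.range g → f a = g (φ a)

/-- Two charts agree on the germ of the fundamental chamber at the origin. -/
def GermEq (P : RootPairing ι F V N) (B : Set ι) (f h : V ⊗[F] Λ → X) : Prop :=
  ∃ ε : Λ, 0 < ε ∧ ∀ c ∈ fundChamber P B, c ∈ small P ε → f c = h c

theorem GermEq.refl (P : RootPairing ι F V N) (B : Set ι) (f : V ⊗[F] Λ → X) :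
    GermEq P B f f := by
  obtain ⟨e, he⟩ := exists_posElt Λ
  exact ⟨e, he, fun _ _ _ => rfl⟩

theorem GermEq.symm {P : RootPairing ι F V N} {B : Set ι} {f h : V ⊗[F] Λ → X}
    (H : GermEq P B f h) : GermEq P B h f := by
  obtain ⟨e, he, H⟩ := H
  exact ⟨e, he, fun c hc hs => (H c hc hs).symm⟩

theorem GermEq.trans {P : RootPairing ι F V N} {B : Set ι} {f g h : V ⊗[F] Λ → X}
    (H : GermEq P B f g) (H' : GermEq P B g h) : GermEq P B f h := by
  obtain ⟨e, he, H⟩ := H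
  obtain ⟨e', he', H'⟩ := H'
  exact ⟨min e e', lt_min he he', fun c hc hs =>
    (H c hc fun i => (hs i).trans_le (min_le_left _ _)).trans
      (H' c hc fun i => (hs i).trans_le (min_le_right _ _))⟩

theorem GermEq.apply_zero {P : RootPairing ι F V N} {B : Set ι} {f h : V ⊗[F] Λ → X}
    (H : GermEq P B f h) : f 0 = h 0 := by
  obtain ⟨e, he, H⟩ := H
  exact H 0 (zero_mem_fundChamber P B) (zero_mem_small P he)

theorem range_comp_perm (f : V ⊗[F] Λ → X) (φ : Equiv.Perm (V ⊗[F] Λ)) :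
    Set.range (f ∘ φ) = Set.range f := φ.surjective.range_comp f

section

variable {P : RootPairing ι F V N} [P.IsRootSystem] {B : Set ι} (hB : IsRootBasis P B)
  {𝒢 : Set (V ⊗[F] Λ → X)} (hA : IsFullAtlas P 𝒢)

include hB hA

/-- Charts that agree on an open part of a Weyl chamber agree wherever they meet. -/
theorem eq_of_mem_range {f g : V ⊗[F] Λ → X} (hf : f ∈ 𝒢) (hg : g ∈ 𝒢) {a : V ⊗[F] Λ} {ε : Λ}
    (hε : 0 < ε) (h : ∀ c ∈ fundChamber P B, c ∈ small P ε → f (a + c) = g (a + c))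
    {x : V ⊗[F] Λ} (hx : f x ∈ Set.range g) : f x = g x := by
  obtain ⟨y, hy⟩ := hx
  obtain ⟨-, φ, hφ, H⟩ := hA.compat f hf g hg x y hy.symm
  -- By injectivity of g the coordinate change fixes the whole common piece.
  have : φ = 1 := affW_ext hB hφ (one_mem _) hε fun c hc hs => by
    have h1 := H (a + c) ⟨_, (h c hc hs).symm⟩
    rw [h c hc hs] at h1
    exact (hA.inj g hg h1).symm
  rw [H x ⟨y, hy⟩, this]; rfl

theorem eq_of_mem_range_of_chamber {f g : V ⊗[F] Λ → X} (hf : f ∈ 𝒢) (hg : g ∈ 𝒢)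
    {a : V ⊗[F] Λ} (h : ∀ c ∈ fundChamber P B, f (a + c) = g (a + c))
    {x : V ⊗[F] Λ} (hx : f x ∈ Set.range g) : f x = g x := by
  obtain ⟨e, he⟩ := exists_posElt Λ
  exact eq_of_mem_range hB hA hf hg he (fun c hc _ => h c hc) hx

theorem GermEq.eq_of_mem_range {f g : V ⊗[F] Λ → X} (hf : f ∈ 𝒢) (hg : g ∈ 𝒢)
    (h : GermEq P B f g) {x : V ⊗[F] Λ} (hx : f x ∈ Set.range g) : f x = g x := by
  obtain ⟨e, he, h⟩ := h
  exact GenBuilding.eq_of_mem_range hB hA hf hg (a := 0) he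
    (fun c hc hs => by rw [zero_add]; exact h c hc hs) hx

/-- Charts that agree on a subchamber agree on the chamber based at a common point. -/
theorem eq_on_chamber {f g : V ⊗[F] Λ → X} (hf : f ∈ 𝒢) (hg : g ∈ 𝒢) {a x : V ⊗[F] Λ}
    (h : ∀ c ∈ fundChamber P B, f (a + c) = g (a + c)) (hx : f x ∈ Set.range g)
    {c : V ⊗[F] Λ} (hc : c ∈ fundChamber P B) : f (x + c) = g (x + c) := by
  obtain ⟨y, hy⟩ := hx
  refine eq_of_mem_range_of_chamber hB hA hf hg h ?_
  exact (hA.compat f hf g hg x y hy.symm).1.add_mem hB (x := x) (y := a) ⟨y, hy⟩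
    (fun c hc => ⟨_, (h c hc).symm⟩) hc

theorem eq_on_fundChamber {f g : V ⊗[F] Λ → X} (hf : f ∈ 𝒢) (hg : g ∈ 𝒢) {a : V ⊗[F] Λ}
    (h : ∀ c ∈ fundChamber P B, f (a + c) = g (a + c)) (hx : f 0 ∈ Set.range g)
    {c : V ⊗[F] Λ} (hc : c ∈ fundChamber P B) : f c = g c := by
  have := eq_on_chamber hB hA hf hg h hx hc
  rwa [zero_add] at this

end

/-! ### The sundial configuration -/

/-- Working form of the axiom (SC) for a full atlas. -/
def Sundial (P : RootPairing ι F V N) (B : Set ι) (𝒢 : Set (V ⊗[F] Λ → X)) : Prop :=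
  ∀ K ∈ 𝒢, ∀ D ∈ 𝒢, ∀ j ∈ B, D '' fundChamber P B ∩ Set.range K = D '' fundPanel P B j →
    ∀ (i : ι) (k : Λ), D '' fundChamber P B ∩ Set.range K ⊆ K '' hyperplane P i k →
      ∃ f₂ ∈ 𝒢, ∃ f₃ ∈ 𝒢, Set.range f₂ ≠ Set.range f₃ ∧
        (∃ i l, K ⁻¹' Set.range f₂ = halfSpace P i l) ∧
        (∃ i l, K ⁻¹' Set.range f₃ = halfSpace P i l) ∧
        K '' hyperplane P i k ∪ D '' fundChamber P B ⊆ Set.range f₂ ∧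
        K '' hyperplane P i k ∪ D '' fundChamber P B ⊆ Set.range f₃

theorem act_reflection (P : RootPairing ι F V N) (j : ι) (x : V ⊗[F] Λ) :
    act Λ (P.reflection j) x = x - P.root j ⊗ₜ[F] ev P j x := by
  induction x with
  | zero => simp
  | add a b ha hb => simp only [map_add, ha, hb, TensorProduct.tmul_add]; abel
  | tmul v a =>
    rw [act_tmul, P.reflection_apply, TensorProduct.sub_tmul, ev_tmul, TensorProduct.smul_tmul]

theorem ev_act_reflection_self (P : RootPairing ι F V N) [P.IsRootSystem] (j : ι)
    (x : V ⊗[F] Λ) : ev P j (act Λ (P.reflection j) x) = - ev P j x := by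
  rw [act_reflection, map_sub, ev_tmul, coroot_root_self, two_smul]; abel

theorem act_reflection_act (P : RootPairing ι F V N) [P.IsRootSystem] (j : ι) (x : V ⊗[F] Λ) :
    act Λ (P.reflection j) (act Λ (P.reflection j) x) = x := by
  rw [← act_mul, reflection_mul_self, act_one]

theorem act_reflection_of_ev_eq_zero (P : RootPairing ι F V N) {j : ι} {x : V ⊗[F] Λ}
    (h : ev P j x = 0) : act Λ (P.reflection j) x = x := by
  rw [act_reflection, h, TensorProduct.tmul_zero, sub_zero]

theorem ev_eq_smul {P : RootPairing ι F V N} {i j : ι} {c : F}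
    (h : P.coroot' i = c • P.coroot' j) (x : V ⊗[F] Λ) : ev P i x = c • ev P j x := by
  induction x with
  | zero => simp
  | add a b ha hb => simp only [map_add, ha, hb, smul_add]
  | tmul v a => rw [ev_tmul, ev_tmul, h, LinearMap.smul_apply, smul_assoc]

section

variable {P : RootPairing ι F V N} [P.IsRootSystem] {B : Set ι} (hB : IsRootBasis P B)

theorem ev_fundWeight_self (j : B) (a : Λ) : ev P j (fundWeight P hB j ⊗ₜ[F] a) = a := by
  rw [ev_tmul, coroot_fundWeight_self, one_smul]

theorem ev_fundWeight_ne {j k : B} (h : k ≠ j) (a : Λ) :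
    ev P j (fundWeight P hB k ⊗ₜ[F] a) = 0 := by
  rw [ev_tmul, coroot_fundWeight_ne hB h.symm, zero_smul]

theorem coroot_fundWeight_ne_zero_of_parallel {i : ι} {j : B}
    (h : ∀ k, k ≠ j → P.coroot' i (fundWeight P hB k) = 0) :
    P.coroot' i (fundWeight P hB j) ≠ 0 := by
  obtain ⟨k, hk⟩ := exists_coroot_fundWeight_ne hB i
  by_cases hkj : k = j
  · rwa [hkj] at hk
  · exact absurd (h k hkj) hk

/-- Simple reflections permute the positive roots that are not parallel to the simple root. -/
theorem ev_act_reflection_nonneg {i : ι} {j k : B} (hi : 0 < P.coroot' i (rho P hB))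
    (hk : k ≠ j) (h : P.coroot' i (fundWeight P hB k) ≠ 0) {c : V ⊗[F] Λ}
    (hc : c ∈ fundChamber P B) : 0 ≤ ev P i (act Λ (P.reflection j) c) := by
  rw [ev_act_perm P (P.reflection j) (P.reflectionPerm j) (fun i x => P.coroot'_reflection x)]
  refine ev_nonneg hB (coroot_rho_pos_of_fundWeight hB (j := k) ?_) hc
  rw [← P.coroot'_reflection, reflection_fundWeight hB hk.symm]
  exact lt_of_le_of_ne (coroot_fundWeight_nonneg hB hi k) h.symm

theorem exists_smul_lt_of_ne {c : F} (hc : c ≠ 0) (l : Λ) : ∃ a : Λ, c • a < l := by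
  rcases lt_or_gt_of_ne hc with h | h
  · obtain ⟨a, -, ha⟩ := exists_smul_lt h l
    exact ⟨a, ha⟩
  · obtain ⟨a, -, ha⟩ := exists_smul_lt (neg_lt_zero.2 h) l
    exact ⟨-a, by rwa [smul_neg, ← neg_smul]⟩

/-- A closed convex set that contains a wall and a Weyl chamber on either side of it is the whole
space. -/
theorem IsClosedConvex.eq_univ_of_wall {Y : Set (V ⊗[F] Λ)} (hY : IsClosedConvex P Y) (j : B)
    {t : V ⊗[F] Λ} (h1 : ∀ k, k ≠ j → ∀ a, t + fundWeight P hB k ⊗ₜ[F] a ∈ Y)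
    (h2 : ∀ a, 0 ≤ a → t + fundWeight P hB j ⊗ₜ[F] a ∈ Y)
    (h3 : ∀ a, 0 ≤ a → t + act Λ (P.reflection j) (fundWeight P hB j ⊗ₜ[F] a) ∈ Y) :
    Y = Set.univ := by
  refine hY.eq_univ fun i l => ?_
  by_cases h : ∀ k, k ≠ j → P.coroot' i (fundWeight P hB k) = 0
  · have hne := coroot_fundWeight_ne_zero_of_parallel hB h
    have hc := ev_eq_smul (Λ := Λ) (coroot_eq_smul hB h)
    rcases lt_or_gt_of_ne hne with h0 | h0
    · obtain ⟨a, ha, hlt⟩ := exists_smul_lt h0 (l - ev P i t)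
      refine ⟨_, h2 a ha.le, ?_⟩
      rw [map_add, ev_tmul]
      exact lt_sub_iff_add_lt'.1 hlt
    · obtain ⟨a, ha, hlt⟩ := exists_smul_lt (neg_lt_zero.2 h0) (l - ev P i t)
      refine ⟨_, h3 a ha.le, ?_⟩
      rw [map_add, hc (act Λ _ _), ev_act_reflection_self, ev_fundWeight_self, smul_neg,
        ← neg_smul]
      exact lt_sub_iff_add_lt'.1 hlt
  · push Not at h
    obtain ⟨k, hk, hne⟩ := h
    obtain ⟨a, hlt⟩ := exists_smul_lt_of_ne hne (l - ev P i t)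
    refine ⟨_, h1 k hk a, ?_⟩
    rw [map_add, ev_tmul]
    exact lt_sub_iff_add_lt'.1 hlt

variable {𝒢 : Set (V ⊗[F] Λ → X)} (hA : IsFullAtlas P 𝒢)

/-- A chart obtained by attaching a chamber to a half-apartment `{k ≤ ev j}` of `K`. -/
def AttachPos (P : RootPairing ι F V N) (B : Set ι) (K D J : V ⊗[F] Λ → X) (j : ι)
    (t : V ⊗[F] Λ) : Prop :=
  (∀ x, ev P j t ≤ ev P j x → J x = K x) ∧
    ∀ c ∈ fundChamber P B, J (t + act Λ (P.reflection j) c) = D (t + act Λ (P.reflection j) c)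

/-- A chart obtained by attaching a chamber to a half-apartment `{ev j ≤ k}` of `K`. -/
def AttachNeg (P : RootPairing ι F V N) (B : Set ι) (K D J : V ⊗[F] Λ → X) (j : ι)
    (t : V ⊗[F] Λ) : Prop :=
  (∀ x, ev P j x ≤ ev P j t → J x = K x) ∧
    ∀ c ∈ fundChamber P B, J (t + c) = D (t + act Λ (P.reflection j) c)

include hB hA

/-- The apartment of f contains a wall of K, so it meets K in a half-apartment parallel to that
wall. After re-charting f to agree with K there, the chamber attached by D can sit in only two ways,
because the coordinate change fixes a panel pointwise. The side of K that is kept must be the one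
into which this chamber does not fall. -/
theorem attach_cases {K D f : V ⊗[F] Λ → X} (hK : K ∈ 𝒢) (hD : D ∈ 𝒢) (hf : f ∈ 𝒢) (j : B)
    (t : V ⊗[F] Λ)
    (h1 : ∀ c ∈ fundChamber P B, D (t + act Λ (P.reflection j) c) ∈ Set.range K → ev P j c = 0)
    (h2 : ∀ c ∈ fundChamber P B, ev P j c = 0 → D (t + c) = K (t + c))
    {i : ι} {l : Λ} (hfK : K ⁻¹' Set.range f = halfSpace P i l)
    (hw : K '' hyperplane P j (ev P j t) ⊆ Set.range f)
    (hS : ∀ c ∈ fundChamber P B, D (t + act Λ (P.reflection j) c) ∈ Set.range f) :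
    ∃ J ∈ 𝒢, Set.range J = Set.range f ∧
      (AttachPos P B K D J j t ∨ AttachNeg P B K D J j t) := by
  have hwall : ∀ x, ev P j x = ev P j t → l ≤ ev P i x := by
    intro x hx
    have : x ∈ K ⁻¹' Set.range f := hw ⟨x, hx, rfl⟩
    rw [hfK] at this
    exact this
  -- The wall extends infinitely in every direction ω_k with k ≠ j, so a half-space containing it
  -- must be constant in these directions.
  have hpar : ∀ k, k ≠ j → P.coroot' i (fundWeight P hB k) = 0 := by
    intro k hk
    by_contra hne
    obtain ⟨a, ha⟩ := exists_smul_lt_of_ne hne (l - ev P i t)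
    have := hwall (t + fundWeight P hB k ⊗ₜ[F] a)
      (by rw [map_add, ev_fundWeight_ne hB hk, add_zero])
    rw [map_add, ev_tmul] at this
    exact absurd this (not_le.2 (lt_sub_iff_add_lt'.1 ha))
  set c := P.coroot' i (fundWeight P hB j) with hc
  have hc0 : c ≠ 0 := coroot_fundWeight_ne_zero_of_parallel hB hpar
  have hev : ∀ x : V ⊗[F] Λ, ev P i x = c • ev P j x := ev_eq_smul (coroot_eq_smul hB hpar)
  have hl : l ≤ c • ev P j t := by rw [← hev]; exact hwall t rfl
  obtain ⟨y, hy⟩ := hw ⟨t, rfl, rfl⟩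
  obtain ⟨-, φ, hφ, Hφ⟩ := hA.compat K hK f hf t y hy.symm
  set J := f ∘ φ with hJ
  have hJ𝒢 : J ∈ 𝒢 := hA.comp f hf φ hφ
  have hrJ : Set.range J = Set.range f := range_comp_perm f φ
  have hJK : ∀ x, l ≤ c • ev P j x → J x = K x := by
    intro x hx
    have : x ∈ K ⁻¹' Set.range f := by rw [hfK, halfSpace, Set.mem_ofPred_eq, hev]; exact hx
    exact (Hφ x this).symm
  have hDt : D t = J t := by
    have h := h2 0 (zero_mem_fundChamber P B) (map_zero _)
    rw [add_zero] at h
    rw [h, hJK t hl]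
  obtain ⟨-, ψ, hψ, Hψ⟩ := hA.compat D hD J hJ𝒢 t t hDt
  obtain ⟨u, hu, hψu⟩ := affW_add hψ
  have hinj := hA.inj J hJ𝒢
  have hψt : ψ t = t := (hinj (hDt.symm.trans (Hψ t ⟨t, hDt.symm⟩))).symm
  have hψ' : ∀ y, ψ (t + y) = t + act Λ u y := fun y => by rw [hψu, hψt]
  have hufix : ∀ k, k ≠ j → u (fundWeight P hB k) = fundWeight P hB k := by
    intro k hk
    obtain ⟨a, ha⟩ := exists_posElt Λ
    have hz := ev_fundWeight_ne hB hk a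
    have h := h2 _ (fundWeight_tmul_mem hB ha.le k) hz
    rw [← hJK _ (by rw [map_add, hz, add_zero]; exact hl)] at h
    have h' := hinj (h.symm.trans (Hψ _ ⟨_, h.symm⟩))
    rw [hψ', add_right_inj, act_tmul] at h'
    refine (fundWeight P hB).ext_elem fun m => ?_
    have h3 := congrArg (ev P m) h'
    rw [ev_tmul, ev_tmul, ← sub_eq_zero, ← sub_smul, smul_eq_zero_iff_of_pos ha, sub_eq_zero] at h3
    rw [repr_fundWeight, repr_fundWeight]
    exact h3.symm
  refine ⟨J, hJ𝒢, hrJ, ?_⟩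
  have hDS : ∀ c ∈ fundChamber P B,
      D (t + act Λ (P.reflection j) c) = J (t + act Λ u (act Λ (P.reflection j) c)) := by
    intro c hc
    rw [← hψ']
    exact Hψ _ (by rw [hrJ]; exact hS c hc)
  obtain ⟨b, hb⟩ := exists_posElt Λ
  have hbC := fundWeight_tmul_mem hB hb.le j
  -- An interior point of the attached chamber cannot land in the half shared with K, since that
  -- chamber meets K only in its panel. This decides the sign of c in both cases below.
  have hbad : ¬ l ≤ c • ev P j (t + act Λ u (act Λ (P.reflection j) (fundWeight P hB j ⊗ₜ[F] b))) := by
    intro h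
    have h3 := h1 _ hbC (by rw [hDS _ hbC, hJK _ h]; exact ⟨_, rfl⟩)
    rw [ev_fundWeight_self] at h3
    exact hb.ne' h3
  rcases eq_one_or_reflection hB hu j hufix with rfl | rfl
  · left
    have hcpos : 0 < c := by
      refine lt_of_le_of_ne (not_lt.1 fun hneg => hbad ?_) hc0.symm
      rw [act_one, map_add, ev_act_reflection_self, ev_fundWeight_self, smul_add, smul_neg,
        ← neg_smul]
      exact hl.trans (le_add_of_nonneg_right (smul_nonneg (neg_nonneg.2 hneg.le) hb.le))
    refine ⟨fun x hx => hJK x (hl.trans (smul_le_smul_of_nonneg_left hx hcpos.le)), fun c hc => ?_⟩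
    rw [hDS c hc, act_one]
  · right
    have hcneg : c < 0 := by
      refine lt_of_le_of_ne (not_lt.1 fun hpos => hbad ?_) hc0
      rw [act_reflection_act, map_add, ev_fundWeight_self, smul_add]
      exact hl.trans (le_add_of_nonneg_right (smul_nonneg hpos.le hb.le))
    refine ⟨fun x hx => hJK x (hl.trans ?_), fun c hc => ?_⟩
    · have := smul_le_smul_of_nonneg_left hx (neg_nonneg.2 hcneg.le)
      rw [neg_smul, neg_smul] at this
      exact neg_le_neg_iff.1 this
    · rw [hDS c hc, act_reflection_act]

/-- The common part of the two apartments is convex and contains a wall together with a chamber on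
either side of it, so it is everything. Used to show that two attachments on the same side of the
wall coincide. -/
theorem range_subset_of_attachPos {K D J J' : V ⊗[F] Λ → X} (hJ : J ∈ 𝒢) (hJ' : J' ∈ 𝒢) (j : B)
    {t : V ⊗[F] Λ} (h : AttachPos P B K D J j t) (h' : AttachPos P B K D J' j t) :
    Set.range J ⊆ Set.range J' := by
  have h1 : ∀ x, ev P j t ≤ ev P j x → x ∈ J ⁻¹' Set.range J' := fun x hx =>
    ⟨x, by rw [h.1 x hx, h'.1 x hx]⟩
  have hY := (hA.compat J hJ J' hJ' t t (by rw [h.1 t le_rfl, h'.1 t le_rfl])).1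
  have huniv := hY.eq_univ_of_wall hB j (t := t)
    (fun k hk a => h1 _ (by rw [map_add, ev_fundWeight_ne hB hk, add_zero]))
    (fun a ha => h1 _ (by rw [map_add, ev_fundWeight_self]; exact le_add_of_nonneg_right ha))
    (fun a ha => ⟨t + act Λ (P.reflection j) (fundWeight P hB j ⊗ₜ[F] a), by
      rw [h.2 _ (fundWeight_tmul_mem hB ha j), h'.2 _ (fundWeight_tmul_mem hB ha j)]⟩)
  rintro _ ⟨x, rfl⟩
  have : x ∈ J ⁻¹' Set.range J' := huniv ▸ trivial
  exact this

theorem range_subset_of_attachNeg {K D J J' : V ⊗[F] Λ → X} (hJ : J ∈ 𝒢) (hJ' : J' ∈ 𝒢) (j : B)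
    {t : V ⊗[F] Λ} (h : AttachNeg P B K D J j t) (h' : AttachNeg P B K D J' j t) :
    Set.range J ⊆ Set.range J' := by
  have h1 : ∀ x, ev P j x ≤ ev P j t → x ∈ J ⁻¹' Set.range J' := fun x hx =>
    ⟨x, by rw [h.1 x hx, h'.1 x hx]⟩
  have hY := (hA.compat J hJ J' hJ' t t (by rw [h.1 t le_rfl, h'.1 t le_rfl])).1
  have huniv := hY.eq_univ_of_wall hB j (t := t)
    (fun k hk a => h1 _ (by rw [map_add, ev_fundWeight_ne hB hk, add_zero]))
    (fun a ha => ⟨t + fundWeight P hB j ⊗ₜ[F] a, by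
      rw [h.2 _ (fundWeight_tmul_mem hB ha j), h'.2 _ (fundWeight_tmul_mem hB ha j)]⟩)
    (fun a ha => h1 _ (by
      rw [map_add, ev_act_reflection_self, ev_fundWeight_self]
      exact add_le_of_nonpos_right (neg_nonpos.2 ha)))
  rintro _ ⟨x, rfl⟩
  have : x ∈ J ⁻¹' Set.range J' := huniv ▸ trivial
  exact this

/-- Crossing a panel at infinity: if the charts `K` and `D` share a Weyl chamber, then either `K`
also contains a subchamber of the `j`-adjacent chamber of `D`, or `K` is cut by a wall into two
half-apartments both of which lie in an apartment with such a subchamber. -/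
theorem exists_attach (hS : Sundial P B 𝒢) {K D : V ⊗[F] Λ → X} (hK : K ∈ 𝒢) (hD : D ∈ 𝒢)
    (j : B) {a : V ⊗[F] Λ} (hKD : ∀ c ∈ fundChamber P B, K (a + c) = D (a + c)) :
    (∀ c ∈ fundChamber P B,
      K (a + act Λ (P.reflection j) c) = D (a + act Λ (P.reflection j) c)) ∨
    ∃ t, (∃ J ∈ 𝒢, AttachPos P B K D J j t) ∧ ∃ J ∈ 𝒢, AttachNeg P B K D J j t := by
  classical
  have ha : K a = D a := by
    have := hKD 0 (zero_mem_fundChamber P B)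
    rwa [add_zero] at this
  have hZconv := (hA.compat K hK D hD a a ha).1
  obtain ⟨s, hs⟩ := hZconv.exists_finset
  have hZ1 : ∀ x, x ∈ K ⁻¹' Set.range D → K x = D x := fun x hx =>
    eq_of_mem_range_of_chamber hB hA hK hD hKD hx
  have hZ2 : ∀ x, D x ∈ Set.range K → x ∈ K ⁻¹' Set.range D := fun x hx =>
    ⟨x, eq_of_mem_range_of_chamber hB hA hD hK (fun c hc => (hKD c hc).symm) hx⟩
  have hpos : ∀ p ∈ s, 0 < P.coroot' p.1 (rho P hB) := fun p hp =>
    coroot_rho_pos_of_bddBelow hB fun c hc => (hs (a + c)).1 ⟨_, (hKD c hc).symm⟩ p hp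
  have haZ := (hs a).1 ⟨a, ha.symm⟩
  -- Among the half-spaces cutting out the common part of K and D, only those parallel to the j-th
  -- wall can obstruct the crossing: the other roots remain nonnegative on the reflected chamber.
  let par : ι × Λ → Prop := fun p => ∀ k, k ≠ j → P.coroot' p.1 (fundWeight P hB k) = 0
  have hnp : ∀ p ∈ s, ¬ par p → ∀ c ∈ fundChamber P B,
      0 ≤ ev P p.1 (act Λ (P.reflection j) c) := by
    intro p hp hpar c hc
    simp only [par] at hpar
    push Not at hpar
    obtain ⟨k, hk, hne⟩ := hpar
    exact ev_act_reflection_nonneg hB (hpos p hp) hk hne hc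
  by_cases hex : (s.filter par).Nonempty
  swap
  · left
    intro c hc
    refine hZ1 _ ((hs _).2 fun p hp => ?_)
    rw [map_add]
    exact (haZ p hp).trans (le_add_of_nonneg_right (hnp p hp
      (fun h => hex ⟨p, Finset.mem_filter.2 ⟨hp, h⟩⟩) c hc))
  right
  let cf : ι × Λ → F := fun p => P.coroot' p.1 (fundWeight P hB j)
  have hcf : ∀ p ∈ s, par p → 0 < cf p := fun p hp h =>
    lt_of_le_of_ne (coroot_fundWeight_nonneg hB (hpos p hp) j)
      (coroot_fundWeight_ne_zero_of_parallel hB h).symm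
  -- After normalizing by the positive factor `cf p`, the parallel constraints all bound `ev P j`
  -- from below. The strictest one is the wall at which K and D separate.
  obtain ⟨p₀, hp₀, hmax⟩ := (s.filter par).exists_max_image (fun p => (cf p)⁻¹ • p.2) hex
  rw [Finset.mem_filter] at hp₀
  set k := (cf p₀)⁻¹ • p₀.2 with hk
  have hparev : ∀ p, par p → ∀ x : V ⊗[F] Λ, ev P p.1 x = cf p • ev P j x := fun p hp =>
    ev_eq_smul (coroot_eq_smul hB hp)
  have hparle : ∀ p ∈ s, par p → ∀ x : V ⊗[F] Λ,
      (p.2 ≤ ev P p.1 x ↔ (cf p)⁻¹ • p.2 ≤ ev P j x) := by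
    intro p hp h x
    rw [hparev p h, ← inv_smul_le_iff_of_pos (hcf p hp h)]
  -- a base point far out on the wall
  have hnppos : ∀ p ∈ s, ¬ par p → 0 < P.coroot' p.1 (rho P hB - fundWeight P hB j) := by
    intro p hp hpar
    simp only [par] at hpar
    push Not at hpar
    obtain ⟨m, hm, hne⟩ := hpar
    let _ := Fintype.ofFinite B
    have : rho P hB - fundWeight P hB j = ∑ x ∈ Finset.univ.erase j, fundWeight P hB x := by
      rw [Finset.sum_erase_eq_sub (Finset.mem_univ j)]; rfl
    rw [this, map_sum]
    exact Finset.sum_pos' (fun x _ => coroot_fundWeight_nonneg hB (hpos p hp) x)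
      ⟨m, Finset.mem_erase.2 ⟨hm, Finset.mem_univ m⟩,
        lt_of_le_of_ne (coroot_fundWeight_nonneg hB (hpos p hp) m) hne.symm⟩
  obtain ⟨M, hM⟩ := (s.image fun p =>
    (P.coroot' p.1 (rho P hB - fundWeight P hB j))⁻¹ • (p.2 - cf p • k)).bddAbove
  -- The first summand puts t on the separating wall. The second moves it inside that wall, along
  -- the sum of the other fundamental weights, far enough to satisfy every non-parallel constraint.
  let t : V ⊗[F] Λ := fundWeight P hB j ⊗ₜ[F] k + (rho P hB - fundWeight P hB j) ⊗ₜ[F] M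
  have htj : ev P j t = k := by
    simp only [t]
    rw [map_add, ev_fundWeight_self, ev_tmul, map_sub, coroot_rho_simple, coroot_fundWeight_self,
      sub_self, zero_smul, add_zero]
  have htnp : ∀ p ∈ s, ¬ par p → p.2 ≤ ev P p.1 t := by
    intro p hp hpar
    have h1 := hM (Finset.mem_coe.2 (Finset.mem_image_of_mem _ hp))
    rw [inv_smul_le_iff_of_pos (hnppos p hp hpar), sub_le_iff_le_add'] at h1
    simp only [t]
    rw [map_add, ev_tmul, ev_tmul]
    exact h1
  have hmemZ : ∀ x ∈ fundChamber P B,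
      (t + act Λ (P.reflection j) x ∈ K ⁻¹' Set.range D ↔ ev P j x = 0) := by
    intro x hx
    have hx0 := hx j j.2
    rw [hs]
    constructor
    · intro h
      have h1 := (hparle p₀ hp₀.1 hp₀.2 _).1 (h p₀ hp₀.1)
      rw [← hk, map_add, htj, ev_act_reflection_self] at h1
      exact le_antisymm (neg_nonneg.1 (le_add_iff_nonneg_right _ |>.1 h1)) hx0
    · intro h p hp
      by_cases hpar : par p
      · rw [hparle p hp hpar, map_add, ev_act_reflection_self, h, neg_zero, add_zero, htj]
        exact hmax p (Finset.mem_filter.2 ⟨hp, hpar⟩)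
      · rw [map_add]
        exact (htnp p hp hpar).trans (le_add_of_nonneg_right (hnp p hp hpar x hx))
  have h1 : ∀ c ∈ fundChamber P B,
      D (t + act Λ (P.reflection j) c) ∈ Set.range K → ev P j c = 0 := fun c hc h =>
    (hmemZ c hc).1 (hZ2 _ h)
  have h2' : ∀ c ∈ fundChamber P B, ev P j c = 0 →
      K (t + act Λ (P.reflection j) c) = D (t + act Λ (P.reflection j) c) := fun c hc h =>
    hZ1 _ ((hmemZ c hc).2 h)
  have h2 : ∀ c ∈ fundChamber P B, ev P j c = 0 → D (t + c) = K (t + c) := by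
    intro c hc h
    have := h2' c hc h
    rw [act_reflection_of_ev_eq_zero P h] at this
    exact this.symm
  -- This change of chart turns the j-adjacent chamber of D at t into the image of the fundamental
  -- chamber, and that chamber meets K exactly in its j-panel.
  set χ : Equiv.Perm (V ⊗[F] Λ) := Equiv.addRight t * lin Λ (P.reflection j) with hχ
  have hχ𝒢 : χ ∈ affW Λ P := mul_mem (addRight_mem P t) (lin_mem P (reflection_mem_weyl P j))
  have hχ' : ∀ c, (D ∘ χ) c = D (t + act Λ (P.reflection j) c) := by
    intro c
    rw [add_comm t]; rfl
  have hcap : (D ∘ χ) '' fundChamber P B ∩ Set.range K = (D ∘ χ) '' fundPanel P B j := by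
    ext z
    constructor
    · rintro ⟨⟨c, hc, rfl⟩, hz⟩
      rw [hχ'] at hz
      exact ⟨c, ⟨hc, h1 c hc hz⟩, rfl⟩
    · rintro ⟨c, ⟨hc, h0⟩, rfl⟩
      refine ⟨⟨c, hc, rfl⟩, ?_⟩
      rw [hχ', ← h2' c hc h0]
      exact ⟨_, rfl⟩
  have hwall : (D ∘ χ) '' fundChamber P B ∩ Set.range K ⊆ K '' hyperplane P j (ev P j t) := by
    rw [hcap]
    rintro z ⟨c, ⟨hc, h0⟩, rfl⟩
    refine ⟨t + act Λ (P.reflection j) c, ?_, ?_⟩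
    · show ev P j _ = _
      rw [map_add, ev_act_reflection_self, h0, neg_zero, add_zero]
    · rw [hχ', h2' c hc h0]
  obtain ⟨f₂, hf₂, f₃, hf₃, hne, ⟨i₂, l₂, hi₂⟩, ⟨i₃, l₃, hi₃⟩, hs₂, hs₃⟩ :=
    hS K hK (D ∘ χ) (hA.comp D hD χ hχ𝒢) j j.2 hcap j (ev P j t) hwall
  obtain ⟨J₂, hJ₂, hr₂, hc₂⟩ := attach_cases hB hA hK hD hf₂ j t h1 h2 hi₂
    (Set.subset_union_left.trans hs₂)
    (fun c hc => by rw [← hχ']; exact hs₂ (Or.inr ⟨c, hc, rfl⟩))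
  obtain ⟨J₃, hJ₃, hr₃, hc₃⟩ := attach_cases hB hA hK hD hf₃ j t h1 h2 hi₃
    (Set.subset_union_left.trans hs₃)
    (fun c hc => by rw [← hχ']; exact hs₃ (Or.inr ⟨c, hc, rfl⟩))
  rw [← hr₂, ← hr₃] at hne
  refine ⟨t, ?_⟩
  -- The two sundial apartments differ, so they cannot keep the same half of K.
  rcases hc₂ with hc₂ | hc₂ <;> rcases hc₃ with hc₃ | hc₃
  · exact absurd (Set.Subset.antisymm (range_subset_of_attachPos hB hA hJ₂ hJ₃ j hc₂ hc₃)
      (range_subset_of_attachPos hB hA hJ₃ hJ₂ j hc₃ hc₂)) hne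
  · exact ⟨⟨J₂, hJ₂, hc₂⟩, J₃, hJ₃, hc₃⟩
  · exact ⟨⟨J₃, hJ₃, hc₃⟩, J₂, hJ₂, hc₂⟩
  · exact absurd (Set.Subset.antisymm (range_subset_of_attachNeg hB hA hJ₂ hJ₃ j hc₂ hc₃)
      (range_subset_of_attachNeg hB hA hJ₃ hJ₂ j hc₃ hc₂)) hne

end

/-! ### Germs, chambers at infinity and relative positions -/

theorem exists_pos_forall_le {α : Type*} (s : Finset α) (f : α → Λ) (h : ∀ p ∈ s, 0 < f p) :
    ∃ ε : Λ, 0 < ε ∧ ∀ p ∈ s, ε ≤ f p := by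
  classical
  rcases s.eq_empty_or_nonempty with rfl | hs
  · obtain ⟨e, he⟩ := exists_posElt Λ
    exact ⟨e, he, by simp⟩
  · obtain ⟨q, hq, hmin⟩ := s.exists_min_image f hs
    exact ⟨f q, h q hq, hmin⟩

theorem weyl_finite (P : RootPairing ι F V N) [P.IsRootSystem] {B : Set ι}
    (hB : IsRootBasis P B) : Finite (weyl P) := by
  choose σ hσ using fun w : weyl P => exists_perm P w.1 w.2
  refine Finite.of_injective σ fun v w h => ?_
  ext x
  refine (fundWeight P hB).ext_elem fun j => ?_
  rw [repr_fundWeight, repr_fundWeight, hσ, hσ, h]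

theorem comp_lin_lin (g : V ⊗[F] Λ → X) (u v : V ≃ₗ[F] V) :
    (g ∘ lin Λ u) ∘ lin Λ v = g ∘ lin Λ (u * v) := by
  funext x
  exact congrArg g (act_mul u v x).symm

/-- Working form of the axiom (A4): two chambers have subchambers in a common apartment. -/
def SubchambersJoin (P : RootPairing ι F V N) (B : Set ι) (𝒢 : Set (V ⊗[F] Λ → X)) : Prop :=
  ∀ g ∈ 𝒢, ∀ h ∈ 𝒢, ∃ f ∈ 𝒢, ∃ a b, (∀ c ∈ fundChamber P B, g (a + c) ∈ Set.range f) ∧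
    ∀ c ∈ fundChamber P B, h (b + c) ∈ Set.range f

/-- Working form of the axiom (ALA). -/
def GermsJoin (P : RootPairing ι F V N) (B : Set ι) (𝒢 : Set (V ⊗[F] Λ → X)) : Prop :=
  ∀ x, ∀ h ∈ 𝒢, ∃ f ∈ 𝒢, x ∈ Set.range f ∧ GermEq P B f h

/-- The chamber of `G` has a subchamber in common with the chamber of direction `u` of `J`. -/
def Par (P : RootPairing ι F V N) (B : Set ι) (G J : V ⊗[F] Λ → X) (u : V ≃ₗ[F] V) : Prop :=
  ∃ e t, ∀ c ∈ fundChamber P B, G (e + c) = J (t + act Λ u c)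

/-- The germ of the chamber of `G` has position `δ` with respect to the chamber of `E`. -/
def Pos (P : RootPairing ι F V N) (B : Set ι) (𝒢 : Set (V ⊗[F] Λ → X)) (E G : V ⊗[F] Λ → X)
    (δ : V ≃ₗ[F] V) : Prop :=
  δ ∈ weyl P ∧ ∃ f ∈ 𝒢, (∀ c ∈ fundChamber P B, f c = E c) ∧ GermEq P B (f ∘ lin Λ δ) G

section

variable {P : RootPairing ι F V N} [P.IsRootSystem] {B : Set ι} (hB : IsRootBasis P B)
  {𝒢 : Set (V ⊗[F] Λ → X)} (hA : IsFullAtlas P 𝒢)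

theorem ev_act_nonneg {w : V ≃ₗ[F] V} (hw : w ∈ weyl P) {i : ι}
    (h : 0 < P.coroot' i (w (rho P hB))) {c : V ⊗[F] Λ} (hc : c ∈ fundChamber P B) :
    0 ≤ ev P i (act Λ w c) := by
  obtain ⟨σ, hσ⟩ := exists_perm P w hw
  rw [ev_act_perm P w σ hσ]
  exact ev_nonneg hB (by rwa [← hσ]) hc

theorem ev_act_nonpos {w : V ≃ₗ[F] V} (hw : w ∈ weyl P) {i : ι}
    (h : P.coroot' i (w (rho P hB)) < 0) {c : V ⊗[F] Λ} (hc : c ∈ fundChamber P B) :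
    ev P i (act Λ w c) ≤ 0 := by
  obtain ⟨σ, hσ⟩ := exists_perm P w hw
  rw [ev_act_perm P w σ hσ]
  exact ev_nonpos hB (by rwa [← hσ]) hc

theorem Pos.congr {E G G' : V ⊗[F] Λ → X} {δ : V ≃ₗ[F] V} (h : Pos P B 𝒢 E G δ)
    (h' : GermEq P B G G') : Pos P B 𝒢 E G' δ := by
  obtain ⟨hδ, f, hf, hfE, hfG⟩ := h
  exact ⟨hδ, f, hf, hfE, hfG.trans h'⟩

include hB

/-- A wall does not cut the germ of a Weyl chamber. -/
theorem germ_side {φ : Equiv.Perm (V ⊗[F] Λ)} (hφ : φ ∈ affW Λ P) (i : ι) (k : Λ) :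
    (∃ ε : Λ, 0 < ε ∧ ∀ c ∈ fundChamber P B, c ∈ small P ε → k ≤ ev P i (φ c)) ∨
    ∃ ε : Λ, 0 < ε ∧ ∀ c ∈ fundChamber P B, c ∈ small P ε → ev P i (φ c) ≤ k := by
  obtain ⟨σ, hσ⟩ := ev_affW hφ
  obtain ⟨e, he⟩ := exists_posElt Λ
  rcases lt_or_gt_of_ne (coroot_rho_ne hB (σ i)) with h | h
  · rcases le_or_gt (ev P i (φ 0)) k with hk | hk
    · refine Or.inr ⟨e, he, fun c hc _ => ?_⟩
      rw [hσ]
      exact (add_le_of_nonpos_left (ev_nonpos hB h hc)).trans hk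
    · refine Or.inl ⟨ev P i (φ 0) - k, sub_pos.2 hk, fun c hc hs => ?_⟩
      rw [hσ]
      have := (neg_lt_of_abs_lt (hs (σ i))).le
      rw [neg_sub] at this
      have := add_le_add_left this (ev P i (φ 0))
      rwa [sub_add_cancel] at this
  · rcases le_or_gt k (ev P i (φ 0)) with hk | hk
    · refine Or.inl ⟨e, he, fun c hc _ => ?_⟩
      rw [hσ]
      exact hk.trans (le_add_of_nonneg_left (ev_nonneg hB h hc))
    · refine Or.inr ⟨k - ev P i (φ 0), sub_pos.2 hk, fun c hc hs => ?_⟩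
      rw [hσ]
      have := (lt_of_abs_lt (hs (σ i))).le
      rwa [← le_sub_iff_add_le]

/-- The subchambers of D supplied by the two hypotheses have the same direction, so they contain a
common parallel subchamber, through which G and J are compared. -/
theorem par_of_par {G D J : V ⊗[F] Λ → X} {u v : V ≃ₗ[F] V} (h : Par P B G D u)
    {t t' : V ⊗[F] Λ} (h' : ∀ c ∈ fundChamber P B, J (t + act Λ v c) = D (t' + act Λ u c)) :
    Par P B G J v := by
  obtain ⟨e, s, h⟩ := h
  obtain ⟨z, hz1, hz2⟩ := exists_sub_mem_fundChamber hB 0 (act Λ u⁻¹ (t' - s))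
  rw [sub_zero] at hz1
  refine ⟨e + z, t + act Λ v (z - act Λ u⁻¹ (t' - s)), fun c hc => ?_⟩
  rw [add_assoc, h _ (add_mem_fundChamber hz1 hc), add_assoc, ← map_add,
    h' _ (add_mem_fundChamber hz2 hc)]
  congr 1
  rw [map_add, map_add, map_sub, act_act_inv]
  abel

theorem Par.congr {G G' D : V ⊗[F] Λ → X} {u : V ≃ₗ[F] V} (h : Par P B G D u)
    (h' : ∀ c ∈ fundChamber P B, G c = G' c) : Par P B G' D u := by
  obtain ⟨e, s, h⟩ := h
  obtain ⟨z, hz1, hz2⟩ := exists_sub_mem_fundChamber hB 0 e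
  rw [sub_zero] at hz1
  refine ⟨z, s + act Λ u (z - e), fun c hc => ?_⟩
  rw [← h' _ (add_mem_fundChamber hz1 hc), add_assoc, ← map_add,
    ← h _ (add_mem_fundChamber hz2 hc)]
  congr 1
  abel

include hA

theorem exists_chart_chamber (hP : ∀ x y, ∃ f ∈ 𝒢, x ∈ Set.range f ∧ y ∈ Set.range f)
    (x y : X) : ∃ g ∈ 𝒢, g 0 = x ∧ y ∈ g '' fundChamber P B := by
  obtain ⟨f, hf, ⟨a, rfl⟩, b, rfl⟩ := hP x y
  obtain ⟨w, hw, hC⟩ := exists_dominant P B hB (b - a)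
  refine ⟨f ∘ (Equiv.addRight a * lin Λ w⁻¹ : Equiv.Perm _),
    hA.comp f hf _ (mul_mem (addRight_mem P a) (lin_mem P (inv_mem hw))), ?_, _, hC, ?_⟩
  · show f (act Λ w⁻¹ 0 + a) = f a
    rw [map_zero, zero_add]
  · show f (act Λ w⁻¹ (act Λ w (b - a)) + a) = f b
    rw [act_inv_act, sub_add_cancel]

/-- Crossing a panel at infinity while keeping a germ. -/
theorem exists_germEq_step (hS : Sundial P B 𝒢) {h D : V ⊗[F] Λ → X} (hD : D ∈ 𝒢)
    {u : V ≃ₗ[F] V} (hu : u ∈ weyl P) (j : B)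
    (H : ∃ f ∈ 𝒢, GermEq P B f h ∧ ∃ a, ∀ c ∈ fundChamber P B, D (a + act Λ u c) ∈ Set.range f) :
    ∃ f ∈ 𝒢, GermEq P B f h ∧
      ∃ a, ∀ c ∈ fundChamber P B, D (a + act Λ (u * P.reflection j) c) ∈ Set.range f := by
  obtain ⟨f, hf, hfh, a, ha⟩ := H
  set D' := D ∘ lin Λ u with hD'
  have hD'𝒢 : D' ∈ 𝒢 := hA.comp D hD _ (lin_mem P hu)
  have hDD' : ∀ x y, D' (x + y) = D (act Λ u x + act Λ u y) := fun x y =>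
    congrArg D (map_add (act Λ u) x y)
  have ha' : ∀ c ∈ fundChamber P B, D' (act Λ u⁻¹ a + c) ∈ Set.range f := by
    intro c hc
    rw [hDD', act_act_inv]; exact ha c hc
  obtain ⟨y, hy⟩ := ha' 0 (zero_mem_fundChamber P B)
  obtain ⟨-, φ, hφ, Hφ⟩ := hA.compat D' hD'𝒢 f hf _ y hy.symm
  have hK := hA.comp f hf φ hφ
  have hKf : Set.range (f ∘ φ) = Set.range f := range_comp_perm f φ
  rcases exists_attach hB hA hS hK hD'𝒢 j (a := act Λ u⁻¹ a)
    (fun c hc => (Hφ _ (ha' c hc)).symm) with h0 | ⟨t, ⟨J, hJ, h1, h2⟩, J', hJ', h1', h2'⟩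
  · refine ⟨f, hf, hfh, a, fun c hc => ?_⟩
    have := h0 c hc
    rw [hDD', act_act_inv, ← act_mul] at this
    rw [← hKf]
    exact ⟨_, this⟩
  · have hφi := inv_mem hφ
    have hφφ : ∀ x, φ (φ⁻¹ x) = x := fun x => φ.apply_symm_apply x
    -- The germ lies on one side of the cutting wall; the attached apartment that keeps this half
    -- keeps the germ.
    rcases germ_side hB hφi j (ev P j t) with ⟨ε, hε, hs⟩ | ⟨ε, hε, hs⟩
    · refine ⟨J ∘ ⇑φ⁻¹, hA.comp J hJ _ hφi, GermEq.trans ⟨ε, hε, fun c hc hcs => ?_⟩ hfh,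
        act Λ u t, fun c hc => ?_⟩
      · rw [Function.comp_apply, h1 _ (hs c hc hcs), Function.comp_apply, hφφ]
      · rw [range_comp_perm, act_mul, ← hDD', ← h2 c hc]
        exact ⟨_, rfl⟩
    · refine ⟨J' ∘ ⇑φ⁻¹, hA.comp J' hJ' _ hφi, GermEq.trans ⟨ε, hε, fun c hc hcs => ?_⟩ hfh,
        act Λ u t, fun c hc => ?_⟩
      · rw [Function.comp_apply, h1' _ (hs c hc hcs), Function.comp_apply, hφφ]
      · rw [range_comp_perm, act_mul, ← hDD', ← h2' c hc]
        exact ⟨_, rfl⟩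

/-- Walk along a minimal gallery at infinity in D from direction u to direction v. The number n
counts the panels still to be crossed. -/
theorem exists_germEq_of_direction (hS : Sundial P B 𝒢) {h D : V ⊗[F] Λ → X} (hD : D ∈ 𝒢)
    {v : V ≃ₗ[F] V} (hv : v ∈ weyl P) (n : ℕ) :
    ∀ u ∈ weyl P, length hB (v⁻¹ * u) = n →
    (∃ f ∈ 𝒢, GermEq P B f h ∧ ∃ a, ∀ c ∈ fundChamber P B, D (a + act Λ u c) ∈ Set.range f) →
    ∃ f ∈ 𝒢, GermEq P B f h ∧
      ∃ a, ∀ c ∈ fundChamber P B, D (a + act Λ v c) ∈ Set.range f := by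
  induction n with
  | zero =>
    rintro u hu hn ⟨f, hf, hfh, a, ha⟩
    refine ⟨f, hf, hfh, a, fun c hc => ?_⟩
    have hz : v⁻¹ * u ∈ weyl P := mul_mem (inv_mem hv) hu
    -- Length zero means that v⁻¹u preserves the fundamental chamber, so u and v determine the same
    -- direction.
    have hmem : act Λ (v⁻¹ * u)⁻¹ c ∈ fundChamber P B := by
      intro j hj
      refine ev_act_nonneg hB (inv_mem hz) ?_ hc
      by_contra hcon
      have := length_mul_reflection_neg hB hz ⟨j, hj⟩
        (lt_of_le_of_ne (not_lt.1 hcon) (coroot_act_rho_ne hB (inv_mem hz) j))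
      omega
    have := ha _ hmem
    rwa [← act_mul, mul_inv_rev, inv_inv, mul_inv_cancel_left] at this
  | succ n ih =>
    intro u hu hn H
    obtain ⟨j, hj⟩ := exists_neg_of_length_pos hB (mul_mem (inv_mem hv) hu) (by rw [hn]; omega)
    have hl := length_mul_reflection_neg hB (mul_mem (inv_mem hv) hu) j hj
    rw [mul_assoc] at hl
    exact ih (u * P.reflection j) (mul_mem hu (reflection_mem_weyl P j)) (by omega)
      (exists_germEq_step hB hA hS hD hu j H)

/-- Every germ of a chamber and every chamber at infinity lie in a common apartment. -/
theorem exists_germEq_subchamber (hS : Sundial P B 𝒢) (h4 : SubchambersJoin P B 𝒢)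
    {h g : V ⊗[F] Λ → X} (hh : h ∈ 𝒢) (hg : g ∈ 𝒢) :
    ∃ f ∈ 𝒢, GermEq P B f h ∧ ∃ b, ∀ c ∈ fundChamber P B, g (b + c) ∈ Set.range f := by
  obtain ⟨D, hD, a, b, ha, hb⟩ := h4 h hh g hg
  obtain ⟨y, hy⟩ := ha 0 (zero_mem_fundChamber P B)
  obtain ⟨-, χ, hχ, Hχ⟩ := hA.compat h hh D hD _ y hy.symm
  obtain ⟨y', hy'⟩ := hb 0 (zero_mem_fundChamber P B)
  obtain ⟨-, ψ, hψ, Hψ⟩ := hA.compat g hg D hD _ y' hy'.symm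
  obtain ⟨u, hu, hχu⟩ := affW_add hχ
  obtain ⟨v, hv, hψv⟩ := affW_add hψ
  -- The walk starts at h itself, which contains its own germ and, by (A4), a subchamber of
  -- direction u of D.
  obtain ⟨f, hf, hfh, a', ha'⟩ := exists_germEq_of_direction hB hA hS (h := h) hD hv _ u hu rfl
    ⟨h, hh, GermEq.refl P B h, χ a, fun c hc => by
      rw [← hχu, ← Hχ _ (ha c hc)]; exact ⟨_, rfl⟩⟩
  obtain ⟨z, hz1, hz2⟩ := exists_sub_mem_fundChamber hB b (ψ⁻¹ a')
  refine ⟨f, hf, hfh, z, fun c hc => ?_⟩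
  have h1 : z + c = b + ((z - b) + c) := by abel
  have h2 : z + c = ψ⁻¹ a' + ((z - ψ⁻¹ a') + c) := by abel
  have h3 : ψ (ψ⁻¹ a') = a' := ψ.apply_symm_apply a'
  rw [h1, Hψ _ (hb _ (add_mem_fundChamber hz1 hc)), ← h1, h2, hψv, h3]
  exact ha' _ (add_mem_fundChamber hz2 hc)

/-- Every germ of a chamber and every chamber with the same base point lie in a common
apartment. -/
theorem exists_germEq_chamber (hS : Sundial P B 𝒢) (h4 : SubchambersJoin P B 𝒢)
    {h g : V ⊗[F] Λ → X} (hh : h ∈ 𝒢) (hg : g ∈ 𝒢) (h0 : h 0 = g 0) :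
    ∃ f ∈ 𝒢, GermEq P B f h ∧ ∀ c ∈ fundChamber P B, g c ∈ Set.range f := by
  obtain ⟨f, hf, hfh, b, hb⟩ := exists_germEq_subchamber hB hA hS h4 hh hg
  refine ⟨f, hf, hfh, fun c hc => ?_⟩
  have hgf : g 0 = f 0 := by rw [← h0, hfh.apply_zero]
  have := (hA.compat g hg f hf 0 0 hgf).1.add_mem hB (x := 0) (y := b) ⟨0, hgf.symm⟩ hb hc
  rwa [zero_add] at this

theorem germsJoin_of_sundial (hS : Sundial P B 𝒢) (h4 : SubchambersJoin P B 𝒢)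
    (hP : ∀ x y, ∃ f ∈ 𝒢, x ∈ Set.range f ∧ y ∈ Set.range f) : GermsJoin P B 𝒢 := by
  intro x h hh
  obtain ⟨g, hg, hg0, c, hc, rfl⟩ := exists_chart_chamber hB hA hP (h 0) x
  obtain ⟨f, hf, hfh, hfg⟩ := exists_germEq_chamber hB hA hS h4 hh hg hg0.symm
  exact ⟨f, hf, hfg c hc, hfh⟩

/-- Parallel chambers with the same base point coincide. -/
theorem Par.eq {G J : V ⊗[F] Λ → X} (hG : G ∈ 𝒢) (hJ : J ∈ 𝒢) {u : V ≃ₗ[F] V} (hu : u ∈ weyl P)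
    (h : Par P B G J u) (h0 : G 0 = J 0) {c : V ⊗[F] Λ} (hc : c ∈ fundChamber P B) :
    G c = J (act Λ u c) := by
  obtain ⟨e, t, h⟩ := h
  set χ : Equiv.Perm (V ⊗[F] Λ) := Equiv.addRight (t - act Λ u e) * lin Λ u with hχ
  have hχW : χ ∈ affW Λ P := mul_mem (addRight_mem P _) (lin_mem P hu)
  have hχ' : ∀ x, χ x = act Λ u x + (t - act Λ u e) := fun x => rfl
  have key : ∀ c ∈ fundChamber P B, G c = (J ∘ χ) c := fun c hc =>
    eq_on_fundChamber hB hA hG (hA.comp J hJ χ hχW) (a := e)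
      (fun c hc => by
        rw [h c hc, Function.comp_apply, hχ', map_add]
        congr 1
        abel)
      (by rw [range_comp_perm, h0]; exact ⟨0, rfl⟩) hc
  have h1 := key 0 (zero_mem_fundChamber P B)
  rw [h0, Function.comp_apply, hχ', map_zero, zero_add] at h1
  have h2 := hA.inj J hJ h1
  rw [key c hc, Function.comp_apply, hχ', ← h2, add_zero]

/-- Some apartment contains a germ at y and a subchamber of the given direction. Inside that
apartment the chamber is translated to the base point y. -/
theorem exists_parallel (hS : Sundial P B 𝒢) (h4 : SubchambersJoin P B 𝒢)
    (hP : ∀ x y, ∃ f ∈ 𝒢, x ∈ Set.range f ∧ y ∈ Set.range f) (y : X) {D : V ⊗[F] Λ → X}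
    (hD : D ∈ 𝒢) {u : V ≃ₗ[F] V} (hu : u ∈ weyl P) :
    ∃ G ∈ 𝒢, G 0 = y ∧ Par P B G (D ∘ lin Λ u) 1 := by
  have hDu := hA.comp D hD _ (lin_mem P hu)
  obtain ⟨h, hh, h0, -⟩ := exists_chart_chamber hB hA hP y y
  obtain ⟨f, hf, hfh, b, hb⟩ := exists_germEq_subchamber hB hA hS h4 hh hDu
  obtain ⟨z, hz⟩ := hb 0 (zero_mem_fundChamber P B)
  obtain ⟨-, φ, hφ, Hφ⟩ := hA.compat _ hDu f hf _ z hz.symm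
  have hφφ : φ (φ⁻¹ 0) = 0 := φ.apply_symm_apply 0
  refine ⟨f ∘ (φ * Equiv.addRight (φ⁻¹ 0) : Equiv.Perm _),
    hA.comp f hf _ (mul_mem hφ (addRight_mem P _)), ?_, b - φ⁻¹ 0, b, fun c hc => ?_⟩
  · show f (φ (0 + φ⁻¹ 0)) = y
    rw [zero_add, hφφ, hfh.apply_zero, h0]
  · rw [act_one, Hφ _ (hb c hc)]
    show f (φ (b - φ⁻¹ 0 + c + φ⁻¹ 0)) = f (φ (b + c))
    congr 2
    abel

/-- Parallel chambers to adjacent chambers at infinity are adjacent or have the same germ. -/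
theorem adjacent_of_par (hS : Sundial P B 𝒢) {G G' D : V ⊗[F] Λ → X} (hG : G ∈ 𝒢)
    (hG' : G' ∈ 𝒢) (hD : D ∈ 𝒢) (j : B) (h0 : G 0 = G' 0) (h' : Par P B G' D 1)
    (h : Par P B G D (P.reflection j)) :
    GermEq P B G G' ∨ ∃ J ∈ 𝒢, (∀ x, 0 ≤ ev P j x → J x = G' x) ∧
      ∀ c ∈ fundChamber P B, G c = J (act Λ (P.reflection j) c) := by
  obtain ⟨e, t, h'⟩ := h'
  have hs := reflection_mem_weyl P (j : ι)
  have hD1 := hA.comp D hD _ (addRight_mem P (t - e))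
  have hDD : ∀ x, (D ∘ Equiv.addRight (t - e)) x = D (x + (t - e)) := fun x => rfl
  rcases exists_attach hB hA hS hG' hD1 j (a := e)
    (fun c hc => by
      rw [h' c hc, hDD, act_one]
      congr 1
      abel) with H | ⟨s, ⟨J, hJ, h1, h2⟩, J', hJ', h1', h2'⟩
  · right
    refine ⟨G', hG', fun _ _ => rfl, fun c hc => ?_⟩
    refine Par.eq hB hA hG hG' hs (par_of_par hB h (t := e) (t' := t) fun c hc => ?_) h0 hc
    rw [H c hc, hDD]
    congr 1
    abel
  -- If the cutting wall passes through the base point or behind it, J keeps the whole chamber of G'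
  -- and the two chambers are adjacent in J. If it lies strictly ahead, G runs along G' until that
  -- wall and branches off only there, so the germs coincide.
  · rcases le_or_gt (ev P j s) 0 with hle | hlt
    · right
      refine ⟨J, hJ, fun x hx => h1 x (hle.trans hx), fun c hc => ?_⟩
      refine Par.eq hB hA hG hJ hs (par_of_par hB h (t := s) (t' := s + (t - e)) fun c hc => ?_)
        ?_ hc
      · rw [h2 c hc, hDD]
        congr 1
        abel
      · rw [h0, h1 0 (by rwa [map_zero])]
    · left
      have hGJ : ∀ c ∈ fundChamber P B, G c = J' c := by
        intro c hc
        have := Par.eq hB hA hG hJ' (one_mem _)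
          (par_of_par hB h (t := s) (t' := s + (t - e)) fun c hc => by
            rw [act_one, h2' c hc, hDD]
            congr 1
            abel) (by rw [h0, h1' 0 (by rw [map_zero]; exact hlt.le)]) hc
        rwa [act_one] at this
      refine ⟨ev P j s, hlt, fun c hc hs => ?_⟩
      rw [hGJ c hc, h1' c (lt_of_abs_lt (hs j)).le]

theorem exists_pos (hS : Sundial P B 𝒢) (h4 : SubchambersJoin P B 𝒢) {E G : V ⊗[F] Λ → X}
    (hE : E ∈ 𝒢) (hG : G ∈ 𝒢) (h0 : E 0 = G 0) : ∃ δ, Pos P B 𝒢 E G δ := by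
  obtain ⟨f, hf, hfG, hfE⟩ := exists_germEq_chamber hB hA hS h4 hG hE h0.symm
  have hE0 : E 0 = f 0 := by rw [h0, hfG.apply_zero]
  obtain ⟨-, φ, hφ, Hφ⟩ := hA.compat E hE f hf 0 0 hE0
  have hφ0 : φ 0 = 0 := by
    have := Hφ 0 ⟨0, hE0.symm⟩
    rw [hE0] at this
    exact (hA.inj f hf this).symm
  obtain ⟨w, hw, hφw⟩ := affW_add hφ
  refine ⟨w⁻¹, inv_mem hw, f ∘ φ, hA.comp f hf φ hφ, fun c hc => (Hφ c (hfE c hc)).symm, ?_⟩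
  have : (f ∘ φ) ∘ lin Λ w⁻¹ = f := by
    funext x
    have := hφw 0 (act Λ w⁻¹ x)
    rw [zero_add, hφ0, zero_add, act_act_inv] at this
    exact congrArg f this
  rw [this]
  exact hfG

/-- Two charts extending the chamber of E agree wherever they meet, in particular on the germ of G.
So both positions induce the same map on a small piece of the chamber. -/
theorem Pos.unique {E G : V ⊗[F] Λ → X} {δ δ' : V ≃ₗ[F] V} (h : Pos P B 𝒢 E G δ)
    (h' : Pos P B 𝒢 E G δ') : δ = δ' := by
  obtain ⟨hδ, f, hf, hfE, hfG⟩ := h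
  obtain ⟨hδ', f', hf', hfE', hfG'⟩ := h'
  obtain ⟨ε, hε, H⟩ := hfG.trans hfG'.symm
  have key : lin Λ δ = lin Λ δ' := affW_ext hB (lin_mem P hδ) (lin_mem P hδ') (a := 0) hε
    fun c hc hs => by
      rw [zero_add]
      have h1 := H c hc hs
      simp only [Function.comp_apply] at h1
      have h2 := eq_of_mem_range_of_chamber hB hA hf hf' (a := 0)
        (fun c hc => by rw [zero_add, hfE c hc, hfE' c hc]) ⟨_, h1.symm⟩
      exact hA.inj f' hf' (h2.symm.trans h1)
  obtain ⟨a, ha⟩ := exists_posElt Λ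
  refine LinearEquiv.ext fun x => (fundWeight P hB).ext_elem fun k => ?_
  have h1 := congrArg (ev P k) (Equiv.congr_fun key (x ⊗ₜ[F] a))
  rw [lin_apply, lin_apply, act_tmul, act_tmul, ev_tmul, ev_tmul, ← sub_eq_zero, ← sub_smul,
    smul_eq_zero_iff_of_pos ha, sub_eq_zero] at h1
  rw [repr_fundWeight, repr_fundWeight]
  exact h1

/-- The two germs share a panel, so their positions differ at most by s_j. If δ' lies on the near
side of the panel, a germ there is determined by E and the panel, through convexity. Two distinct
germs of one apartment cannot both be that one, so the second lies beyond the panel. -/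
theorem Pos.adjacent {E J : V ⊗[F] Λ → X} (hJ : J ∈ 𝒢) {δ δ' : V ≃ₗ[F] V} (j : B)
    (h' : Pos P B 𝒢 E J δ') (h : Pos P B 𝒢 E (J ∘ lin Λ (P.reflection j)) δ) :
    (δ = δ' ∨ δ = δ' * P.reflection j) ∧
      (0 < P.coroot' j (δ'⁻¹ (rho P hB)) → δ = δ' * P.reflection j) := by
  obtain ⟨hδ, f, hf, hfE, ε₁, hε₁, H⟩ := h
  obtain ⟨hδ', f', hf', hfE', ε₂, hε₂, H'⟩ := h'
  have hff : ∀ x, f' x ∈ Set.range f → f' x = f x := fun x hx =>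
    eq_of_mem_range_of_chamber hB hA hf' hf (a := 0)
      (fun c hc => by rw [zero_add, hfE c hc, hfE' c hc]) hx
  have hpanel : ∀ p ∈ fundChamber P B, ev P j p = 0 → p ∈ small P ε₁ → p ∈ small P ε₂ →
      f' (act Λ δ' p) = f (act Λ δ p) := by
    intro p hp h0 h1 h2
    have e1 : f (act Λ δ p) = J (act Λ (P.reflection j) p) := H p hp h1
    have e2 : f' (act Λ δ' p) = J p := H' p hp h2
    rw [e1, e2, act_reflection_of_ev_eq_zero P h0]
  have hcase : δ = δ' ∨ δ = δ' * P.reflection j := by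
    have hfix : ∀ k, k ≠ j → (δ⁻¹ * δ') (fundWeight P hB k) = fundWeight P hB k := by
      intro k hk
      obtain ⟨a, ha, hs⟩ := exists_tmul_mem_small P (fundWeight P hB k) (lt_min hε₁ hε₂)
      have e1 := hpanel _ (fundWeight_tmul_mem hB ha.le k) (ev_fundWeight_ne hB hk a)
        (fun i => (hs i).trans_le (min_le_left _ _)) (fun i => (hs i).trans_le (min_le_right _ _))
      have e2 := hff _ ⟨_, e1.symm⟩
      have e3 := hA.inj f hf (e2.symm.trans e1)
      have e4 := congrArg (act Λ δ⁻¹) e3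
      rw [act_inv_act, ← act_mul, act_tmul] at e4
      refine (fundWeight P hB).ext_elem fun m => ?_
      have h3 := congrArg (ev P m) e4
      rw [ev_tmul, ev_tmul, ← sub_eq_zero, ← sub_smul, smul_eq_zero_iff_of_pos ha,
        sub_eq_zero] at h3
      rw [repr_fundWeight, repr_fundWeight]
      exact h3
    rcases eq_one_or_reflection hB (mul_mem (inv_mem hδ) hδ') j hfix with h | h
    · left
      exact inv_mul_eq_one.1 h
    · right
      rw [inv_mul_eq_iff_eq_mul] at h
      rw [h, mul_assoc, reflection_mul_self, mul_one]
  refine ⟨hcase, fun hpos => hcase.resolve_left ?_⟩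
  rintro rfl
  have hf0 : f' 0 = f 0 := by
    rw [hfE 0 (zero_mem_fundChamber P B), hfE' 0 (zero_mem_fundChamber P B)]
  obtain ⟨s, hs⟩ := (hA.compat f' hf' f hf 0 0 hf0).1.exists_finset
  classical
  obtain ⟨ε₃, hε₃, hmin⟩ := exists_pos_forall_le (s.filter fun p => p.2 < 0) (fun p => - p.2)
    (fun p hp => neg_pos.2 (Finset.mem_filter.1 hp).2)
  obtain ⟨a, ha, hsm⟩ := exists_tmul_mem_small P (fundWeight P hB j)
    (lt_min (lt_min hε₁ hε₂) hε₃)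
  set c := fundWeight P hB j ⊗ₜ[F] a with hc
  have hcC : c ∈ fundChamber P B := fundWeight_tmul_mem hB ha.le j
  obtain ⟨σ, hσ⟩ := exists_perm P δ hδ
  -- A half-space containing E and the small panel also contains c after applying δ: if its boundary
  -- misses the origin, smallness of c suffices. If the boundary passes through 0 and its root were
  -- negative on the germ, it would vanish on the panel, hence be parallel to the j-th wall, against
  -- `hpos`.
  have hmem : act Λ δ c ∈ f' ⁻¹' Set.range f := by
    rw [hs]
    intro p hp
    have hp0 : p.2 ≤ 0 := by
      have := (hs 0).1 ⟨0, hf0.symm⟩ p hp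
      rwa [map_zero] at this
    have hppos : 0 < P.coroot' p.1 (rho P hB) := coroot_rho_pos_of_bddBelow hB (x := 0)
      fun c hc => (hs (0 + c)).1 ⟨c, by rw [zero_add, hfE c hc, hfE' c hc]⟩ p hp
    rw [ev_act_perm P δ σ hσ]
    rcases lt_or_gt_of_ne (coroot_rho_ne hB (σ p.1)) with hneg | hneg
    · rcases lt_or_eq_of_le hp0 with hlt | heq
      · have h1 := (hsm (σ p.1)).trans_le (min_le_right _ _)
        have h2 := hmin p (Finset.mem_filter.2 ⟨hp, hlt⟩)
        exact (le_neg.1 h2).trans (neg_lt_of_abs_lt h1).le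
      · exfalso
        have hpar : ∀ k, k ≠ j → P.coroot' (σ p.1) (fundWeight P hB k) = 0 := by
          intro k hk
          obtain ⟨b, hb, hsb⟩ := exists_tmul_mem_small P (fundWeight P hB k) (lt_min hε₁ hε₂)
          have e1 := hpanel _ (fundWeight_tmul_mem hB hb.le k) (ev_fundWeight_ne hB hk b)
            (fun i => (hsb i).trans_le (min_le_left _ _))
            (fun i => (hsb i).trans_le (min_le_right _ _))
          have e2 := (hs _).1 ⟨_, e1.symm⟩ p hp
          rw [ev_act_perm P δ σ hσ, heq] at e2
          have e3 := ev_nonpos hB hneg (fundWeight_tmul_mem hB hb.le k)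
          have e4 := le_antisymm e3 e2
          rwa [ev_tmul, smul_eq_zero_iff_of_pos hb] at e4
        have e5 := coroot_eq_smul hB hpar
        have e6 : P.coroot' p.1 (rho P hB) = P.coroot' (σ p.1) (δ⁻¹ (rho P hB)) := by
          rw [← hσ]; exact congrArg _ (δ.apply_symm_apply _).symm
        rw [e6, e5, LinearMap.smul_apply, smul_eq_mul] at hppos
        exact absurd hppos (not_lt.2 (mul_nonpos_of_nonpos_of_nonneg
          (coroot_fundWeight_nonpos hB hneg j) hpos.le))
    · exact hp0.trans (ev_nonneg hB hneg hcC)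
  have e1 : f (act Λ δ c) = J (act Λ (P.reflection j) c) :=
    H c hcC fun i => (hsm i).trans_le ((min_le_left _ _).trans (min_le_left _ _))
  have e2 : f' (act Λ δ c) = J c :=
    H' c hcC fun i => (hsm i).trans_le ((min_le_left _ _).trans (min_le_right _ _))
  have e3 := hA.inj J hJ (e2.symm.trans ((hff _ hmem).trans e1))
  have e4 := congrArg (ev P j) e3
  rw [ev_act_reflection_self, hc, ev_fundWeight_self] at e4
  exact ha.ne' (self_eq_neg.1 e4)

end

/-! ### Covering an apartment by chambers with a given base point -/

section

variable {P : RootPairing ι F V N} [P.IsRootSystem] {B : Set ι} (hB : IsRootBasis P B)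
  {𝒢 : Set (V ⊗[F] Λ → X)} (hA : IsFullAtlas P 𝒢)

include hB in
theorem act_mem_of_length_eq_zero {v : V ≃ₗ[F] V} (hv : v ∈ weyl P) (hn : length hB v = 0)
    {c : V ⊗[F] Λ} (hc : c ∈ fundChamber P B) : act Λ v c ∈ fundChamber P B := by
  have hlen : sepWalls hB v = ∅ := (Set.ncard_eq_zero (sepWalls_finite hB v)).1 hn
  intro j hj
  refine ev_act_nonneg hB hv ?_ hc
  by_contra hcon
  have hmem : LinearMap.ker (P.coroot' j) ∈ sepWalls hB v :=
    ⟨j, by rw [coroot_rho_simple hB ⟨j, hj⟩]; exact one_pos,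
      lt_of_le_of_ne (not_lt.1 hcon) (coroot_act_rho_ne hB hv j), rfl⟩
  rw [hlen] at hmem
  exact hmem

include hB hA

/-- The position of a germ is at most as long as the position of its chamber at infinity, and in
case of equality the two chambers lie in a common apartment. -/
theorem length_le_of_par (hS : Sundial P B 𝒢) (h4 : SubchambersJoin P B 𝒢)
    (hP : ∀ x y, ∃ f ∈ 𝒢, x ∈ Set.range f ∧ y ∈ Set.range f) (n : ℕ) :
    ∀ v ∈ weyl P, length hB v = n → ∀ E ∈ 𝒢, ∀ G ∈ 𝒢, ∀ D ∈ 𝒢, E 0 = G 0 → Par P B E D 1 →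
      Par P B G D v → ∀ δ, Pos P B 𝒢 E G δ → length hB δ ≤ n ∧
        (length hB δ = n → ∃ f ∈ 𝒢, (∀ c ∈ fundChamber P B, f c = E c) ∧
          ∀ c ∈ fundChamber P B, f (act Λ v c) = G c) := by
  induction n with
  | zero =>
    intro v hv hn E hE G hG D hD h0 hED hGD δ hδ
    have hvC := fun c => act_mem_of_length_eq_zero hB hv hn (c := c) (Λ := Λ)
    have hGE : ∀ c ∈ fundChamber P B, G c = E (act Λ v c) := by
      obtain ⟨e, t, hED⟩ := hED
      refine fun c hc => Par.eq hB hA hG hE hv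
        (par_of_par hB hGD (t := e) (t' := t) fun c hc => ?_) h0.symm hc
      rw [hED _ (hvC c hc), act_one]
    have hpos : Pos P B 𝒢 E G v := by
      obtain ⟨a, ha⟩ := exists_posElt Λ
      exact ⟨hv, E, hE, fun _ _ => rfl, a, ha, fun c hc _ => (hGE c hc).symm⟩
    rw [Pos.unique hB hA hδ hpos, hn]
    exact ⟨le_rfl, fun _ => ⟨E, hE, fun _ _ => rfl, fun c hc => (hGE c hc).symm⟩⟩
  | succ n ih =>
    intro v hv hn E hE G hG D hD h0 hED hGD δ hδ
    obtain ⟨j, hj⟩ := exists_neg_of_length_pos hB hv (by omega)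
    have hs := reflection_mem_weyl P (j : ι)
    have hlen := length_mul_reflection_neg hB hv j hj
    have hsign : 0 < P.coroot' j ((v * P.reflection j)⁻¹ (rho P hB)) := by
      rw [coroot_mul_reflection_inv]; exact neg_pos.2 hj
    set v' := v * P.reflection j with hv'
    have hv'W : v' ∈ weyl P := mul_mem hv hs
    have hvv' : v = v' * P.reflection j := by rw [hv', mul_assoc, reflection_mul_self, mul_one]
    have hDv' := hA.comp D hD _ (lin_mem P hv'W)
    -- G' is the chamber at the same base point whose chamber at infinity is one step closer to that
    -- of E. By `adjacent_of_par`, G has the germ of G' or is adjacent to it, so the length grows by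
    -- at most one.
    obtain ⟨G', hG', hG'0, hG'D⟩ := exists_parallel hB hA hS h4 hP (G 0) hD hv'W
    have hG'D' : Par P B G' D v' := par_of_par hB hG'D (t := 0) (t' := 0) fun c hc => by
      rw [zero_add, zero_add, act_one]; rfl
    have hGD' : Par P B G (D ∘ lin Λ v') (P.reflection j) :=
      par_of_par hB hGD (t := 0) (t' := 0) fun c hc => by
        rw [zero_add, zero_add, hvv', act_mul]; rfl
    obtain ⟨δ', hδ'⟩ := exists_pos hB hA hS h4 hE hG' (by rw [h0, hG'0])
    obtain ⟨ih1, ih2⟩ := ih v' hv'W (by omega) E hE G' hG' D hD (by rw [h0, hG'0]) hED hG'D' δ' hδ'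
    have hsame : GermEq P B G G' → length hB δ ≤ n := fun hg => by
      rw [Pos.unique hB hA (hδ.congr hg) hδ']; exact ih1
    rcases adjacent_of_par hB hA hS hG hG' hDv' j hG'0.symm hG'D hGD' with hg | ⟨J, hJ, hJ1, hJ2⟩
    · have := hsame hg
      exact ⟨by omega, fun h => by omega⟩
    · obtain ⟨a, ha⟩ := exists_posElt Λ
      have hadj := (Pos.adjacent hB hA hJ j
        (hδ'.congr ⟨a, ha, fun c hc _ => (hJ1 c (hc j j.2)).symm⟩)
        (hδ.congr ⟨a, ha, fun c hc _ => hJ2 c hc⟩)).1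
      have hle : length hB δ ≤ length hB δ' + 1 := by
        rcases hadj with rfl | rfl
        · omega
        · exact length_mul_reflection_le hB hδ'.1 j
      -- Equality forces equality for G', so E and G' lie in the apartment of f'. There G must
      -- branch off across a panel, and the attached apartment keeps E because E lies on the near
      -- side of it.
      refine ⟨by omega, fun heq => ?_⟩
      obtain ⟨f', hf', hf'E, hf'G⟩ := ih2 (by omega)
      have hfv := hA.comp f' hf' _ (lin_mem P hv'W)
      rcases adjacent_of_par hB hA hS hG hfv hDv' j
        (by rw [← hG'0, ← hf'G 0 (zero_mem_fundChamber P B)]; rfl)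
        (hG'D.congr hB fun c hc => (hf'G c hc).symm) hGD' with hg | ⟨J', hJ', hJ1', hJ2'⟩
      · have := hsame (hg.trans ⟨a, ha, fun c hc _ => hf'G c hc⟩)
        omega
      · refine ⟨J' ∘ lin Λ v'⁻¹, hA.comp J' hJ' _ (lin_mem P (inv_mem hv'W)), fun c hc => ?_,
          fun c hc => ?_⟩
        · rw [Function.comp_apply, lin_apply,
            hJ1' _ (ev_act_nonneg hB (inv_mem hv'W) hsign hc), Function.comp_apply, lin_apply,
            act_act_inv, hf'E c hc]
        · rw [Function.comp_apply, lin_apply, hvv', act_mul, act_inv_act, hJ2' c hc]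

/-- Some chamber of a given apartment is opposite to a given chamber with the same base point. -/
theorem exists_opposite (hS : Sundial P B 𝒢) (h4 : SubchambersJoin P B 𝒢)
    {E G : V ⊗[F] Λ → X} (hE : E ∈ 𝒢) (hG : G ∈ 𝒢) (h0 : E 0 = G 0) :
    ∃ u ∈ weyl P, ∃ δ, Pos P B 𝒢 E (G ∘ lin Λ u) δ ∧
      ∀ j : B, P.coroot' j (δ⁻¹ (rho P hB)) < 0 := by
  have h0' : ∀ u : V ≃ₗ[F] V, E 0 = (G ∘ lin Λ u) 0 := fun u => by
    rw [Function.comp_apply, lin_apply, map_zero, h0]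
  -- Take a germ of the apartment of G at maximal distance from E. If it could be lengthened at j,
  -- the j-adjacent germ in the same apartment would be further away by `Pos.adjacent`.
  let S : Set ℕ := {n | ∃ u ∈ weyl P, ∃ δ, Pos P B 𝒢 E (G ∘ lin Λ u) δ ∧ length hB δ = n}
  have hne : S.Nonempty := by
    obtain ⟨δ, hδ⟩ := exists_pos hB hA hS h4 hE (hA.comp G hG _ (lin_mem P (one_mem _))) (h0' 1)
    exact ⟨_, 1, one_mem _, δ, hδ, rfl⟩
  have hbdd : BddAbove S := by
    refine ⟨(Set.range fun i => LinearMap.ker (P.coroot' i)).ncard, ?_⟩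
    rintro n ⟨u, -, δ, -, rfl⟩
    exact Set.ncard_le_ncard (fun _ ⟨i, _, _, h⟩ => ⟨i, h.symm⟩) (Set.finite_range _)
  obtain ⟨u, hu, δ, hδ, hmax⟩ := Nat.sSup_mem hne hbdd
  refine ⟨u, hu, δ, hδ, fun j => ?_⟩
  by_contra hcon
  have hpos := lt_of_le_of_ne (not_lt.1 hcon) (coroot_act_rho_ne hB (inv_mem hδ.1) j).symm
  have hus := mul_mem hu (reflection_mem_weyl P (j : ι))
  obtain ⟨δ', hδ'⟩ := exists_pos hB hA hS h4 hE (hA.comp G hG _ (lin_mem P hus)) (h0' _)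
  have h1 := (Pos.adjacent hB hA (hA.comp G hG _ (lin_mem P hu)) j hδ
    (by rw [comp_lin_lin]; exact hδ')).2 hpos
  have h2 := le_csSup hbdd (a := length hB δ') ⟨_, hus, δ', hδ', rfl⟩
  rw [← hmax, h1, length_mul_reflection hB hδ.1 j hpos] at h2
  omega

/-- Every apartment is covered by finitely many chambers with a given base point. -/
theorem exists_finite_cover (hS : Sundial P B 𝒢) (h4 : SubchambersJoin P B 𝒢)
    (hP : ∀ x y, ∃ f ∈ 𝒢, x ∈ Set.range f ∧ y ∈ Set.range f) {k : V ⊗[F] Λ → X} (hk : k ∈ 𝒢)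
    (z : X) : ∃ 𝒬 : Set (V ⊗[F] Λ → X), 𝒬.Finite ∧ (∀ g ∈ 𝒬, g ∈ 𝒢 ∧ g 0 = z) ∧
      ∀ p, ∃ g ∈ 𝒬, k p ∈ g '' fundChamber P B := by
  have := weyl_finite P hB
  have : Nonempty X := ⟨z⟩
  choose! H hH𝒢 hH0 hHk using fun (u : V ≃ₗ[F] V) (hu : u ∈ weyl P) =>
    exists_parallel hB hA hS h4 hP z hk hu
  refine ⟨Set.range fun u : weyl P => H u, Set.finite_range _, ?_, fun p => ?_⟩
  · rintro _ ⟨u, rfl⟩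
    exact ⟨hH𝒢 u u.2, hH0 u u.2⟩
  obtain ⟨E, hE, hE0, q, hq, hqz⟩ := exists_chart_chamber hB hA hP (k p) z
  set G := k ∘ Equiv.addRight p with hGdef
  have hG : G ∈ 𝒢 := hA.comp k hk _ (addRight_mem P p)
  have hG' : ∀ x, G x = k (x + p) := fun x => rfl
  have hEG : E 0 = G 0 := by rw [hE0, hG', zero_add]
  obtain ⟨u, hu, δ, hδ, hneg⟩ := exists_opposite hB hA hS h4 hE hG hEG
  have hGu := hA.comp G hG _ (lin_mem P hu)
  have hEGu : E 0 = (G ∘ lin Λ u) 0 := by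
    rw [Function.comp_apply, lin_apply, map_zero, hEG]
  -- the relative position at infinity
  obtain ⟨D₀, hD₀, a, b, ha, hb⟩ := h4 E hE _ hGu
  obtain ⟨y, hy⟩ := ha 0 (zero_mem_fundChamber P B)
  obtain ⟨-, χ, hχ, Hχ⟩ := hA.compat E hE D₀ hD₀ _ y hy.symm
  have hD := hA.comp D₀ hD₀ χ hχ
  obtain ⟨y', hy'⟩ := hb 0 (zero_mem_fundChamber P B)
  have hrD : Set.range (D₀ ∘ χ) = Set.range D₀ := range_comp_perm D₀ χ
  obtain ⟨y'', hy''⟩ : (G ∘ lin Λ u) (b + 0) ∈ Set.range (D₀ ∘ χ) := by rw [hrD]; exact ⟨y', hy'⟩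
  obtain ⟨-, ψ, hψ, Hψ⟩ := hA.compat _ hGu _ hD _ y'' hy''.symm
  obtain ⟨v, hv, hψv⟩ := affW_add hψ
  have hED : Par P B E (D₀ ∘ χ) 1 := ⟨a, a, fun c hc => by rw [act_one]; exact Hχ _ (ha c hc)⟩
  have hGD : Par P B (G ∘ lin Λ u) (D₀ ∘ χ) v :=
    ⟨b, ψ b, fun c hc => by rw [← hψv]; exact Hψ _ (by rw [hrD]; exact hb c hc)⟩
  obtain ⟨hle, hjoin⟩ :=
    length_le_of_par hB hA hS h4 hP _ v hv rfl E hE _ hGu _ hD hEGu hED hGD δ hδ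
  -- Since δ is longest, v cannot be longer than δ; together with `hle` this gives equality.
  obtain ⟨f, hf, hfE, hfG⟩ := hjoin (le_antisymm hle (length_le_of_forall_neg hB hδ.1 hneg v))
  have hvδ : v = δ := by
    refine Pos.unique hB hA (E := E) (G := G ∘ lin Λ u) ⟨hv, f, hf, hfE, ?_⟩ hδ
    obtain ⟨e, he⟩ := exists_posElt Λ
    exact ⟨e, he, fun c hc _ => hfG c hc⟩
  subst hvδ
  -- the chamber at `z` of the apartment of `f` that contains `k p`
  have hf' := hA.comp f hf _ (addRight_mem P q)
  have hpar : Par P B (H u) (f ∘ Equiv.addRight q) v := by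
    refine par_of_par hB (hHk u hu) (t := - q) (t' := act Λ u⁻¹ p) fun c hc => ?_
    rw [act_one]
    show f (-q + act Λ v c + q) = k (act Λ u (act Λ u⁻¹ p + c))
    rw [neg_add_cancel_comm, hfG c hc, map_add, act_act_inv, add_comm p]
    rfl
  have hfq : (f ∘ Equiv.addRight q) 0 = z := by
    show f (0 + q) = z
    rw [zero_add, hfE q hq, hqz]
  have heq : ∀ c ∈ fundChamber P B, H u c = f (act Λ v c + q) := fun c hc =>
    Par.eq hB hA (hH𝒢 u hu) hf' hv hpar (by rw [hH0 u hu, hfq]) hc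
  -- In the apartment of f, the point k p is the origin and z is q. The opposite chamber based at q
  -- contains the origin because q is dominant.
  have hmem : act Λ v⁻¹ (-q) ∈ fundChamber P B := by
    intro j hj
    rw [map_neg, map_neg]
    exact neg_nonneg.2 (ev_act_nonpos hB (inv_mem hv) (hneg ⟨j, hj⟩) hq)
  refine ⟨H u, ⟨⟨u, hu⟩, rfl⟩, _, hmem, ?_⟩
  rw [heq _ hmem, act_act_inv, neg_add_cancel, hfE 0 (zero_mem_fundChamber P B), hE0]

end

/-! ### Retractions centered at germs do not increase distances -/

theorem exists_between_of_lt (F : Subfield ℝ) [Module F Λ] [IsOrderedModule F Λ] {a b : Λ}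
    (h : a < b) : ∃ c, a < c ∧ c < b := by
  have h1 : (0 : F) < 2⁻¹ := by norm_num
  have h2 : (2⁻¹ : F) < 1 := by norm_num
  have hba := sub_pos.2 h
  refine ⟨a + (2⁻¹ : F) • (b - a), lt_add_of_pos_right _ (smul_pos_of_pos h1 hba), ?_⟩
  have := smul_lt_smul_of_lt h2 hba
  rw [one_smul] at this
  exact lt_sub_iff_add_lt'.1 this

/-- A function that is controlled on finitely many closed intervals covering `[s, a]` is controlled
on `[s, a]`. -/
theorem le_of_finite_cover (F : Subfield ℝ) [Module F Λ] [IsOrderedModule F Λ] {e : Λ → Λ → Λ}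
    {D : Λ → Λ} (he : ∀ r s t, e r t ≤ e r s + e s t) {a : Λ} (n : ℕ) :
    ∀ (I : Finset (Λ × Λ)) (s : Λ), I.card = n → s ≤ a →
      (∀ p ∈ I, ∀ r t, r ≤ t → p.1 ≤ r → t ≤ p.2 → e r t ≤ D t - D r) →
      (∀ t, s ≤ t → t ≤ a → ∃ p ∈ I, p.1 ≤ t ∧ t ≤ p.2) → e s a ≤ D a - D s := by
  classical
  induction n with
  | zero =>
    intro I s hI hs _ hcov
    obtain ⟨p, hp, -⟩ := hcov s le_rfl hs
    rw [Finset.card_eq_zero.1 hI] at hp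
    exact absurd hp (Finset.notMem_empty p)
  | succ n ih =>
    intro I s hI hs hctl hcov
    obtain ⟨p, hp, hp1, hp2⟩ := hcov s le_rfl hs
    rcases le_or_gt a p.2 with ha | ha
    · exact hctl p hp s a hs hp1 ha
    have hI' : (I.erase p).card = n := by rw [Finset.card_erase_of_mem hp, hI]; rfl
    have hcov1 : ∀ t, p.2 < t → t ≤ a → ∃ q ∈ I.erase p, q.1 ≤ t ∧ t ≤ q.2 := by
      intro t h1 h2
      obtain ⟨q, hq, hq1, hq2⟩ := hcov t (hp2.trans h1.le) h2
      refine ⟨q, Finset.mem_erase.2 ⟨?_, hq⟩, hq1, hq2⟩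
      rintro rfl
      exact absurd hq2 (not_le.2 h1)
    -- No completeness of `Λ` is available, only density. If the endpoint belonged to none of the
    -- remaining closed intervals, then neither would points slightly beyond it, although those must
    -- be covered.
    have hcov2 : ∃ q ∈ I.erase p, q.1 ≤ p.2 ∧ p.2 ≤ q.2 := by
      by_contra! hcon
      obtain ⟨ε, hε, hmin⟩ := exists_pos_forall_le ((I.erase p).filter fun q => p.2 < q.1)
        (fun q => q.1 - p.2) (fun q hq => sub_pos.2 (Finset.mem_filter.1 hq).2)
      obtain ⟨t, ht1, ht2⟩ := exists_between_of_lt F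
        (lt_min ha (lt_add_of_pos_right p.2 hε))
      obtain ⟨q, hq, hq1, hq2⟩ := hcov1 t ht1 (ht2.le.trans (min_le_left _ _))
      rcases le_or_gt q.1 p.2 with h | h
      · exact absurd (ht1.trans_le hq2) (hcon q hq h).not_gt
      · have h1 := hmin q (Finset.mem_filter.2 ⟨hq, h⟩)
        have h2 := ht2.trans_le (min_le_right _ _)
        rw [le_sub_iff_add_le'] at h1
        exact absurd hq1 (not_le.2 (h2.trans_le h1))
    have h1 := hctl p hp s p.2 hp2 hp1 le_rfl
    have h2 := ih (I.erase p) p.2 hI' ha.le (fun q hq => hctl q (Finset.mem_of_mem_erase hq))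
      (fun t ht1 ht2 => by
        rcases lt_or_eq_of_le ht1 with h | rfl
        · exact hcov1 t h ht2
        · exact hcov2)
    calc e s a ≤ e s p.2 + e p.2 a := he _ _ _
      _ ≤ (D p.2 - D s) + (D a - D p.2) := add_le_add h1 h2
      _ = D a - D s := by abel

/-- Finitely many linear inequalities cut a closed interval out of a closed interval. -/
theorem exists_interval (s : Finset (F × Λ)) (a : Λ) :
    ∃ lo hi : Λ, ∀ t, (0 ≤ t ∧ t ≤ a ∧ ∀ q ∈ s, q.2 ≤ q.1 • t) ↔ (lo ≤ t ∧ t ≤ hi) := by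
  classical
  induction s using Finset.induction_on with
  | empty => exact ⟨0, a, fun t => by simp⟩
  | insert q s _ ih =>
    obtain ⟨lo, hi, h⟩ := ih
    have key : ∀ t, (0 ≤ t ∧ t ≤ a ∧ ∀ q' ∈ insert q s, q'.2 ≤ q'.1 • t) ↔
        ((lo ≤ t ∧ t ≤ hi) ∧ q.2 ≤ q.1 • t) := by
      intro t
      rw [← h, Finset.forall_mem_insert]
      tauto
    rcases lt_trichotomy q.1 0 with hq | hq | hq
    · refine ⟨lo, min hi (q.1⁻¹ • q.2), fun t => ?_⟩
      have : q.2 ≤ q.1 • t ↔ t ≤ q.1⁻¹ • q.2 := by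
        have h1 := inv_smul_le_iff_of_pos (neg_pos.2 hq) (b₁ := q.2) (b₂ := -t)
        rw [smul_neg, neg_smul, neg_neg, inv_neg, neg_smul, neg_le_neg_iff] at h1
        exact h1.symm
      rw [key, this, le_min_iff, and_assoc]
    · rcases le_or_gt q.2 0 with h0 | h0
      · exact ⟨lo, hi, fun t => by rw [key, hq, zero_smul]; tauto⟩
      · refine ⟨q.2, 0, fun t => ?_⟩
        rw [key, hq, zero_smul]
        constructor
        · exact fun h => absurd h.2 (not_le.2 h0)
        · exact fun h => absurd (h.1.trans h.2) (not_le.2 h0)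
    · refine ⟨max lo (q.1⁻¹ • q.2), hi, fun t => ?_⟩
      rw [key, ← inv_smul_le_iff_of_pos hq, max_le_iff]
      tauto

/-- Working form of the axiom (FC): pieces of rays are covered by finitely many chambers with a
given base point. -/
def RaysCovered (P : RootPairing ι F V N) (B : Set ι) (𝒢 : Set (V ⊗[F] Λ → X)) : Prop :=
  ∀ k ∈ 𝒢, ∀ (z : X) (p : V ⊗[F] Λ) (v : V) (a : Λ), 0 ≤ a →
    ∃ 𝒬 : Set (V ⊗[F] Λ → X), 𝒬.Finite ∧ (∀ g ∈ 𝒬, g ∈ 𝒢 ∧ g 0 = z) ∧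
      ∀ t, 0 ≤ t → t ≤ a → ∃ g ∈ 𝒬, k (p + v ⊗ₜ[F] t) ∈ g '' fundChamber P B

section

variable {P : RootPairing ι F V N} [P.IsRootSystem] {B : Set ι} (hB : IsRootBasis P B)
  {𝒢 : Set (V ⊗[F] Λ → X)} (hA : IsFullAtlas P 𝒢)

theorem IsModelMetric.dist_ray {d : V ⊗[F] Λ → V ⊗[F] Λ → Λ} (hd : IsModelMetric P d)
    (p : V ⊗[F] Λ) (v : V) (s t : Λ) :
    d (p + v ⊗ₜ[F] s) (p + v ⊗ₜ[F] t) = d 0 (v ⊗ₜ[F] (t - s)) := by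
  have := hd.invariant _ (mem_affineWeyl_top (addRight_mem P (p + v ⊗ₜ[F] s)))
    0 (v ⊗ₜ[F] (t - s))
  rw [← this, TensorProduct.tmul_sub]
  simp only [Equiv.coe_addRight, zero_add]
  congr 1
  abel

include hA in
-- Chambers and intersections of apartments are cut out by finitely many half-spaces, which become
-- linear inequalities in t along a ray.
theorem exists_interval_chamber {k g : V ⊗[F] Λ → X} (hk : k ∈ 𝒢) (hg : g ∈ 𝒢)
    (p : V ⊗[F] Λ) (v : V) (a : Λ) :
    ∃ I : Λ × Λ, ∀ t, (0 ≤ t ∧ t ≤ a ∧ k (p + v ⊗ₜ[F] t) ∈ g '' fundChamber P B) ↔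
      (I.1 ≤ t ∧ t ≤ I.2) := by
  classical
  by_cases hne : ∃ t, k (p + v ⊗ₜ[F] t) ∈ g '' fundChamber P B
  swap
  · obtain ⟨e, he⟩ := exists_posElt Λ
    -- As e is positive, this is an empty interval.
    refine ⟨(e, 0), fun t => ⟨fun h => absurd ⟨t, h.2.2⟩ hne, fun h => ?_⟩⟩
    exact absurd (h.1.trans h.2) (not_le.2 he)
  obtain ⟨t₀, y, hy, hyt⟩ := hne
  obtain ⟨hconv, φ, hφ, Hφ⟩ := hA.compat k hk g hg _ y hyt.symm
  obtain ⟨s, hs⟩ := hconv.exists_finset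
  obtain ⟨σ, hσ⟩ := ev_affW hφ
  have hgi := hA.inj g hg
  have hmem : ∀ x, k x ∈ g '' fundChamber P B ↔
      (∀ q ∈ s, q.2 ≤ ev P q.1 x) ∧ ∀ i ∈ B, 0 ≤ ev P (σ i) x + ev P i (φ 0) := by
    intro x
    rw [← hs x]
    constructor
    · rintro ⟨c, hc, hcx⟩
      have hx : k x ∈ Set.range g := ⟨c, hcx⟩
      refine ⟨hx, fun i hi => ?_⟩
      rw [← hσ, ← hgi (hcx.trans (Hφ x hx))]
      exact hc i hi
    · rintro ⟨hx, h⟩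
      refine ⟨φ x, fun i hi => ?_, (Hφ x hx).symm⟩
      rw [hσ]
      exact h i hi
  obtain ⟨lo, hi, h⟩ := exists_interval
    ((s.image fun q => (P.coroot' q.1 v, q.2 - ev P q.1 p)) ∪
      ((Finset.univ.filter (· ∈ B)).image fun i =>
        (P.coroot' (σ i) v, - ev P i (φ 0) - ev P (σ i) p))) a
  refine ⟨(lo, hi), fun t => ?_⟩
  rw [← h t, hmem, Finset.forall_mem_union, Finset.forall_mem_image, Finset.forall_mem_image]
  simp only [map_add, ev_tmul, Finset.mem_filter, Finset.mem_univ, true_and, sub_le_iff_le_add',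
    neg_le_iff_add_nonneg']
  have hcomm : ∀ i, ev P i (φ 0) + (ev P (σ i) p + P.coroot' (σ i) v • t) =
      ev P (σ i) p + P.coroot' (σ i) v • t + ev P i (φ 0) := fun i => add_comm _ _
  simp only [hcomm]

include hB hA

/-- The coordinates of the points of `X` with respect to the apartments containing a germ. -/
theorem exists_coordinates (hJ : GermsJoin P B 𝒢) {h : V ⊗[F] Λ → X} (hh : h ∈ 𝒢) :
    ∃ ρ : X → V ⊗[F] Λ, ∀ g ∈ 𝒢, GermEq P B g h → ∀ a, ρ (g a) = a := by
  choose f hf hx hfh using fun x => hJ x h hh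
  choose ρ hρ using hx
  refine ⟨ρ, fun g hg hgh a => ?_⟩
  have h1 := GermEq.eq_of_mem_range hB hA hg (hf (g a)) (hgh.trans (hfh (g a)).symm)
    ⟨_, hρ (g a)⟩
  exact hA.inj _ (hf (g a)) ((hρ (g a)).trans h1)

variable {d : V ⊗[F] Λ → V ⊗[F] Λ → Λ} (hd : IsModelMetric P d) (hJ : GermsJoin P B 𝒢)
  {h : V ⊗[F] Λ → X} (hh : h ∈ 𝒢) {ρ : X → V ⊗[F] Λ}
  (hρ : ∀ g ∈ 𝒢, GermEq P B g h → ∀ a, ρ (g a) = a)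

include hd hJ hh hρ

/-- An apartment containing the germ and g (x + y) also contains g x and g y by
`IsClosedConvex.mem_of_add_mem`. There ρ is the inverse of its chart, and coordinate changes
preserve d. -/
theorem coordinates_isometry_on_chamber {g : V ⊗[F] Λ → X} (hg : g ∈ 𝒢) (h0 : g 0 = h 0)
    {x y : V ⊗[F] Λ} (hx : x ∈ fundChamber P B) (hy : y ∈ fundChamber P B) :
    d (ρ (g x)) (ρ (g y)) = d x y := by
  obtain ⟨f, hf, hxy, hfh⟩ := hJ (g (x + y)) h hh
  have hgf : g 0 = f 0 := h0.trans hfh.apply_zero.symm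
  obtain ⟨hconv, φ, hφ, Hφ⟩ := hA.compat g hg f hf 0 0 hgf
  have h1 := Hφ x (hconv.mem_of_add_mem hB ⟨0, hgf.symm⟩ hx hy hxy)
  have h2 := Hφ y (hconv.mem_of_add_mem hB ⟨0, hgf.symm⟩ hy hx
    (by rw [add_comm]; exact hxy))
  rw [h1, h2, hρ f hf hfh, hρ f hf hfh]
  exact hd.invariant φ (mem_affineWeyl_top hφ) x y

/-- The ray piece is cut into finitely many intervals, each inside a chamber based at the vertex of
the germ, where ρ is isometric. Additivity of d along the ray makes the lengths of the pieces add
up. -/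
theorem coordinates_le_of_ray (hR : RaysCovered P B 𝒢) {k : V ⊗[F] Λ → X} (hk : k ∈ 𝒢)
    (p : V ⊗[F] Λ) (v : V) {a : Λ} (ha : 0 ≤ a) :
    d (ρ (k p)) (ρ (k (p + v ⊗ₜ[F] a))) ≤ d 0 (v ⊗ₜ[F] a) := by
  classical
  obtain ⟨𝒬, hfin, h𝒬, hcov⟩ := hR k hk (h 0) p v a ha
  have hI : ∀ g ∈ 𝒬, ∃ I : Λ × Λ, ∀ t, (0 ≤ t ∧ t ≤ a ∧
      k (p + v ⊗ₜ[F] t) ∈ g '' fundChamber P B) ↔ (I.1 ≤ t ∧ t ≤ I.2) := fun g hg =>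
    exists_interval_chamber hA hk (h𝒬 g hg).1 p v a
  choose! I hI using hI
  have key := le_of_finite_cover F
    (e := fun s t => d (ρ (k (p + v ⊗ₜ[F] s))) (ρ (k (p + v ⊗ₜ[F] t))))
    (D := fun t => d 0 (v ⊗ₜ[F] t)) (fun r s t => hd.triangle _ _ _) (a := a) _
    (hfin.toFinset.image I) 0 rfl ha ?_ ?_
  · have h0 : d 0 (0 : V ⊗[F] Λ) = 0 := (hd.eq_zero_iff 0 0).2 rfl
    simp only [TensorProduct.tmul_zero, add_zero, h0, sub_zero] at key
    exact key
  · intro q hq r t hrt hr ht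
    obtain ⟨g, hg, rfl⟩ := Finset.mem_image.1 hq
    rw [Set.Finite.mem_toFinset] at hg
    obtain ⟨hr0, -, x, hx, hxr⟩ := (hI g hg r).2 ⟨hr, hrt.trans ht⟩
    obtain ⟨-, -, y, hy, hyt⟩ := (hI g hg t).2 ⟨hr.trans hrt, ht⟩
    have h1 : d x y = d (p + v ⊗ₜ[F] r) (p + v ⊗ₜ[F] t) := by
      obtain ⟨-, φ, hφ, Hφ⟩ := hA.compat k hk g (h𝒬 g hg).1 _ x hxr.symm
      have hgi := hA.inj g (h𝒬 g hg).1
      rw [hgi (hxr.trans (Hφ _ ⟨x, hxr⟩)), hgi (hyt.trans (Hφ _ ⟨y, hyt⟩))]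
      exact hd.invariant φ (mem_affineWeyl_top hφ) _ _
    have h2 := hd.ray v r (t - r) hr0 (sub_nonneg.2 hrt)
    rw [add_sub_cancel] at h2
    rw [← hxr, ← hyt, coordinates_isometry_on_chamber hB hA hd hJ hh hρ (h𝒬 g hg).1
      (h𝒬 g hg).2 hx hy, h1, hd.dist_ray, h2, add_sub_cancel_left]
  · intro t h1 h2
    obtain ⟨g, hg, hgt⟩ := hcov t h1 h2
    exact ⟨I g, Finset.mem_image_of_mem I (hfin.mem_toFinset.2 hg), (hI g hg t).1 ⟨h1, h2, hgt⟩⟩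

theorem coordinates_le (hR : RaysCovered P B 𝒢) {k : V ⊗[F] Λ → X} (hk : k ∈ 𝒢)
    (p q : V ⊗[F] Λ) : d (ρ (k p)) (ρ (k q)) ≤ d p q := by
  obtain ⟨l, hl, hsum, hdist⟩ := hd.geodesic p q
  have key : ∀ (l : List (V × Λ)) (p : V ⊗[F] Λ), (∀ x ∈ l, 0 ≤ x.2) →
      d (ρ (k p)) (ρ (k (p + (l.map fun x => x.1 ⊗ₜ[F] x.2).sum))) ≤
        (l.map fun x => d 0 (x.1 ⊗ₜ[F] x.2)).sum := by
    intro l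
    induction l with
    | nil =>
      intro p _
      simp only [List.map_nil, List.sum_nil, add_zero]
      exact ((hd.eq_zero_iff _ _).2 rfl).le
    | cons x l ih =>
      intro p hl
      simp only [List.map_cons, List.sum_cons]
      rw [← add_assoc]
      refine (hd.triangle _ _ (ρ (k (p + x.1 ⊗ₜ[F] x.2)))).trans (add_le_add ?_ ?_)
      · exact coordinates_le_of_ray hB hA hd hJ hh hρ hR hk p x.1 (hl x List.mem_cons_self)
      · exact ih _ fun y hy => hl y (List.mem_cons_of_mem x hy)
  have := key l p hl
  rwa [← hsum, add_sub_cancel, ← hdist] at this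

end

/-! ### Saturating an atlas under the full affine Weyl group -/

/-- The atlas of all charts that differ from a chart of `𝒜` by an affine Weyl group element. -/
def saturate (P : RootPairing ι F V N) (𝒜 : Set (V ⊗[F] Λ → X)) : Set (V ⊗[F] Λ → X) :=
  {f | ∃ g ∈ 𝒜, ∃ φ ∈ affW Λ P, f = g ∘ φ}

theorem subset_saturate (P : RootPairing ι F V N) {𝒜 : Set (V ⊗[F] Λ → X)} {f : V ⊗[F] Λ → X}
    (hf : f ∈ 𝒜) : f ∈ saturate P 𝒜 := ⟨f, hf, 1, one_mem _, rfl⟩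

theorem preimage_halfSpace {P : RootPairing ι F V N} {φ : Equiv.Perm (V ⊗[F] Λ)}
    (hφ : φ ∈ affW Λ P) : ∃ σ : Equiv.Perm ι, ∀ i l,
      φ ⁻¹' halfSpace P i l = halfSpace P (σ i) (l - ev P i (φ 0)) := by
  obtain ⟨σ, hσ⟩ := ev_affW hφ
  refine ⟨σ, fun i l => Set.ext fun x => ?_⟩
  show l ≤ ev P i (φ x) ↔ l - ev P i (φ 0) ≤ ev P (σ i) x
  rw [hσ, sub_le_iff_le_add]

theorem IsClosedConvex.preimage {P : RootPairing ι F V N} {Y : Set (V ⊗[F] Λ)}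
    (hY : IsClosedConvex P Y) {φ : Equiv.Perm (V ⊗[F] Λ)} (hφ : φ ∈ affW Λ P) :
    IsClosedConvex P (φ ⁻¹' Y) := by
  classical
  obtain ⟨s, rfl⟩ := hY
  obtain ⟨σ, hσ⟩ := preimage_halfSpace hφ
  refine ⟨s.image fun p => (σ p.1, p.2 - ev P p.1 (φ 0)), ?_⟩
  rw [Set.preimage_iInter₂, Finset.set_biInter_finset_image]
  simp only [hσ]

section

variable {P : RootPairing ι F V N} {B : Set ι} {T : AddSubgroup (V ⊗[F] Λ)}
  {𝒜 : Set (V ⊗[F] Λ → X)}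

theorem exists_range_eq {f : V ⊗[F] Λ → X} (hf : f ∈ saturate P 𝒜) :
    ∃ g ∈ 𝒜, Set.range f = Set.range g := by
  obtain ⟨g, hg, φ, -, rfl⟩ := hf
  exact ⟨g, hg, range_comp_perm g φ⟩

theorem isFullAtlas_saturate (hinj : ∀ f ∈ 𝒜, Function.Injective f) (h2 : A2 P T 𝒜) :
    IsFullAtlas P (saturate P 𝒜) where
  inj := by
    rintro _ ⟨g, hg, φ, -, rfl⟩
    exact (hinj g hg).comp φ.injective
  comp := by
    rintro _ ⟨g, hg, φ, hφ, rfl⟩ ψ hψ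
    exact ⟨g, hg, φ * ψ, mul_mem hφ hψ, rfl⟩
  compat := by
    rintro _ ⟨f, hf, φ, hφ, rfl⟩ _ ⟨g, hg, ψ, hψ, rfl⟩ x y hxy
    obtain ⟨hconv, w, hw, H⟩ := h2 f hf g hg ⟨f (φ x), ⟨_, rfl⟩, ⟨_, hxy.symm⟩⟩
    obtain ⟨χ, hχ, rfl⟩ := exists_affW_of_mem hw
    rw [range_comp_perm]
    refine ⟨hconv.preimage hφ, ψ⁻¹ * χ * φ, mul_mem (mul_mem (inv_mem hψ) hχ) hφ, fun a ha => ?_⟩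
    have : ψ (ψ⁻¹ (χ (φ a))) = χ (φ a) := ψ.apply_symm_apply _
    show f (φ a) = g (ψ (ψ⁻¹ (χ (φ a))))
    rw [this]
    exact H _ ha

/-! ### Translating the axioms into their working forms -/

theorem isChamberAt_iff {S : Set X} {x : X} :
    IsChamberAt P B 𝒜 S x ↔ ∃ h ∈ saturate P 𝒜, S = h '' fundChamber P B ∧ x = h 0 := by
  constructor
  · rintro ⟨f, hf, w, hw, a, rfl, rfl⟩
    refine ⟨f ∘ (Equiv.addRight a * lin Λ w : Equiv.Perm _),
      ⟨f, hf, _, mul_mem (addRight_mem P a) (lin_mem P hw), rfl⟩, rfl, ?_⟩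
    show f a = f (act Λ w 0 + a)
    rw [map_zero, zero_add]
  · rintro ⟨_, ⟨f, hf, φ, ⟨w, hw, a, hφ⟩, rfl⟩, rfl, rfl⟩
    refine ⟨f, hf, w, hw, a, Set.image_congr fun c _ => ?_, ?_⟩
    · show f (φ c) = _
      rw [hφ]
    · show f (φ 0) = f a
      rw [hφ, map_zero, zero_add]

theorem sundial_saturate (hfull : IsFullAtlas P (saturate P 𝒜)) (h : SC P B 𝒜) :
    Sundial P B (saturate P 𝒜) := by
  rintro K hK _ ⟨D, hD, ψ, ⟨w, hw, a, hψ⟩, rfl⟩ j hj hcap i k hwall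
  obtain ⟨K₀, hK₀, φ, hφ, rfl⟩ := id hK
  obtain ⟨σ, hσ⟩ := ev_affW hφ
  have hDψ : ∀ Y, (D ∘ ψ) '' Y = (fun c => D (act Λ w c + a)) '' Y := fun Y =>
    Set.image_congr fun c _ => by rw [Function.comp_apply, hψ]
  have hr : Set.range (K₀ ∘ φ) = Set.range K₀ := range_comp_perm K₀ φ
  set i' := σ.symm i with hi'
  have hhyp : (K₀ ∘ φ) '' hyperplane P i k = K₀ '' hyperplane P i' (k + ev P i' (φ 0)) := by
    rw [Set.image_comp]
    congr 1
    ext x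
    constructor
    · rintro ⟨y, hy, rfl⟩
      show ev P i' (φ y) = _
      rw [hσ, hi', Equiv.apply_symm_apply, show ev P i y = k from hy]
    · intro hx
      refine ⟨φ⁻¹ x, ?_, φ.apply_symm_apply x⟩
      have h1 := hσ i' (φ⁻¹ x)
      rw [show φ (φ⁻¹ x) = x from φ.apply_symm_apply x, hi', Equiv.apply_symm_apply,
        show ev P i' x = _ from hx] at h1
      exact (add_right_cancel h1).symm
  obtain ⟨f₂, hf₂, f₃, hf₃, hne, hH₂, hH₃, hs₂, hs₃⟩ := h K₀ hK₀ ((D ∘ ψ) '' fundChamber P B)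
    ⟨D, hD, w, hw, a, j, hj, hDψ _, by rw [← hr, hcap, hDψ]⟩ i' (k + ev P i' (φ 0))
    (by rw [← hr, ← hhyp]; exact hwall)
  have hD0 : (D ∘ ψ) 0 ∈ (D ∘ ψ) '' fundChamber P B := ⟨0, zero_mem_fundChamber P B, rfl⟩
  have hD0K : (D ∘ ψ) 0 ∈ Set.range K₀ := by
    have : (D ∘ ψ) 0 ∈ (D ∘ ψ) '' fundPanel P B j :=
      ⟨0, ⟨zero_mem_fundChamber P B, map_zero _⟩, rfl⟩
    rw [← hcap, hr] at this
    exact this.2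
  -- The half-apartment is given in some chart g. The coordinate change to K₀ ∘ φ exists because
  -- both contain the base point of the sundial chamber, and it carries half-spaces to half-spaces.
  have key : ∀ f : V ⊗[F] Λ → X, IsHalfApartment P 𝒜 (Set.range K₀ ∩ Set.range f) →
      (D ∘ ψ) 0 ∈ Set.range f → ∃ i l, (K₀ ∘ φ) ⁻¹' Set.range f = halfSpace P i l := by
    rintro f ⟨g, hg, i, l, hgH⟩ hDf
    have hyz : (D ∘ ψ) 0 ∈ g '' halfSpace P i l := by rw [← hgH]; exact ⟨hD0K, hDf⟩
    obtain ⟨y, hy, hyz⟩ := hyz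
    obtain ⟨z, hz⟩ : g y ∈ Set.range (K₀ ∘ φ) := by rw [hyz, hr]; exact hD0K
    obtain ⟨-, χ, hχ, Hχ⟩ := hfull.compat g (subset_saturate P hg) _ hK y z hz.symm
    obtain ⟨τ, hτ⟩ := preimage_halfSpace (inv_mem hχ)
    refine ⟨_, _, (Set.ext fun x => ?_ : _ = ⇑χ⁻¹ ⁻¹' halfSpace P i l).trans (hτ i l)⟩
    have hχi : χ (χ⁻¹ x) = x := χ.apply_symm_apply x
    have hgr : ∀ u ∈ halfSpace P i l, g u ∈ Set.range (K₀ ∘ φ) := by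
      intro u hu
      have : g u ∈ Set.range K₀ ∩ Set.range f := by rw [hgH]; exact ⟨u, hu, rfl⟩
      rw [hr]
      exact this.1
    constructor
    · intro hx
      have : (K₀ ∘ φ) x ∈ g '' halfSpace P i l := by rw [← hgH]; exact ⟨⟨_, rfl⟩, hx⟩
      obtain ⟨u, hu, hux⟩ := this
      have h1 := hfull.inj _ hK ((Hχ u (hgr u hu)).symm.trans hux)
      rw [← h1]
      show χ⁻¹ (χ u) ∈ halfSpace P i l
      rw [show χ⁻¹ (χ u) = u from χ.symm_apply_apply u]
      exact hu
    · intro hx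
      have h1 := Hχ _ (hgr _ hx)
      rw [hχi] at h1
      have : g (χ⁻¹ x) ∈ Set.range K₀ ∩ Set.range f := by rw [hgH]; exact ⟨_, hx, rfl⟩
      rw [h1] at this
      exact this.2
  refine ⟨f₂, subset_saturate P hf₂, f₃, subset_saturate P hf₃, hne,
    key f₂ hH₂ (hs₂ (Or.inr hD0)), key f₃ hH₃ (hs₃ (Or.inr hD0)), ?_, ?_⟩
  · rw [hhyp]; exact hs₂
  · rw [hhyp]; exact hs₃

theorem subchambersJoin_saturate [P.IsRootSystem] (hB : IsRootBasis P B)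
    (hfull : IsFullAtlas P (saturate P 𝒜)) (h : A4 P B 𝒜) :
    SubchambersJoin P B (saturate P 𝒜) := by
  intro g hg k hk
  obtain ⟨C, y, C', y', hC, hC', hCg, hCk, f, hf, hCf, hCf'⟩ :=
    h _ _ _ _ (isChamberAt_iff.2 ⟨g, hg, rfl, rfl⟩) (isChamberAt_iff.2 ⟨k, hk, rfl, rfl⟩)
  have key : ∀ g ∈ saturate P 𝒜, ∀ C y, IsChamberAt P B 𝒜 C y → C ⊆ g '' fundChamber P B →
      C ⊆ Set.range f → ∃ a, ∀ c ∈ fundChamber P B, g (a + c) ∈ Set.range f := by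
    intro g hg C y hC hCg hCf
    obtain ⟨p, hp, rfl, rfl⟩ := isChamberAt_iff.1 hC
    have hpg : ∀ c ∈ fundChamber P B, ∃ c' ∈ fundChamber P B, g c' = p c := fun c hc =>
      hCg ⟨c, hc, rfl⟩
    obtain ⟨z, -, hz⟩ := hpg 0 (zero_mem_fundChamber P B)
    obtain ⟨-, φ, hφ, Hφ⟩ := hfull.compat p hp g hg 0 z hz.symm
    obtain ⟨u, hu, hφu⟩ := affW_add hφ
    obtain ⟨σ, hσ⟩ := exists_perm P u hu
    have hφC : ∀ c ∈ fundChamber P B, φ 0 + act Λ u c ∈ fundChamber P B := by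
      intro c hc
      obtain ⟨c', hc', hcc'⟩ := hpg c hc
      have h1 := hfull.inj g hg (hcc'.trans (Hφ c ⟨c', hcc'⟩))
      rw [← hφu, zero_add, ← h1]
      exact hc'
    -- A chamber contained in another chamber is parallel to it: the roots j ∘ u are bounded below
    -- on C, hence positive, and u preserves C.
    have hu0 : length hB u⁻¹ = 0 := by
      by_contra hne
      obtain ⟨j, hj⟩ := exists_neg_of_length_pos hB (inv_mem hu) hne
      rw [inv_inv, hσ] at hj
      refine absurd hj (not_lt.2 (coroot_rho_pos_of_bddBelow hB (x := 0) (l := - ev P j (φ 0))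
        fun c hc => ?_).le)
      have := hφC c hc j j.2
      rw [map_add, ev_act_perm P u σ hσ] at this
      rw [zero_add]
      exact neg_le_iff_add_nonneg'.2 this
    refine ⟨φ 0, fun c hc => ?_⟩
    have hc' := act_mem_of_length_eq_zero hB (inv_mem hu) hu0 hc
    obtain ⟨c₁, -, hcc₁⟩ := hpg _ hc'
    have h1 := Hφ _ ⟨c₁, hcc₁⟩
    rw [← zero_add (act Λ u⁻¹ c), hφu, act_act_inv, zero_add] at h1
    rw [← h1]
    exact hCf ⟨_, hc', rfl⟩
  obtain ⟨a, ha⟩ := key g hg C y hC hCg hCf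
  obtain ⟨b, hb⟩ := key k hk C' y' hC' hCk hCf'
  exact ⟨f, subset_saturate P hf, a, b, ha, hb⟩

theorem exists_germEq_of_germ_subset (hfull : IsFullAtlas P (saturate P 𝒜))
    {g h : V ⊗[F] Λ → X} (hg : g ∈ saturate P 𝒜) (hh : h ∈ saturate P 𝒜)
    (H : ∃ ε : Λ, 0 < ε ∧ ∀ c ∈ fundChamber P B, c ∈ small P ε → h c ∈ Set.range g) :
    ∃ φ ∈ affW Λ P, GermEq P B (g ∘ φ) h := by
  obtain ⟨ε, hε, H⟩ := H
  obtain ⟨y, hy⟩ := H 0 (zero_mem_fundChamber P B) (zero_mem_small P hε)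
  obtain ⟨-, φ, hφ, Hφ⟩ := hfull.compat h hh g hg 0 y hy.symm
  exact ⟨φ, hφ, ε, hε, fun c hc hs => (Hφ c (H c hc hs)).symm⟩

theorem points_join (hfull : IsFullAtlas P (saturate P 𝒜))
    (hJ : GermsJoin P B (saturate P 𝒜)) (hne : (saturate P 𝒜).Nonempty) (x y : X) :
    ∃ f ∈ saturate P 𝒜, x ∈ Set.range f ∧ y ∈ Set.range f := by
  obtain ⟨h, hh⟩ := hne
  obtain ⟨f, hf, ⟨a, rfl⟩, -⟩ := hJ x h hh
  obtain ⟨g, hg, hy, hgf⟩ := hJ y _ (hfull.comp f hf _ (addRight_mem P a))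
  refine ⟨g, hg, ⟨0, ?_⟩, hy⟩
  rw [hgf.apply_zero]
  show f (0 + a) = f a
  rw [zero_add]

/-! ### Distances, germs, and the axioms (ALA) and (FC) -/

variable {d : V ⊗[F] Λ → V ⊗[F] Λ → Λ} (hd : IsModelMetric P d)

theorem idist_saturate (hd : IsModelMetric P d) (hinj : ∀ f ∈ 𝒜, Function.Injective f)
    (h2 : A2 P T 𝒜) {f : V ⊗[F] Λ → X} (hf : f ∈ saturate P 𝒜) (a b : V ⊗[F] Λ) :
    idist d 𝒜 (f a) (f b) = d a b := by
  obtain ⟨g, hg, φ, hφ, rfl⟩ := hf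
  rw [Function.comp_apply, Function.comp_apply, idist_apply P T d hd 𝒜 hinj h2 g hg]
  exact hd.invariant φ (mem_affineWeyl_top hφ) a b

theorem exists_ball_subset_small (hd : IsModelMetric P d) {ε : Λ} (hε : 0 < ε) :
    ∃ δ : Λ, 0 < δ ∧ ∀ c, d 0 c < δ → c ∈ small P ε := by
  obtain ⟨δ, hδ, H⟩ := hd.finer ε hε
  refine ⟨δ, hδ, fun c hc i => ?_⟩
  refine lt_of_le_of_lt ?_ (H 0 c hc)
  have := Finset.single_le_sum (f := fun i => |ev P i (0 - c)|) (fun _ _ => abs_nonneg _)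
    (Finset.mem_univ i)
  rw [show |ev P i c| = |ev P i (0 - c)| by rw [zero_sub, map_neg, abs_neg]]
  exact this

theorem exists_small_subset_ball (hd : IsModelMetric P d) {ε : Λ} (hε : 0 < ε) :
    ∃ δ : Λ, 0 < δ ∧ ∀ c ∈ small P δ, d 0 c < ε := by
  obtain ⟨δ, hδ, H⟩ := hd.coarser ε hε
  have hM : (0 : F) < Fintype.card ι + 1 := by positivity
  -- The summand 1 keeps the total strictly below δ and the scalar defined even without roots.
  refine ⟨((Fintype.card ι : F) + 1)⁻¹ • δ, smul_pos_of_pos (inv_pos.2 hM) hδ, fun c hc => H _ _ ?_⟩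
  calc minkowski P 0 c ≤ ∑ _i : ι, ((Fintype.card ι : F) + 1)⁻¹ • δ :=
        Finset.sum_le_sum fun i _ => by
          rw [zero_sub, map_neg, abs_neg]; exact (hc i).le
    _ = ((Fintype.card ι : F) * ((Fintype.card ι : F) + 1)⁻¹) • δ := by
        rw [Finset.sum_const, Finset.card_univ, mul_smul, Nat.cast_smul_eq_nsmul]
    _ < (1 : F) • δ := smul_lt_smul_of_lt (by
        rw [← div_eq_mul_inv, div_lt_one hM]; exact lt_add_one _) hδ
    _ = δ := one_smul F δ

/-- All representatives of a germ agree with the given chamber near the base point, and by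
topological equivalence metric balls may be replaced by bounds on the co-roots. -/
theorem germIn_iff (hd : IsModelMetric P d) (hinj : ∀ f ∈ 𝒜, Function.Injective f)
    (h2 : A2 P T 𝒜) {h : V ⊗[F] Λ → X} (hh : h ∈ saturate P 𝒜) (Y : Set X) :
    GermIn d 𝒜 (germ P B d 𝒜 (h '' fundChamber P B) (h 0)) (h 0) Y ↔
      ∃ ε : Λ, 0 < ε ∧ ∀ c ∈ fundChamber P B, c ∈ small P ε → h c ∈ Y := by
  have hdist := idist_saturate hd hinj h2 hh
  constructor
  · rintro ⟨S, ⟨-, ε₁, hε₁, hS, -⟩, ε₂, hε₂, hY⟩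
    obtain ⟨δ, hδ, hδs⟩ := exists_small_subset_ball hd (lt_min hε₁ hε₂)
    refine ⟨δ, hδ, fun c hc hs => ?_⟩
    have hlt := hδs c hs
    rw [← hdist] at hlt
    exact hY ⟨(hS ⟨⟨c, hc, rfl⟩, hlt.trans_le (min_le_left _ _)⟩).2,
      hlt.trans_le (min_le_right _ _)⟩
  · rintro ⟨ε, hε, H⟩
    obtain ⟨δ, hδ, hδs⟩ := exists_ball_subset_small hd hε
    refine ⟨h '' fundChamber P B, ⟨isChamberAt_iff.2 ⟨h, hh, rfl, rfl⟩, δ, hδ,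
      fun _ hz => ⟨hz.1, hz.1⟩, fun _ hz => ⟨hz.1, hz.1⟩⟩, δ, hδ, ?_⟩
    rintro _ ⟨⟨c, hc, rfl⟩, hlt⟩
    refine H c hc (hδs c ?_)
    rw [← hdist]
    exact hlt

theorem germsJoin_of_ALA (hd : IsModelMetric P d) (hinj : ∀ f ∈ 𝒜, Function.Injective f)
    (h2 : A2 P T 𝒜) (h : ALA P B d 𝒜) : GermsJoin P B (saturate P 𝒜) := by
  intro x k hk
  have hfull := isFullAtlas_saturate hinj h2
  obtain ⟨f, hf, hx, hin⟩ := h x (k 0) (germ P B d 𝒜 (k '' fundChamber P B) (k 0))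
    ⟨_, isChamberAt_iff.2 ⟨k, hk, rfl, rfl⟩, rfl⟩
  rw [germIn_iff hd hinj h2 hk] at hin
  obtain ⟨φ, hφ, hg⟩ := exists_germEq_of_germ_subset hfull (subset_saturate P hf) hk hin
  exact ⟨f ∘ φ, hfull.comp f (subset_saturate P hf) φ hφ, by rwa [range_comp_perm], hg⟩

/-- Additivity of d along rays places every intermediate point of a ray piece in the metric segment
of its endpoints. -/
theorem raysCovered_of_FC [P.IsRootSystem] (hd : IsModelMetric P d) (hinj : ∀ f ∈ 𝒜, Function.Injective f)
    (h2 : A2 P T 𝒜) (h : FC P B d 𝒜) : RaysCovered P B (saturate P 𝒜) := by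
  intro k hk z p v a ha
  obtain ⟨k₀, hk₀, hr⟩ := exists_range_eq hk
  obtain ⟨𝒞, hfin, h𝒞, hcov⟩ := h (k p) (k (p + v ⊗ₜ[F] a)) z (Set.range k) ⟨k₀, hk₀, hr⟩
    ⟨_, rfl⟩ ⟨_, rfl⟩
  have hne : Nonempty X := ⟨z⟩
  choose! g hg hgS hgz using fun S hS => isChamberAt_iff.1 (h𝒞 S hS)
  refine ⟨g '' 𝒞, hfin.image g, ?_, fun t ht hta => ?_⟩
  · rintro _ ⟨S, hS, rfl⟩
    exact ⟨hg S hS, (hgz S hS).symm⟩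
  · have hdist := idist_saturate hd hinj h2 hk
    obtain ⟨S, hS, hmem⟩ := hcov (a := k (p + v ⊗ₜ[F] t)) ⟨⟨_, rfl⟩, by
      have h1 := hd.dist_ray p v 0 a
      have h2 := hd.dist_ray p v 0 t
      rw [TensorProduct.tmul_zero, add_zero, sub_zero] at h1 h2
      have h3 := hd.ray v t (a - t) ht (sub_nonneg.2 hta)
      rw [add_sub_cancel] at h3
      rw [hdist, hdist, hdist, h1, h2, hd.dist_ray, h3]⟩
    exact ⟨g S, ⟨S, hS, rfl⟩, by rw [← hgS S hS]; exact hmem⟩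

end

/-! ### The main theorem -/

section

variable {P : RootPairing ι F V N} [P.IsRootSystem] {B : Set ι} (hB : IsRootBasis P B)
  {T : AddSubgroup (V ⊗[F] Λ)} {d : V ⊗[F] Λ → V ⊗[F] Λ → Λ} (hd : IsModelMetric P d)
  {𝒜 : Set (V ⊗[F] Λ → X)} (hinj : ∀ f ∈ 𝒜, Function.Injective f) (h2 : A2 P T 𝒜)
  (hJ : GermsJoin P B (saturate P 𝒜))

theorem IsGermRetraction.unique (h2 : A2 P T 𝒜) {f : V ⊗[F] Λ → X} (hf : f ∈ 𝒜)
    {μ : Set (Set X)} {x : X} {r r' : X → X}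
    (hx : ∀ g ∈ 𝒜, GermIn d 𝒜 μ x (Set.range g) → (Set.range g ∩ Set.range f).Nonempty)
    (h : IsGermRetraction P T d 𝒜 (Set.range f) μ x r)
    (h' : IsGermRetraction P T d 𝒜 (Set.range f) μ x r') : r = r' := by
  funext y
  obtain ⟨g, hg, ⟨a, rfl⟩, hμ⟩ := h.1 y
  obtain ⟨-, w, hw, H⟩ := h2 g hg f hf (hx g hg hμ)
  rw [h.2 f hf rfl g hg hμ w hw H, h'.2 f hf rfl g hg hμ w hw H]

include hB hd hinj h2 hJ

theorem nonIncreasing_comp (hR : RaysCovered P B (saturate P 𝒜)) {f h : V ⊗[F] Λ → X}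
    (hf : f ∈ saturate P 𝒜) (hh : h ∈ saturate P 𝒜) {ρ : X → V ⊗[F] Λ}
    (hρ : ∀ g ∈ saturate P 𝒜, GermEq P B g h → ∀ a, ρ (g a) = a) :
    NonIncreasing d 𝒜 (f ∘ ρ) := by
  intro y z
  have hfull := isFullAtlas_saturate hinj h2
  obtain ⟨k, hk, ⟨p, rfl⟩, q, rfl⟩ := points_join hfull hJ ⟨h, hh⟩ y z
  rw [Function.comp_apply, Function.comp_apply, idist_saturate hd hinj h2 hf,
    idist_saturate hd hinj h2 hk]
  exact coordinates_le hB hfull hd hJ hh hρ hR hk p q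

theorem isGermRetraction_comp {f h : V ⊗[F] Λ → X} (hf : f ∈ saturate P 𝒜)
    (hh : h ∈ saturate P 𝒜) (hfh : GermEq P B f h) {ρ : X → V ⊗[F] Λ}
    (hρ : ∀ g ∈ saturate P 𝒜, GermEq P B g h → ∀ a, ρ (g a) = a) :
    IsGermRetraction P T d 𝒜 (Set.range f)
      (germ P B d 𝒜 (h '' fundChamber P B) (h 0)) (h 0) (f ∘ ρ) := by
  have hfull := isFullAtlas_saturate hinj h2
  refine ⟨fun y => ?_, fun f₁ hf₁ hr g hg hμ w hw H a => ?_⟩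
  · obtain ⟨k, hk, hy, ε, hε, hkh⟩ := hJ y h hh
    obtain ⟨g, hg, hrg⟩ := exists_range_eq hk
    refine ⟨g, hg, hrg ▸ hy, (germIn_iff hd hinj h2 hh _).2 ⟨ε, hε, fun c hc hs => ?_⟩⟩
    rw [← hkh c hc hs, ← hrg]
    exact ⟨c, rfl⟩
  · rw [germIn_iff hd hinj h2 hh] at hμ
    have hg' := subset_saturate P hg
    have hf₁' := subset_saturate P hf₁
    obtain ⟨χ, hχ, hgh⟩ := exists_germEq_of_germ_subset hfull hg' hh hμ
    obtain ⟨ε, hε, hfh'⟩ := hfh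
    obtain ⟨φ, hφ, hf₁h⟩ := exists_germEq_of_germ_subset hfull hf₁' hh
      ⟨ε, hε, fun c hc hs => by rw [hr, ← hfh' c hc hs]; exact ⟨c, rfl⟩⟩
    obtain ⟨ψ, hψ, rfl⟩ := exists_affW_of_mem hw
    have hff₁ : ∀ x, f x = f₁ (φ x) := fun x =>
      GermEq.eq_of_mem_range hB hfull hf (hfull.comp f₁ hf₁' φ hφ)
        (GermEq.trans ⟨ε, hε, hfh'⟩ hf₁h.symm) (by rw [range_comp_perm, hr]; exact ⟨x, rfl⟩)
    -- Both sides translate coordinates adapted to the germ into those of f₁, and they agree on the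
    -- germ itself; thus the value prescribed by w is the one computed from ρ.
    have hψχ : ψ * χ = φ := by
      obtain ⟨e, he, h3⟩ := hgh.trans hf₁h.symm
      refine affW_ext hB (mul_mem hψ hχ) hφ (a := 0) he fun c hc hs => ?_
      rw [zero_add]
      have h4 : g (χ c) = f₁ (φ c) := h3 c hc hs
      exact hinj f₁ hf₁ ((H (χ c) ⟨_, h4.symm⟩).symm.trans h4)
    have hχχ : χ (χ⁻¹ a) = a := χ.apply_symm_apply a
    have h5 := hρ _ (hfull.comp g hg' χ hχ) hgh (χ⁻¹ a)
    rw [Function.comp_apply, hχχ] at h5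
    rw [Function.comp_apply, h5, hff₁, ← hψχ, Equiv.Perm.mul_apply, hχχ]

theorem retractions_of_germsJoin (hR : RaysCovered P B (saturate P 𝒜)) :
    (∀ (A : Set X) (x : X) (μ : Set (Set X)), IsApartment 𝒜 A → IsChamberGerm P B d 𝒜 μ x →
      GermIn d 𝒜 μ x A → (∃! r : X → X, IsGermRetraction P T d 𝒜 A μ x r) ∧
        ∀ r : X → X, IsGermRetraction P T d 𝒜 A μ x r → NonIncreasing d 𝒜 r) ∧ A5 d 𝒜 := by
  have hfull := isFullAtlas_saturate hinj h2
  constructor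
  · rintro _ x _ ⟨f, hf, rfl⟩ ⟨_, hS, rfl⟩ hin
    obtain ⟨h, hh, rfl, rfl⟩ := isChamberAt_iff.1 hS
    have hin' := (germIn_iff hd hinj h2 hh _).1 hin
    have hf' := subset_saturate P hf
    obtain ⟨φ, hφ, hfh⟩ := exists_germEq_of_germ_subset hfull hf' hh hin'
    obtain ⟨ρ, hρ⟩ := exists_coordinates hB hfull hJ hh
    have hfφ := hfull.comp f hf' φ hφ
    have hret := isGermRetraction_comp hB hd hinj h2 hJ hfφ hh hfh hρ
    rw [range_comp_perm] at hret
    have huniq : ∀ r, IsGermRetraction P T d 𝒜 (Set.range f) _ (h 0) r → r = (f ∘ φ) ∘ ρ :=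
      fun r hr => by
        refine IsGermRetraction.unique h2 hf (fun g hg hμ => ?_) hr hret
        rw [germIn_iff hd hinj h2 hh] at hμ
        obtain ⟨ε, hε, hμ⟩ := hμ
        obtain ⟨ε', hε', hin'⟩ := hin'
        exact ⟨h 0, hμ 0 (zero_mem_fundChamber P B) (zero_mem_small P hε),
          hin' 0 (zero_mem_fundChamber P B) (zero_mem_small P hε')⟩
    refine ⟨⟨_, hret, huniq⟩, fun r hr => ?_⟩
    rw [huniq r hr]
    exact nonIncreasing_comp hB hd hinj h2 hJ hR hfφ hh hρ
  -- Any germ of the apartment at the point serves as center. The fiber over the point is trivial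
  -- because every y lies in a chart containing the germ, on which the retraction is injective.
  · rintro _ ⟨f, hf, rfl⟩ _ ⟨a, rfl⟩
    set h := f ∘ Equiv.addRight a with hhdef
    have hh : h ∈ saturate P 𝒜 := hfull.comp f (subset_saturate P hf) _ (addRight_mem P a)
    have hr : Set.range h = Set.range f := range_comp_perm f _
    have h0 : h 0 = f a := by
      show f (0 + a) = f a
      rw [zero_add]
    obtain ⟨ρ, hρ⟩ := exists_coordinates hB hfull hJ hh
    have hρh := hρ h hh (GermEq.refl P B h)
    rw [← h0, ← hr]
    refine ⟨h ∘ ρ, fun y => ⟨_, rfl⟩, ?_, nonIncreasing_comp hB hd hinj h2 hJ hR hh hh hρ, ?_⟩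
    · rintro _ ⟨b, rfl⟩
      rw [Function.comp_apply, hρh]
    · ext y
      constructor
      · intro hy
        obtain ⟨g, hg, ⟨b, rfl⟩, hgh⟩ := hJ y h hh
        have h1 : h (ρ (g b)) = h 0 := hy
        rw [hρ g hg hgh] at h1
        rw [hfull.inj h hh h1, hgh.apply_zero]
        rfl
      · rintro rfl
        show h (ρ (h 0)) = h 0
        rw [hρh]

end

end GenBuilding

end

open scoped TensorProduct in
theorem mainTheorem7 {F : Subfield ℝ} {ι V N Λ X : Type*} [Fintype ι]
    [AddCommGroup V] [Module F V] [AddCommGroup N] [Module F N]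
    [AddCommGroup Λ] [LinearOrder Λ] [IsOrderedAddMonoid Λ] [Nontrivial Λ]
    [Module F Λ] [IsOrderedModule F Λ]
    (P : RootPairing ι F V N) [P.IsRootSystem]
    (B : Set ι) (hB : GenBuilding.IsRootBasis P B)
    (T : AddSubgroup (V ⊗[F] Λ)) (hT : GenBuilding.WeylInvariant P T)
    (d : V ⊗[F] Λ → V ⊗[F] Λ → Λ) (hd : GenBuilding.IsModelMetric P d)
    (𝒜 : Set (V ⊗[F] Λ → X)) (hinj : ∀ f ∈ 𝒜, Function.Injective f)
    (h : (GenBuilding.A1 P T 𝒜 ∧ GenBuilding.A2 P T 𝒜 ∧ GenBuilding.A3 𝒜 ∧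
            GenBuilding.A4 P B 𝒜 ∧ GenBuilding.TI d 𝒜 ∧ GenBuilding.SC P B 𝒜) ∨
         (GenBuilding.A1 P T 𝒜 ∧ GenBuilding.A2 P T 𝒜 ∧
            GenBuilding.ALA P B d 𝒜 ∧ GenBuilding.FC P B d 𝒜)) :
    (∀ (A : Set X) (x : X) (μ : Set (Set X)),
        GenBuilding.IsApartment 𝒜 A → GenBuilding.IsChamberGerm P B d 𝒜 μ x →
        GenBuilding.GermIn d 𝒜 μ x A →
          (∃! r : X → X, GenBuilding.IsGermRetraction P T d 𝒜 A μ x r) ∧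
          ∀ r : X → X, GenBuilding.IsGermRetraction P T d 𝒜 A μ x r →
            GenBuilding.NonIncreasing d 𝒜 r) ∧
      GenBuilding.A5 d 𝒜 := by
  rcases h with ⟨_, h2, h3, h4, _, hSC⟩ | ⟨_, h2, hALA, hFC⟩
  · have hfull := GenBuilding.isFullAtlas_saturate hinj h2
    have hS := GenBuilding.sundial_saturate hfull hSC
    have h4' := GenBuilding.subchambersJoin_saturate hB hfull h4
    have hP : ∀ x y, ∃ f ∈ GenBuilding.saturate P 𝒜, x ∈ Set.range f ∧ y ∈ Set.range f := by
      intro x y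
      obtain ⟨f, hf, hx, hy⟩ := h3 x y
      exact ⟨f, GenBuilding.subset_saturate P hf, hx, hy⟩
    refine GenBuilding.retractions_of_germsJoin hB hd hinj h2
      (GenBuilding.germsJoin_of_sundial hB hfull hS h4' hP) ?_
    intro k hk z p v a ha
    obtain ⟨𝒬, hfin, h𝒬, hcov⟩ := GenBuilding.exists_finite_cover hB hfull hS h4' hP hk z
    exact ⟨𝒬, hfin, h𝒬, fun t _ _ => hcov _⟩
  · exact GenBuilding.retractions_of_germsJoin hB hd hinj h2
      (GenBuilding.germsJoin_of_ALA hd hinj h2 hALA)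
      (GenBuilding.raysCovered_of_FC hd hinj h2 hFC)
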